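/- **Setting.** Let $X$ be a Banach space and let $A:D(A)\subset X\to X$ be the generator of a semigroup $(S(t))_{t\ge 0}$ of bounded linear operators on $X$ (not necessarily strongly continuous at $0$; for large real $z$, $(z-A)^{-1}f=\int_0^\infty e^{-zt}S(t)f\,dt$). Assume that every $S(t)$ is injective and that there are Banach spaces $X_\lambda$, $\lambda\in[0,2)$, with $X_0=X$, $X_1=D(A)$ and $X_\lambda$ continuously embedded in $X_\beta$ if $\beta<\lambda$, such that for every $T>0$ there are positive constants with $$\|S(t)\|_{\mathscr L(X_\zeta,X_\lambda)}\le L_{\zeta,\lambda,T}\,t^{-\lambda+\zeta}\quad(0\le\zeta\le\lambda<2),\qquad \|S(t)-I\|_{\mathscr L(X_\mu,X_\nu)}\le C_{\mu,\nu,T}\,t^{\mu-\nu}\quad(0\le\nu<\mu\le1)$$ for all $t\in(0,T]$. Let $x\in C^\eta([0,1];\mathbb R)$ with $\eta\in(1/2,1)$, let $\alpha\in(0,1)$ with $\eta+\alpha>1$, let $\omega\ge1$, and let $\sigma:X\to X$ be Gâteaux differentiable with bounded Gâteaux derivative $\sigma'$. Assume that $\sigma$ maps $X_\alpha$ into itself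 and that there are positive constants $K,K',L$ such that, for every $R>0$, all $u,v\in X_\alpha$ with $\|u\|_{X_\alpha},\|v\|_{X_\alpha}\le R$ and all $h\in X$, $$\|\sigma(u)-\sigma(v)\|_{X_\alpha}\le K(1+R)^\omega\|u-v\|_{X_\alpha},\qquad \|\sigma'(u)h-\sigma'(v)h\|_X\le K'(1+R)^{\omega-1}\|u-v\|_{X_\alpha}\|h\|_X,$$ and $\|\sigma(u)\|_{X_\alpha}\le L(1+\|u\|_{X_\alpha})$ for all $u\in X_\alpha$. **Notation.** For $f:[0,1]\to X$ put $(\hat\delta_1f)(s,t)=f(t)-S(t-s)f(s)$. For $\gamma\ge0$, $Y^\alpha_{-\gamma}(0,1)$ is the set of all $f:[0,1]\to X$ such that $f:(0,1]\to X_\alpha$ is continuous with $\sup_{0<t\le1}t^\gamma\|f(t)\|_{X_\alpha}<\infty$, $f:(0,1]\to X$ is continuous and bounded, and $\hat\delta_1f$ is continuous from $\{0\le s\le t\le1\}$ to $X_\alpha$, vanishes for $s=t$ and satisfies $\|(\hat\delta_1f)(s,t)\|_{X_\alpha}\le C(t-s)^\alpha$. *Convolution integral.* Let $\varphi:(a,b]\to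 X$. Suppose that there are $0\le\beta\le\alpha'<2$ with $\alpha'-\beta<1$, $\eta'\in(0,1)$, $\rho'\in(1-\eta',1)$ and $\gamma'\in[0,\min\{\eta',\rho'+\eta'+\beta-\alpha'\})$ such that $x\in C^{\eta'}([a,b])$; $\varphi$ is continuous from $(a,b]$ to $X_{\alpha'}$ with $\sup_{a<t\le b}(t-a)^{\gamma'}\|\varphi(t)\|_{X_{\alpha'}}<\infty$; and $\hat\delta_1\varphi$ is continuous from $\{a<s\le t\le b\}$ to $X_\beta$ with $\|(\hat\delta_1\varphi)(s,t)\|_{X_\beta}\le C(s-a)^{-\gamma'}(t-s)^{\rho'}$. Put $g(s,t)=(x(t)-x(s))\varphi(s)$. There is a unique $M$ on $\{a<s\le t\le b\}$ such that, for all $\tau\in(0,b-a)$ and all $\varepsilon\in[0,1)$ with $\beta+\varepsilon<2$, $M$ is continuous from $\{a+\tau\le s\le t\le b\}$ to $X_{\beta+\varepsilon}$, vanishes for $s=t$ and satisfies $\|M(s,t)\|_{X_{\beta+\varepsilon}}\le C(t-s)^{\eta'+\rho'-\varepsilon}$, and such that for $a<r\le s\le t\le b$ $$M(r,t)-M(s,t)-S(t-s)M(r,s)=S(t-s)\big[S(s-r)(g(r,t)-g(r,s))-g(s,t)\big].$$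 One then sets $\int_s^tS(t-r)\varphi(r)\,dx(r):=S(t-s)g(s,t)-M(s,t)$ for $a<s\le t\le b$, extended to $s=a$ by the limit in $X$ as $s\to a^+$ if $t>a$, and by $0$ if $t=a$. A *mild solution* of $$dy(t)=Ay(t)\,dt+\sigma(y(t))\,dx(t),\quad t\in(0,1],\qquad y(0)=\psi,\tag{1}$$ is a function $y:[0,1]\to X$ for which this integral with $\varphi=\sigma\circ y$ on $[0,1]$ is well defined and $y(t)=S(t)\psi+\int_0^tS(t-r)\sigma(y(r))\,dx(r)$ for every $t\in[0,1]$. **Theorem.** Let $\theta\in[0,\alpha]$ satisfy $\eta>\alpha+(1+\omega)(\alpha-\theta)$. Then: 1. For every $\psi\in X_\theta$ there is a unique mild solution $y$ of (1) which belongs to $Y^\alpha_{\theta-\alpha}(0,1)$. 2. For every $\rho\in[\eta+\alpha-1,\eta+\alpha)$ this solution belongs to $C((0,1];X_\rho)$ and to $C^{\min\{\eta,\,\eta+\alpha-\rho\}}_{\rm loc}((0,1];X_\rho)$. In particular, it belongs to $C^{\eta+\alpha-\rho}_{\rm loc}((0,1];X_\rho)$ for every $\rho\in[\alpha,\eta+\alpha)$.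 3. For every $\mu\in[0,\eta+\alpha-1)$ there is a positive constant $\mathfrak C$, depending on $\psi$ only through $\|\psi\|_{X_\theta}$ (and on $\alpha,\theta,x,\eta,\sigma,\mu,\omega$ and on the semigroup and the spaces $X_\lambda$), such that $\|y(t)\|_{X_{1+\mu}}\le\mathfrak C\,t^{\theta-1-\mu}$ for every $t\in(0,1]$. -/

import Mathlib

open Set Filter Topology

universe u v

/-- A decreasing family of Banach spaces `X_l`, `l ∈ [0, 2)`, continuously embedded in the space
`E = X_0`. The space `X_l` is the type `Sp l`, and `incl l` is its embedding into `E`. Only the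
indices in `[0, 2)` are ever used. -/
structure BanachScale (E : Type u) [NormedAddCommGroup E] [NormedSpace ℝ E] where
  Sp : ℝ → Type v
  [instGroup : ∀ l, NormedAddCommGroup (Sp l)]
  [instSpace : ∀ l, NormedSpace ℝ (Sp l)]
  [instComplete : ∀ l, CompleteSpace (Sp l)]
  /-- the embedding of `X_l` into `E` -/
  incl : ∀ l, Sp l →L[ℝ] E
  incl_injective : ∀ l ∈ Ico (0 : ℝ) 2, Function.Injective (incl l)
  /-- `X_0 = E`, with the same norm -/
  incl_zero_surjective : Function.Surjective (incl 0)
  norm_incl_zero : ∀ w : Sp 0, ‖incl 0 w‖ = ‖w‖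
  /-- for `b < l` the space `X_l` is continuously embedded in `X_b` -/
  embed : ∀ b ∈ Ico (0 : ℝ) 2, ∀ l ∈ Ico (0 : ℝ) 2, b < l →
    ∃ j : Sp l →L[ℝ] Sp b, ∀ w, incl b (j w) = incl l w

attribute [instance] BanachScale.instGroup BanachScale.instSpace BanachScale.instComplete

section Increments

variable {E : Type u} [NormedAddCommGroup E] [NormedSpace ℝ E]

/-- `(δ̂₁ f)(s,t) = f(t) - S(t-s) f(s)`. -/
def hatDeltaOne (S : ℝ → E →L[ℝ] E) (f : ℝ → E) (s t : ℝ) : E :=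
  f t - S (t - s) (f s)

/-- `(δ̂₂ F)(r,s,t) = F(r,t) - F(s,t) - S(t-s) F(r,s)`. -/
def hatDeltaTwo (S : ℝ → E →L[ℝ] E) (F : ℝ → ℝ → E) (r s t : ℝ) : E :=
  F r t - F s t - S (t - s) (F r s)

/-- `(δ_{S,2} g)(r,s,t) = S(s-r) [g(r,t) - g(r,s)] - g(s,t)`. -/
def deltaSTwo (S : ℝ → E →L[ℝ] E) (g : ℝ → ℝ → E) (r s t : ℝ) : E :=
  S (s - r) (g r t - g r s) - g s t

/-- `A` is the generator of the (possibly not strongly continuous) semigroup `S`: for all large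
real `z`, the operator `z - A : D(A) → E` is bijective and its inverse is the Laplace transform
`f ↦ ∫₀^∞ e^{-zt} S(t) f dt`. -/
def IsGeneratorOf (A : E →ₗ.[ℝ] E) (S : ℝ → E →L[ℝ] E) : Prop :=
  ∃ z₀ : ℝ, ∀ z : ℝ, z₀ < z → ∀ f : E,
    MeasureTheory.IntegrableOn (fun t : ℝ => Real.exp (-(z * t)) • S t f) (Ioi 0) ∧
    ∀ w : E, (∃ d : A.domain, (d : E) = w ∧ z • w - A d = f) ↔
      w = ∫ t in Ioi (0 : ℝ), Real.exp (-(z * t)) • S t f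

end Increments

namespace BanachScale

variable {E : Type u} [NormedAddCommGroup E] [NormedSpace ℝ E] (X : BanachScale.{u, v} E)

/-- `w ∈ X_l` and `‖w‖_{X_l} ≤ c`. -/
def NormLE (l : ℝ) (w : E) (c : ℝ) : Prop :=
  ∃ v : X.Sp l, X.incl l v = w ∧ ‖v‖ ≤ c

/-- `f` takes its values on `D` in `X_l` and is continuous on `D` as an `X_l`-valued function. -/
def ContOn {P : Type*} [TopologicalSpace P] (l : ℝ) (D : Set P) (f : P → E) : Prop :=
  ∃ g : P → X.Sp l, ContinuousOn g D ∧ ∀ p ∈ D, X.incl l (g p) = f p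

/-- `f ∈ C^r_loc((0,1]; X_l)`: `f` is `X_l`-valued on `(0,1]` and `r`-Hölder continuous on every
interval `[ε,1]`, `0 < ε ≤ 1`. -/
def LocHolder (l r : ℝ) (f : ℝ → E) : Prop :=
  ∃ g : ℝ → X.Sp l, (∀ t ∈ Ioc (0 : ℝ) 1, X.incl l (g t) = f t) ∧
    ∀ ε ∈ Ioc (0 : ℝ) 1, ∃ C : NNReal, HolderOnWith C r.toNNReal g (Icc ε 1)

/-- `f ∈ 𝒞_{-γ}((a,b]; X_l)`. -/
def MemSing (l γ a b : ℝ) (f : ℝ → E) : Prop :=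
  X.ContOn l (Ioc a b) f ∧
    ∃ C : ℝ, ∀ t ∈ Ioc a b, X.NormLE l (f t) (C * (t - a) ^ (-γ))

/-- `F ∈ 𝒞^r([a,b]²_<; X_l)`. -/
def MemIncr (l r a b : ℝ) (F : ℝ → ℝ → E) : Prop :=
  X.ContOn l {p : ℝ × ℝ | a ≤ p.1 ∧ p.1 ≤ p.2 ∧ p.2 ≤ b} (fun p => F p.1 p.2) ∧
    (∀ s ∈ Icc a b, F s s = 0) ∧
    ∃ C : ℝ, ∀ s t : ℝ, a ≤ s → s < t → t ≤ b → X.NormLE l (F s t) (C * (t - s) ^ r)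

/-- `F ∈ 𝒞^r_{-γ}((a,b]²_<; X_l)`. -/
def MemIncrSing (l r γ a b : ℝ) (F : ℝ → ℝ → E) : Prop :=
  X.ContOn l {p : ℝ × ℝ | a < p.1 ∧ p.1 ≤ p.2 ∧ p.2 ≤ b} (fun p => F p.1 p.2) ∧
    (∀ s ∈ Ioc a b, F s s = 0) ∧
    ∃ C : ℝ, ∀ s t : ℝ, a < s → s < t → t ≤ b →
      X.NormLE l (F s t) (C * (s - a) ^ (-γ) * (t - s) ^ r)

/-- `f ∈ Y^α_{-γ}(0,1)`. -/
def MemY (S : ℝ → E →L[ℝ] E) (α γ : ℝ) (f : ℝ → E) : Prop :=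
  X.MemSing α γ 0 1 f ∧ X.MemSing 0 0 0 1 f ∧ X.MemIncr α α 0 1 (hatDeltaOne S f)

/-- The standing assumptions on the scale, the semigroup `(S(t))_{t ≥ 0}` and its generator `A`.
(The values of `S` at negative times play no role.) -/
structure IsSmoothingSemigroup (S : ℝ → E →L[ℝ] E) (A : E →ₗ.[ℝ] E) : Prop where
  zero : S 0 = ContinuousLinearMap.id ℝ E
  add : ∀ s t : ℝ, 0 ≤ s → 0 ≤ t → S (s + t) = (S s).comp (S t)
  generator : IsGeneratorOf A S
  /-- `X_1 = D(A)`. By the closed graph theorem the norm of `X_1` is then equivalent to the graph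
  norm of `A`. -/
  range_incl_one : range (X.incl 1) = (A.domain : Set E)
  /-- `‖S(t)‖_{L(X_ζ, X_l)} ≤ L t^{-l+ζ}` on `(0,T]` -/
  smoothing : ∀ ζ l : ℝ, 0 ≤ ζ → ζ ≤ l → l < 2 → ∀ T : ℝ, 0 < T →
    ∃ L : ℝ, 0 < L ∧ ∀ t ∈ Ioc 0 T, ∀ w : X.Sp ζ,
      X.NormLE l (S t (X.incl ζ w)) (L * t ^ (-l + ζ) * ‖w‖)
  /-- `‖S(t) - I‖_{L(X_μ, X_ν)} ≤ C t^{μ-ν}` on `(0,T]` -/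
  approx : ∀ μ ν : ℝ, 0 ≤ ν → ν < μ → μ ≤ 1 → ∀ T : ℝ, 0 < T →
    ∃ C : ℝ, 0 < C ∧ ∀ t ∈ Ioc 0 T, ∀ w : X.Sp μ,
      X.NormLE ν (S t (X.incl μ w) - X.incl μ w) (C * t ^ (μ - ν) * ‖w‖)
  injective : ∀ t : ℝ, 0 ≤ t → Function.Injective (S t)

/-- `k(s,t) = ∫_s^t S(t-r) φ(r) dx(r)` for `a ≤ s ≤ t ≤ b`. The function `φ` may be singular at
`a`. With `g(s,t) = (x(t) - x(s)) φ(s)` and `M` the sewing map of `δ_{S,2} g`, that is, the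
(unique) regular function with `δ̂₂ M (r,s,t) = S(t-s) (δ_{S,2} g)(r,s,t)`, the integral is
`S(t-s) g(s,t) - M(s,t)` for `s > a`, and is extended by continuity to `s = a`. That `k` exists
means that the integral is well defined. -/
def IsConvIntegral (S : ℝ → E →L[ℝ] E) (a b : ℝ) (x : ℝ → ℝ) (φ : ℝ → E)
    (k : ℝ → ℝ → E) : Prop :=
  ∃ α β η ρ γ : ℝ,
    (0 ≤ β ∧ β ≤ α ∧ α < 2 ∧ α - β < 1) ∧ η ∈ Ioo (0 : ℝ) 1 ∧ ρ ∈ Ioo (1 - η) 1 ∧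
    γ ∈ Ico 0 (min η (ρ + η + β - α)) ∧
    (∃ C : NNReal, HolderOnWith C η.toNNReal x (Icc a b)) ∧
    X.MemSing α γ a b φ ∧
    X.MemIncrSing β ρ γ a b (hatDeltaOne S φ) ∧
    ∃ M : ℝ → ℝ → E,
      (∀ τ ∈ Ioo 0 (b - a), ∀ ε ∈ Ico (0 : ℝ) 1, β + ε < 2 →
        X.MemIncr (β + ε) (η + ρ - ε) (a + τ) b M) ∧
      (∀ r s t : ℝ, a < r → r ≤ s → s ≤ t → t ≤ b →
        hatDeltaTwo S M r s t
          = S (t - s) (deltaSTwo S (fun s t => (x t - x s) • φ s) r s t)) ∧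
      (∀ s t : ℝ, a < s → s ≤ t → t ≤ b →
        k s t = S (t - s) ((x t - x s) • φ s) - M s t) ∧
      (∀ t ∈ Ioc a b, Tendsto (fun s => k s t) (𝓝[>] a) (𝓝 (k a t))) ∧
      k a a = 0

/-- `y` is a mild solution on `[0,1]` of `dy = A y dt + σ(y) dx`, `y(0) = ψ`. -/
def IsMildSolution (S : ℝ → E →L[ℝ] E) (σ : E → E) (x : ℝ → ℝ) (ψ : E) (y : ℝ → E) : Prop :=
  ∃ k : ℝ → ℝ → E, X.IsConvIntegral S 0 1 x (fun t => σ (y t)) k ∧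
    ∀ t ∈ Icc (0 : ℝ) 1, y t = S t ψ + k 0 t

/-- The assumptions on the nonlinear term: `σ : E → E` is Gateaux differentiable with bounded
derivative `σ'`, maps `X_α` into itself, is locally Lipschitz there with growth `(1+R)^ω` and of
linear growth, and `σ'` is locally Lipschitz from `X_α` to `L(E)` with growth `(1+R)^(ω-1)`. -/
structure IsAdmissibleNonlinearity (σ : E → E) (α ω : ℝ) : Prop where
  gateaux : ∃ σ' : E → E →L[ℝ] E,
    (∀ w h : E, HasLineDerivAt ℝ σ (σ' w h) w h) ∧
    (∃ C : ℝ, ∀ w : E, ‖σ' w‖ ≤ C) ∧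
    ∃ K : ℝ, 0 < K ∧ ∀ R : ℝ, 0 < R → ∀ w₁ w₂ : X.Sp α, ‖w₁‖ ≤ R → ‖w₂‖ ≤ R → ∀ h : E,
      ‖σ' (X.incl α w₁) h - σ' (X.incl α w₂) h‖ ≤ K * (1 + R) ^ (ω - 1) * ‖w₁ - w₂‖ * ‖h‖
  restriction : ∃ σα : X.Sp α → X.Sp α,
    (∀ w, X.incl α (σα w) = σ (X.incl α w)) ∧
    (∃ K : ℝ, 0 < K ∧ ∀ R : ℝ, 0 < R → ∀ w₁ w₂ : X.Sp α, ‖w₁‖ ≤ R → ‖w₂‖ ≤ R →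
      ‖σα w₁ - σα w₂‖ ≤ K * (1 + R) ^ ω * ‖w₁ - w₂‖) ∧
    ∃ L : ℝ, 0 < L ∧ ∀ w : X.Sp α, ‖σα w‖ ≤ L * (1 + ‖w‖)

end BanachScale

/-! The integral equation is first traded for a local description. A path `u` solves `du = A u dt +
φ dx` when the germ remainder `δ̂₁u(s,t) - S(t-s)(x(t)-x(s))φ(s)` has order larger than one in `t -
s`, in the norm of `E` and away from the initial time, and the initial value is attained weakly
(`IsPrimitive`, `IsSolution`). This condition is qualitative and stable under differences and
restriction; sewing makes it quantitative. When an interval is bisected, the remainder is additive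
up to a defect of order `η + ρ > 1` (`germRemainder_split`), so under repeated bisection the unknown
remainder disappears and only the summed defects survive (`exists_sewing_zero`). Cutting instead at
points that accumulate at the right end leaves a positive time of the semigroup in front of every
term, which lifts the estimate to `X_l` for all `l < η + ρ`, `l < 2` (`exists_sewing`).

A solution started in `X_θ` may blow up in `X_α` like `t^{-γ}` with `γ = α - θ`, so the analysis
runs with weights at the initial time: values in `X_α` and `ρ`-Hölder increments. The auxiliary
exponent satisfies `1 - η < ρ < min(α, 1 - α)`. The lower bound permits sewing; the upper one gives
`α + ρ ≤ 1`, so that regularity in `X_{α+ρ}` converts into `ρ`-Hölder continuity in `X_α`. The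
linear estimate (`exists_pathBound`) carries a small factor `(b-a)^{η-α-g}`, where `g` is the weight
of the forcing. The nonlinearity keeps the weight `γ`, with linear growth, but a difference `σ(y) -
σ(z)` meets Lipschitz constants of size `(1 + R t^{-γ})^ω` and has weight `(1+ω)γ`
(`exists_forcingBound_sub`). The hypothesis on `θ` says exactly `(1+ω)γ < η - α`: on short intervals
the solution map is a contraction. It is defined because linear equations are solvable, by
mollifying `x` and passing to the limit in a weaker Hölder norm (`exists_isSolution`).

Because `σ` grows linearly, the a priori bound holds on intervals whose length does not depend on
the initial value (`exists_apriori_local`). After the first short interval the path lies in `X_α`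
and restarts need no weight. Finitely many steps therefore bound the solution on `[0,1]` in terms of
the norm of `ψ` alone, and uniqueness and existence become global by restarting and gluing.

These bounds show that `y` is `α`-Hölder in `E` with weight `γ`, so sewing can be repeated with `α`
in place of `ρ`, reaching `X_l` for `l < η + α`. Restarting at `t/2` yields the blow-up rate for `l
≥ α`; Hölder continuity in `X_l`, where `l` may exceed one, follows by pushing the past of the path
dyadically through the semigroup (`exists_smooth_increment_bound`). Finally the local notion is
matched with mild solutions: the convolution integral is `δ̂₁y` and the sewing map is minus the germ
remainder. -/

namespace BanachScale

variable {E : Type u} [NormedAddCommGroup E] [NormedSpace ℝ E] {X : BanachScale.{u, v} E}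

/-! ### Calculus of norm bounds in the scale -/

section NormLE

variable {l : ℝ} {w z : E} {c d : ℝ}

theorem NormLE.nonneg (h : X.NormLE l w c) : 0 ≤ c := by
  obtain ⟨v, -, hv⟩ := h
  exact (norm_nonneg v).trans hv

theorem NormLE.mono (h : X.NormLE l w c) (hcd : c ≤ d) : X.NormLE l w d := by
  obtain ⟨v, hv, hc⟩ := h
  exact ⟨v, hv, hc.trans hcd⟩

theorem NormLE.add (h : X.NormLE l w c) (h' : X.NormLE l z d) : X.NormLE l (w + z) (c + d) := by
  obtain ⟨v, hv, hc⟩ := h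
  obtain ⟨v', hv', hc'⟩ := h'
  exact ⟨v + v', by rw [map_add, hv, hv'], (norm_add_le _ _).trans (add_le_add hc hc')⟩

theorem NormLE.smul (h : X.NormLE l w c) (r : ℝ) : X.NormLE l (r • w) (|r| * c) := by
  obtain ⟨v, hv, hc⟩ := h
  refine ⟨r • v, by rw [map_smul, hv], ?_⟩
  rw [norm_smul, Real.norm_eq_abs]
  gcongr

theorem NormLE.neg (h : X.NormLE l w c) : X.NormLE l (-w) c := by
  obtain ⟨v, hv, hc⟩ := h
  exact ⟨-v, by rw [map_neg, hv], by rwa [norm_neg]⟩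

theorem NormLE.sub (h : X.NormLE l w c) (h' : X.NormLE l z d) : X.NormLE l (w - z) (c + d) := by
  rw [sub_eq_add_neg]
  exact h.add h'.neg

theorem NormLE.sub_comm (h : X.NormLE l (w - z) c) : X.NormLE l (z - w) c := by
  rw [← neg_sub]
  exact h.neg

theorem normLE_zero_vector (hc : 0 ≤ c) : X.NormLE l 0 c :=
  ⟨0, map_zero _, by simpa using hc⟩

theorem normLE_zero_iff : X.NormLE 0 w c ↔ ‖w‖ ≤ c := by
  constructor
  · rintro ⟨v, rfl, hv⟩
    rwa [X.norm_incl_zero]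
  · intro h
    obtain ⟨v, rfl⟩ := X.incl_zero_surjective w
    exact ⟨v, rfl, by rwa [← X.norm_incl_zero]⟩

theorem normLE_incl (v : X.Sp l) : X.NormLE l (X.incl l v) ‖v‖ := ⟨v, rfl, le_rfl⟩

theorem normLE_incl_iff (hl : l ∈ Ico (0 : ℝ) 2) {v : X.Sp l} :
    X.NormLE l (X.incl l v) c ↔ ‖v‖ ≤ c := by
  constructor
  · rintro ⟨v', hv', hc⟩
    rwa [← X.incl_injective l hl hv']
  · exact fun h => ⟨v, rfl, h⟩

/-- The bound in `NormLE` may be replaced by a limit of bounds. -/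
theorem normLE_of_tendsto (hl : l ∈ Ico (0 : ℝ) 2) {C : ℕ → ℝ} (h : ∀ n, X.NormLE l w (C n))
    (hC : Tendsto C atTop (𝓝 c)) : X.NormLE l w c := by
  obtain ⟨v, rfl, -⟩ := h 0
  rw [normLE_incl_iff hl]
  exact ge_of_tendsto' hC fun n => (normLE_incl_iff hl).1 (h n)

variable (X) in
theorem exists_normLE_embed {b l : ℝ} (hb : 0 ≤ b) (hbl : b ≤ l) (hl : l < 2) :
    ∃ C : ℝ, 1 ≤ C ∧ ∀ (w : E) (c : ℝ), X.NormLE l w c → X.NormLE b w (C * c) := by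
  rcases hbl.eq_or_lt with rfl | hlt
  · exact ⟨1, le_rfl, fun w c h => by rwa [one_mul]⟩
  · obtain ⟨j, hj⟩ := X.embed b ⟨hb, hlt.trans hl⟩ l ⟨hb.trans hbl, hl⟩ hlt
    refine ⟨max 1 ‖j‖, le_max_left _ _, ?_⟩
    rintro w c ⟨v, rfl, hv⟩
    refine ⟨j v, hj v, (j.le_opNorm v).trans ?_⟩
    gcongr
    exact le_max_right _ _

/-- A sequence with geometrically decreasing increments in `X_l` converges in `X_l`. -/
theorem normLE_of_geometric {z : ℕ → E} {z' : E} {C q : ℝ} (hq0 : 0 ≤ q) (hq1 : q < 1)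
    (h : ∀ n, X.NormLE l (z n - z (n + 1)) (C * q ^ n)) (hz : Tendsto z atTop (𝓝 z')) :
    X.NormLE l (z 0 - z') (C / (1 - q)) := by
  choose v hv hvn using h
  have hs : Summable fun n => C * q ^ n := (summable_geometric_of_lt_one hq0 hq1).mul_left C
  have hsum : Summable fun n => ‖v n‖ := Summable.of_nonneg_of_le (fun _ => norm_nonneg _) hvn hs
  -- The lifted increments are summable in the complete space `X_l`; their sum is identified in `E`,
  -- the only space where convergence of `z` is known.
  refine ⟨∑' n, v n, ?_, ?_⟩
  · have h1 : Tendsto (fun n => X.incl l (∑ i ∈ Finset.range n, v i)) atTop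
        (𝓝 (X.incl l (∑' n, v n))) :=
      ((X.incl l).continuous.tendsto _).comp hsum.of_norm.hasSum.tendsto_sum_nat
    have h2 : (fun n => X.incl l (∑ i ∈ Finset.range n, v i)) = fun n => z 0 - z n := by
      funext n
      simp only [map_sum, hv]
      exact Finset.sum_range_sub' z n
    rw [h2] at h1
    exact tendsto_nhds_unique h1 (tendsto_const_nhds.sub hz)
  · refine (norm_tsum_le_tsum_norm hsum).trans ?_
    refine (hsum.tsum_le_tsum hvn hs).trans (le_of_eq ?_)
    rw [tsum_mul_left, tsum_geometric_of_lt_one hq0 hq1, div_eq_mul_inv]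

/-- Since the embedding is injective, every pointwise lift to `X_l` is the lift, and its continuity
can be tested on differences taken in `E`. -/
theorem contOn_of_normLE {P : Type*} [TopologicalSpace P] (hl : l ∈ Ico (0 : ℝ) 2) {D : Set P}
    {f : P → E} (h1 : ∀ p ∈ D, ∃ c, X.NormLE l (f p) c)
    (h2 : ∀ p ∈ D, ∀ ε > 0, ∀ᶠ q in 𝓝[D] p, X.NormLE l (f q - f p) ε) : X.ContOn l D f := by
  classical
  have h3 : ∀ p, ∃ v : X.Sp l, p ∈ D → X.incl l v = f p := fun p => by
    by_cases hp : p ∈ D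
    · obtain ⟨c, v, hv, -⟩ := h1 p hp
      exact ⟨v, fun _ => hv⟩
    · exact ⟨0, fun h => absurd h hp⟩
  choose g hg using h3
  refine ⟨g, fun p hp => ?_, hg⟩
  rw [ContinuousWithinAt, Metric.tendsto_nhds]
  intro ε hε
  filter_upwards [h2 p hp (ε / 2) (half_pos hε), self_mem_nhdsWithin] with q hq hqD
  rw [← hg p hp, ← hg q hqD, ← map_sub, normLE_incl_iff hl] at hq
  rw [dist_eq_norm]
  linarith

theorem ContOn.eventually_normLE {P : Type*} [TopologicalSpace P] {D : Set P} {f : P → E}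
    (h : X.ContOn l D f) {p : P} (hp : p ∈ D) {ε : ℝ} (hε : 0 < ε) :
    ∀ᶠ q in 𝓝[D] p, X.NormLE l (f q - f p) ε := by
  obtain ⟨g, hg, hgf⟩ := h
  have h1 := Metric.tendsto_nhds.1 (hg p hp) ε hε
  filter_upwards [h1, self_mem_nhdsWithin] with q hq hqD
  rw [← hgf p hp, ← hgf q hqD, ← map_sub]
  rw [dist_eq_norm] at hq
  exact ⟨_, rfl, hq.le⟩

theorem ContOn.exists_normLE {P : Type*} [TopologicalSpace P] {D : Set P} {f : P → E}
    (h : X.ContOn l D f) {p : P} (hp : p ∈ D) : ∃ c, X.NormLE l (f p) c := by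
  obtain ⟨g, -, hgf⟩ := h
  exact ⟨_, g p, hgf p hp, le_rfl⟩

end NormLE

/-! ### Smoothing estimates on the unit time interval -/

section Smoothing

variable {S : ℝ → E →L[ℝ] E} {A : E →ₗ.[ℝ] E}

namespace IsSmoothingSemigroup

theorem apply_zero (hS : X.IsSmoothingSemigroup S A) (w : E) : S 0 w = w := by
  rw [hS.zero]; rfl

theorem apply_apply (hS : X.IsSmoothingSemigroup S A) {s t : ℝ} (hs : 0 ≤ s) (ht : 0 ≤ t) (w : E) :
    S s (S t w) = S (s + t) w := by
  rw [hS.add s t hs ht]; rfl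

/-- Constants are normalised to be at least one here and below, so that they can be multiplied and
enlarged without separate sign conditions. -/
theorem exists_smoothing (hS : X.IsSmoothingSemigroup S A) {ζ l : ℝ} (hζ : 0 ≤ ζ) (hζl : ζ ≤ l)
    (hl : l < 2) : ∃ L : ℝ, 1 ≤ L ∧ ∀ t ∈ Ioc (0 : ℝ) 1, ∀ w c, X.NormLE ζ w c →
      X.NormLE l (S t w) (L * t ^ (ζ - l) * c) := by
  obtain ⟨L, hL, h⟩ := hS.smoothing ζ l hζ hζl hl 1 one_pos
  refine ⟨max 1 L, le_max_left _ _, ?_⟩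
  rintro t ht w c ⟨v, rfl, hv⟩
  refine (h t ht v).mono ?_
  rw [neg_add_eq_sub]
  have : 0 ≤ t ^ (ζ - l) := Real.rpow_nonneg ht.1.le _
  gcongr
  exact le_max_right _ _

theorem exists_bound (hS : X.IsSmoothingSemigroup S A) {l : ℝ} (hl0 : 0 ≤ l) (hl : l < 2) :
    ∃ L : ℝ, 1 ≤ L ∧ ∀ t ∈ Icc (0 : ℝ) 1, ∀ w c, X.NormLE l w c →
      X.NormLE l (S t w) (L * c) := by
  obtain ⟨L, hL, h⟩ := hS.exists_smoothing hl0 le_rfl hl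
  refine ⟨L, hL, fun t ht w c hw => ?_⟩
  rcases ht.1.eq_or_lt with rfl | h0
  · rw [hS.apply_zero]
    exact hw.mono (le_mul_of_one_le_left hw.nonneg hL)
  · simpa using h t ⟨h0, ht.2⟩ w c hw

theorem exists_norm_bound (hS : X.IsSmoothingSemigroup S A) :
    ∃ L : ℝ, 1 ≤ L ∧ ∀ t ∈ Icc (0 : ℝ) 1, ∀ w, ‖S t w‖ ≤ L * ‖w‖ := by
  obtain ⟨L, hL, h⟩ := hS.exists_bound le_rfl two_pos
  exact ⟨L, hL, fun t ht w => normLE_zero_iff.1 (h t ht w _ (normLE_zero_iff.2 le_rfl))⟩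

theorem exists_approx (hS : X.IsSmoothingSemigroup S A) {μ ν : ℝ} (hν : 0 ≤ ν) (hνμ : ν < μ)
    (hμ : μ ≤ 1) : ∃ C : ℝ, 1 ≤ C ∧ ∀ t ∈ Icc (0 : ℝ) 1, ∀ w c, X.NormLE μ w c →
      X.NormLE ν (S t w - w) (C * t ^ (μ - ν) * c) := by
  obtain ⟨L, hL, h⟩ := hS.approx μ ν hν hνμ hμ 1 one_pos
  refine ⟨max 1 L, le_max_left _ _, ?_⟩
  rintro t ht w c ⟨v, rfl, hv⟩
  rcases ht.1.eq_or_lt with rfl | h0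
  · rw [hS.apply_zero, sub_self]
    have hc := (norm_nonneg v).trans hv
    exact normLE_zero_vector (by positivity)
  · refine (h t ⟨h0, ht.2⟩ v).mono ?_
    have : 0 ≤ t ^ (μ - ν) := Real.rpow_nonneg ht.1 _
    gcongr
    exact le_max_right _ _

/-- The combined estimate `‖(S(h) - I) S(t)‖_{L(X_ζ, X_l)} ≤ C h t^{ζ-1-l}`. -/
theorem exists_approx_smoothing (hS : X.IsSmoothingSemigroup S A) {ζ l : ℝ} (hζ : 0 ≤ ζ)
    (hζ1 : ζ ≤ 1) (hl0 : 0 ≤ l) (hl : l < 2) :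
    ∃ C : ℝ, 1 ≤ C ∧ ∀ h ∈ Icc (0 : ℝ) 1, ∀ t ∈ Ioc (0 : ℝ) 1, ∀ w c, X.NormLE ζ w c →
      X.NormLE l (S h (S t w) - S t w) (C * h * t ^ (ζ - 1 - l) * c) := by
  obtain ⟨L₁, hL₁, h₁⟩ := hS.exists_smoothing hζ hζ1 one_lt_two
  obtain ⟨L₂, hL₂, h₂⟩ := hS.exists_approx le_rfl one_pos le_rfl
  obtain ⟨L₃, hL₃, h₃⟩ := hS.exists_smoothing le_rfl hl0 hl
  refine ⟨max 1 (L₃ * L₂ * L₁ * (1 / 2 : ℝ) ^ (ζ - 1 - l)), le_max_left _ _, ?_⟩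
  intro h hh t ht w c hw
  have ht2 : t / 2 ∈ Ioc (0 : ℝ) 1 := ⟨half_pos ht.1, by linarith [ht.2, ht.1]⟩
  -- With `S(t) = S(t/2) S(t/2)`, the first half maps `X_ζ` to `X_1`, there `S(h) - I` gains the
  -- full power `h` into `X_0`, and the second half maps `X_0` to `X_l`.
  have e1 := h₃ _ ht2 _ _ (h₂ h hh _ _ (h₁ _ ht2 w c hw))
  have e2 : S (t / 2) (S h (S (t / 2) w) - S (t / 2) w) = S h (S t w) - S t w := by
    rw [map_sub, hS.apply_apply hh.1 ht2.1.le, hS.apply_apply ht2.1.le (by linarith [hh.1, ht2.1]),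
      hS.apply_apply ht2.1.le ht2.1.le, hS.apply_apply hh.1 ht.1.le]
    congr 3 <;> ring
  rw [e2] at e1
  refine e1.mono ?_
  have hc := hw.nonneg
  have e3 : (t / 2) ^ (0 - l) * (t / 2) ^ (ζ - 1) = (1 / 2 : ℝ) ^ (ζ - 1 - l) * t ^ (ζ - 1 - l) := by
    rw [← Real.rpow_add ht2.1, ← Real.mul_rpow (by norm_num) ht.1.le]
    congr 1 <;> ring
  have e4 : h ^ ((1 : ℝ) - 0) = h := by norm_num
  rw [e4]
  calc L₃ * (t / 2) ^ (0 - l) * (L₂ * h * (L₁ * (t / 2) ^ (ζ - 1) * c))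
      = L₃ * L₂ * L₁ * ((t / 2) ^ (0 - l) * (t / 2) ^ (ζ - 1)) * h * c := by ring
    _ = L₃ * L₂ * L₁ * (1 / 2 : ℝ) ^ (ζ - 1 - l) * h * t ^ (ζ - 1 - l) * c := by rw [e3]; ring
    _ ≤ _ := by
      have := Real.rpow_nonneg ht.1.le (ζ - 1 - l)
      have := hh.1
      gcongr
      exact le_max_right _ _

end IsSmoothingSemigroup

end Smoothing

end BanachScale

/-! ### Solutions of the linear equation described by germs -/

section Primitive

variable {E : Type u} [NormedAddCommGroup E] [NormedSpace ℝ E]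

/-- The remainder `(δ̂₁ u)(s,t) - S(t-s) (x(t) - x(s)) φ(s)`. -/
def germRemainder (S : ℝ → E →L[ℝ] E) (x : ℝ → ℝ) (u φ : ℝ → E) (s t : ℝ) : E :=
  hatDeltaOne S u s t - S (t - s) ((x t - x s) • φ s)

/-- `du = A u dt + φ dx` on `[s,t]`, in the sense that the increments of `u` agree with those of
the germ up to a power larger than one of the length. -/
def IsPrimitive (S : ℝ → E →L[ℝ] E) (x : ℝ → ℝ) (u φ : ℝ → E) (s t : ℝ) : Prop :=
  ∃ C p : ℝ, 0 ≤ C ∧ 1 < p ∧ ∀ r q, s ≤ r → r ≤ q → q ≤ t →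
    ‖germRemainder S x u φ r q‖ ≤ C * (q - r) ^ p

/-- `du = A u dt + φ dx` on `(a,b]`, with initial value `u(a)` attained in a weak sense. -/
def IsSolution (S : ℝ → E →L[ℝ] E) (x : ℝ → ℝ) (u φ : ℝ → E) (a b : ℝ) : Prop :=
  (∀ s ∈ Ioc a b, IsPrimitive S x u φ s b) ∧
    ∀ t ∈ Ioc a b, Tendsto (fun s => S (t - s) (u s)) (𝓝[>] a) (𝓝 (S (t - a) (u a)))

theorem IsPrimitive.mono {S : ℝ → E →L[ℝ] E} {x : ℝ → ℝ} {u φ : ℝ → E} {s t s' t' : ℝ}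
    (h : IsPrimitive S x u φ s t) (hs : s ≤ s') (ht : t' ≤ t) : IsPrimitive S x u φ s' t' := by
  obtain ⟨C, p, hC, hp, h⟩ := h
  exact ⟨C, p, hC, hp, fun r q h1 h2 h3 => h r q (hs.trans h1) h2 (h3.trans ht)⟩

theorem germRemainder_sub (S : ℝ → E →L[ℝ] E) (x : ℝ → ℝ) (u φ u' φ' : ℝ → E) (s t : ℝ) :
    germRemainder S x (u - u') (φ - φ') s t =
      germRemainder S x u φ s t - germRemainder S x u' φ' s t := by
  simp only [germRemainder, hatDeltaOne, Pi.sub_apply, map_sub, smul_sub]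
  abel

theorem germRemainder_sub_left (S : ℝ → E →L[ℝ] E) (x x' : ℝ → ℝ) (u φ u' : ℝ → E) (s t : ℝ) :
    germRemainder S (x - x') (u - u') φ s t =
      germRemainder S x u φ s t - germRemainder S x' u' φ s t := by
  simp only [germRemainder, hatDeltaOne, Pi.sub_apply, map_sub, sub_smul]
  abel

/-- Serves both differences of forcings and differences of driving paths. On length at most one, the
smaller of the two exponents bounds both remainders. -/
theorem isPrimitive_of_sub {S : ℝ → E →L[ℝ] E} {x x₁ x₂ : ℝ → ℝ} {u φ u₁ φ₁ u₂ φ₂ : ℝ → E}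
    {s t : ℝ} (hst : t - s ≤ 1) (h₁ : IsPrimitive S x₁ u₁ φ₁ s t)
    (h₂ : IsPrimitive S x₂ u₂ φ₂ s t)
    (h : ∀ r q, germRemainder S x u φ r q =
      germRemainder S x₁ u₁ φ₁ r q - germRemainder S x₂ u₂ φ₂ r q) : IsPrimitive S x u φ s t := by
  obtain ⟨C, p, hC, hp, h₁⟩ := h₁
  obtain ⟨C', p', hC', hp', h₂⟩ := h₂
  refine ⟨C + C', min p p', by positivity, lt_min hp hp', fun r q hsr hrq hqt => ?_⟩
  rw [h]
  have h0 : 0 ≤ q - r := by linarith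
  have h01 : q - r ≤ 1 := by linarith
  have h0' : 0 ≤ min p p' := by linarith [lt_min hp hp']
  have e1 : (q - r) ^ p ≤ (q - r) ^ min p p' :=
    Real.rpow_le_rpow_of_exponent_ge_of_imp h0 h01 (min_le_left _ _) (fun _ hp0 => by linarith)
  have e2 : (q - r) ^ p' ≤ (q - r) ^ min p p' :=
    Real.rpow_le_rpow_of_exponent_ge_of_imp h0 h01 (min_le_right _ _) (fun _ hp0 => by linarith)
  calc _ ≤ C * (q - r) ^ p + C' * (q - r) ^ p' :=
        (norm_sub_le _ _).trans (add_le_add (h₁ r q hsr hrq hqt) (h₂ r q hsr hrq hqt))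
    _ ≤ C * (q - r) ^ min p p' + C' * (q - r) ^ min p p' := by gcongr
    _ = _ := by ring

theorem IsPrimitive.sub {S : ℝ → E →L[ℝ] E} {x : ℝ → ℝ} {u φ u' φ' : ℝ → E} {s t : ℝ}
    (hst : t - s ≤ 1) (h : IsPrimitive S x u φ s t) (h' : IsPrimitive S x u' φ' s t) :
    IsPrimitive S x (u - u') (φ - φ') s t :=
  isPrimitive_of_sub hst h h' fun _ _ => germRemainder_sub ..

theorem IsSolution.sub {S : ℝ → E →L[ℝ] E} {x : ℝ → ℝ} {u φ u' φ' : ℝ → E} {a b : ℝ}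
    (hab : b - a ≤ 1) (h : IsSolution S x u φ a b) (h' : IsSolution S x u' φ' a b) :
    IsSolution S x (u - u') (φ - φ') a b := by
  refine ⟨fun s hs => (h.1 s hs).sub (by linarith [hs.1]) (h'.1 s hs), fun t ht => ?_⟩
  simpa only [Pi.sub_apply, map_sub] using (h.2 t ht).sub (h'.2 t ht)

theorem IsSolution.mono_right {S : ℝ → E →L[ℝ] E} {x : ℝ → ℝ} {u φ : ℝ → E} {a b b' : ℝ}
    (h : IsSolution S x u φ a b) (hb : b' ≤ b) : IsSolution S x u φ a b' :=
  ⟨fun s hs => (h.1 s ⟨hs.1, hs.2.trans hb⟩).mono le_rfl hb,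
    fun t ht => h.2 t ⟨ht.1, ht.2.trans hb⟩⟩

end Primitive

/-! ### Sewing estimates -/

namespace BanachScale.IsSmoothingSemigroup

variable {E : Type u} [NormedAddCommGroup E] [NormedSpace ℝ E] {X : BanachScale.{u, v} E}
  {S : ℝ → E →L[ℝ] E} {A : E →ₗ.[ℝ] E}

theorem hatDeltaOne_split (hS : X.IsSmoothingSemigroup S A) (u : ℝ → E) {r m q : ℝ} (h1 : r ≤ m)
    (h2 : m ≤ q) :
    hatDeltaOne S u r q = hatDeltaOne S u m q + S (q - m) (hatDeltaOne S u r m) := by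
  simp only [hatDeltaOne, map_sub]
  rw [hS.apply_apply (sub_nonneg.2 h2) (sub_nonneg.2 h1), sub_add_sub_cancel q m r]
  abel

/-- The last term is the only defect of additivity of the germ; it has order `η + ρ` when `x` is
`η`-Hölder and the increments `δ̂₁φ` have order `ρ`. -/
theorem germRemainder_split (hS : X.IsSmoothingSemigroup S A) (x : ℝ → ℝ) (u φ : ℝ → E)
    {r m q : ℝ} (h1 : r ≤ m) (h2 : m ≤ q) :
    germRemainder S x u φ r q = germRemainder S x u φ m q + S (q - m) (germRemainder S x u φ r m)
      + S (q - m) ((x q - x m) • hatDeltaOne S φ r m) := by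
  simp only [germRemainder]
  rw [hS.hatDeltaOne_split u h1 h2, map_sub, hS.apply_apply (sub_nonneg.2 h2) (sub_nonneg.2 h1),
    sub_add_sub_cancel q m r]
  simp only [hatDeltaOne, map_sub, smul_sub, map_smul]
  rw [hS.apply_apply (sub_nonneg.2 h2) (sub_nonneg.2 h1) (φ r), sub_add_sub_cancel q m r]
  module

/-- After `n` bisections the qualitative bound contributes `2^n (2^{-n})^p`, which vanishes as `p >
1`, while the defects form a geometric series as `η + ρ > 1`. Carrying `S(v)` through the induction
merges the semigroup factors into one operator, so that `L` is paid only once and not at every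
level. -/
theorem sewing_aux (hS : X.IsSmoothingSemigroup S A) {η ρ : ℝ} (hηρ : 1 < η + ρ) {L : ℝ}
    (hL1 : 1 ≤ L) (hL : ∀ t ∈ Icc (0 : ℝ) 1, ∀ w, ‖S t w‖ ≤ L * ‖w‖) {x : ℝ → ℝ} {u φ : ℝ → E}
    {s t H B C p : ℝ} (hH : 0 ≤ H) (hB : 0 ≤ B)
    (hx : ∀ r q, s ≤ r → r ≤ q → q ≤ t → |x q - x r| ≤ H * (q - r) ^ η)
    (hφ : ∀ r q, s ≤ r → r ≤ q → q ≤ t → ‖hatDeltaOne S φ r q‖ ≤ B * (q - r) ^ ρ)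
    (hu : ∀ r q, s ≤ r → r ≤ q → q ≤ t → ‖germRemainder S x u φ r q‖ ≤ C * (q - r) ^ p) (n : ℕ) :
    ∀ r q v, s ≤ r → r ≤ q → q ≤ t → 0 ≤ v → v + (q - r) ≤ 1 →
      ‖S v (germRemainder S x u φ r q)‖ ≤ L * C * (q - r) ^ p * ((2 : ℝ) ^ (1 - p)) ^ n
        + L * (H * B) * (1 / (1 - (2 : ℝ) ^ (1 - (η + ρ)))) * (q - r) ^ (η + ρ) := by
  have hG : 0 < 1 - (2 : ℝ) ^ (1 - (η + ρ)) := by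
    have := Real.rpow_lt_one_of_one_lt_of_neg (x := 2) one_lt_two
      (show 1 - (η + ρ) < 0 by linarith)
    linarith
  set G : ℝ := 1 / (1 - (2 : ℝ) ^ (1 - (η + ρ))) with hGdef
  have hG0 : 0 < G := by positivity
  -- `G` is the sum of the geometric series of defects; this fixed point equation is what closes the
  -- induction step.
  have hGeq : 1 + (2 : ℝ) ^ (1 - (η + ρ)) * G = G := by
    rw [hGdef]; field_simp; ring
  induction n with
  | zero =>
    intro r q v h1 h2 h3 hv hv1
    have h0 : 0 ≤ q - r := by linarith
    have e1 := hL v ⟨hv, by linarith⟩ (germRemainder S x u φ r q)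
    have e2 := hu r q h1 h2 h3
    have e3 : 0 ≤ L * (H * B) * G * (q - r) ^ (η + ρ) := by positivity
    have e4 : L * ‖germRemainder S x u φ r q‖ ≤ L * (C * (q - r) ^ p) := by gcongr
    simp only [pow_zero, mul_one]
    linarith
  | succ n ih =>
    intro r q v h1 h2 h3 hv hv1
    have h0 : 0 ≤ q - r := by linarith
    set m := (r + q) / 2 with hm
    have hrm : m - r = (q - r) / 2 := by rw [hm]; ring
    have hqm : q - m = (q - r) / 2 := by rw [hm]; ring
    have hrm' : r ≤ m := by linarith
    have hmq' : m ≤ q := by linarith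
    rw [hS.germRemainder_split x u φ hrm' hmq', map_add, map_add,
      hS.apply_apply hv (by linarith), hS.apply_apply hv (by linarith)]
    have i1 := ih m q v (by linarith) hmq' h3 hv (by linarith)
    have i2 := ih r m (v + (q - m)) h1 hrm' (by linarith) (by linarith) (by linarith)
    have i3 : ‖S (v + (q - m)) ((x q - x m) • hatDeltaOne S φ r m)‖
        ≤ L * (H * B) * (q - r) ^ (η + ρ) := by
      refine (hL _ ⟨by linarith, by linarith⟩ _).trans ?_
      rw [norm_smul, Real.norm_eq_abs]
      have j1 := hx m q (by linarith) hmq' h3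
      have j2 := hφ r m h1 hrm' (by linarith)
      rw [hqm] at j1
      rw [hrm] at j2
      calc L * (|x q - x m| * ‖hatDeltaOne S φ r m‖)
          ≤ L * (H * ((q - r) / 2) ^ η * (B * ((q - r) / 2) ^ ρ)) := by gcongr
        _ = L * (H * B) * (((q - r) / 2) ^ η * ((q - r) / 2) ^ ρ) := by ring
        _ = L * (H * B) * ((q - r) / 2) ^ (η + ρ) := by
          rw [← Real.rpow_add' (by linarith) (by linarith)]
        _ ≤ _ := by
          gcongr
          linarith
    rw [hrm] at i2
    rw [hqm] at i1
    have k : ∀ e : ℝ, 2 * ((q - r) / 2) ^ e = (q - r) ^ e * (2 : ℝ) ^ (1 - e) := fun e => by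
      rw [Real.div_rpow h0 (by norm_num), Real.rpow_sub (by norm_num), Real.rpow_one]
      ring
    have k1 := k p
    have k2 := k (η + ρ)
    refine (norm_add_le _ _).trans ((add_le_add (norm_add_le _ _) le_rfl).trans ?_)
    calc _ ≤ (L * C * ((q - r) / 2) ^ p * ((2 : ℝ) ^ (1 - p)) ^ n
              + L * (H * B) * G * ((q - r) / 2) ^ (η + ρ))
            + (L * C * ((q - r) / 2) ^ p * ((2 : ℝ) ^ (1 - p)) ^ n
              + L * (H * B) * G * ((q - r) / 2) ^ (η + ρ))
            + L * (H * B) * (q - r) ^ (η + ρ) := add_le_add (add_le_add i1 i2) i3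
      _ = L * C * (2 * ((q - r) / 2) ^ p) * ((2 : ℝ) ^ (1 - p)) ^ n
            + L * (H * B) * G * (2 * ((q - r) / 2) ^ (η + ρ))
            + L * (H * B) * (q - r) ^ (η + ρ) := by ring
      _ = L * C * (q - r) ^ p * ((2 : ℝ) ^ (1 - p)) ^ (n + 1)
            + L * (H * B) * (1 + (2 : ℝ) ^ (1 - (η + ρ)) * G) * (q - r) ^ (η + ρ) := by
          rw [k1, k2]; ring
      _ = _ := by rw [hGeq]

/-- The sewing estimate in the base space. -/
theorem exists_sewing_zero (hS : X.IsSmoothingSemigroup S A) {η ρ : ℝ} (hηρ : 1 < η + ρ) :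
    ∃ C : ℝ, 1 ≤ C ∧ ∀ (x : ℝ → ℝ) (u φ : ℝ → E) (s t H B : ℝ), 0 ≤ H → 0 ≤ B → s ≤ t →
      t - s ≤ 1 → (∀ r q, s ≤ r → r ≤ q → q ≤ t → |x q - x r| ≤ H * (q - r) ^ η) →
      (∀ r q, s ≤ r → r ≤ q → q ≤ t → ‖hatDeltaOne S φ r q‖ ≤ B * (q - r) ^ ρ) →
      IsPrimitive S x u φ s t →
      ‖germRemainder S x u φ s t‖ ≤ C * (H * B) * (t - s) ^ (η + ρ) := by
  obtain ⟨L, hL1, hL⟩ := hS.exists_norm_bound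
  refine ⟨max 1 (L * (1 / (1 - (2 : ℝ) ^ (1 - (η + ρ))))), le_max_left _ _, ?_⟩
  intro x u φ s t H B hH hB hst hst1 hx hφ ⟨C, p, hC, hp, hu⟩
  -- With `v = 0` and `n → ∞` the constants `C` and `p` of the qualitative bound disappear.
  have h := fun n => hS.sewing_aux hηρ hL1 hL hH hB hx hφ hu n s t 0 le_rfl hst le_rfl le_rfl
    (by linarith)
  simp only [hS.apply_zero] at h
  have hq : (2 : ℝ) ^ (1 - p) < 1 :=
    Real.rpow_lt_one_of_one_lt_of_neg one_lt_two (by linarith)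
  have hlim := (((tendsto_pow_atTop_nhds_zero_of_lt_one (by positivity) hq).const_mul
    (L * C * (t - s) ^ p)).add_const
    (L * (H * B) * (1 / (1 - (2 : ℝ) ^ (1 - (η + ρ)))) * (t - s) ^ (η + ρ)))
  have h2 := ge_of_tendsto' hlim h
  rw [mul_zero, zero_add] at h2
  refine h2.trans ?_
  have h0 : 0 ≤ t - s := by linarith
  calc _ = (L * (1 / (1 - (2 : ℝ) ^ (1 - (η + ρ))))) * (H * B) * (t - s) ^ (η + ρ) := by ring
    _ ≤ _ := by
      gcongr
      exact le_max_right _ _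

/-- The sewing estimate, with the smoothing effect of the semigroup. -/
theorem exists_sewing (hS : X.IsSmoothingSemigroup S A) {η ρ l : ℝ} (hηρ : 1 < η + ρ)
    (hl0 : 0 ≤ l) (hl : l < 2) (hlηρ : l < η + ρ) :
    ∃ C : ℝ, 1 ≤ C ∧ ∀ (x : ℝ → ℝ) (u φ : ℝ → E) (s t H B : ℝ), 0 ≤ H → 0 ≤ B → s < t →
      t - s ≤ 1 → (∀ r q, s ≤ r → r ≤ q → q ≤ t → |x q - x r| ≤ H * (q - r) ^ η) →
      (∀ r q, s ≤ r → r ≤ q → q ≤ t → ‖hatDeltaOne S φ r q‖ ≤ B * (q - r) ^ ρ) →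
      IsPrimitive S x u φ s t →
      X.NormLE l (germRemainder S x u φ s t) (C * (H * B) * (t - s) ^ (η + ρ - l)) := by
  obtain ⟨K, hK1, hK⟩ := hS.exists_sewing_zero hηρ
  obtain ⟨L, hL1, hL⟩ := hS.exists_smoothing le_rfl hl0 hl
  set κ := η + ρ - l with hκ
  have hκ0 : 0 < κ := by linarith
  set q : ℝ := (1 / 2 : ℝ) ^ κ with hq
  have hq0 : 0 < q := by positivity
  have hq1 : q < 1 := Real.rpow_lt_one (by norm_num) (by norm_num) hκ0
  have hq2 : 0 < 1 - q := by linarith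
  refine ⟨max 1 (L * (K + 1) / (1 - q)), le_max_left _ _, ?_⟩
  intro x u φ s t H B hH hB hst hst1 hx hφ hu
  have hd : 0 < t - s := by linarith
  -- The cut points `t - d j` accumulate at `t`. Consecutive remainders differ by `S(d (j+1))`
  -- applied to a term of size `d^{η+ρ}` in `E`; smoothing into `X_l` costs `d^{-l}`, and the sum
  -- converges because `l < η + ρ`.
  set d : ℕ → ℝ := fun j => (t - s) * (1 / 2 : ℝ) ^ j with hdd
  have hd0 : ∀ j, 0 < d j := fun j => by positivity
  have hds : ∀ j, d (j + 1) = d j / 2 := fun j => by simp only [hdd, pow_succ]; ring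
  have hd1 : ∀ j, d j ≤ t - s := fun j =>
    mul_le_of_le_one_right hd.le (pow_le_one₀ (by norm_num) (by norm_num))
  have hdlim : Tendsto d atTop (𝓝 0) := by
    simpa [hdd] using (tendsto_pow_atTop_nhds_zero_of_lt_one (r := (1 / 2 : ℝ)) (by norm_num)
      (by norm_num)).const_mul (t - s)
  have hdpow : ∀ j, d j ^ κ = (t - s) ^ κ * q ^ j := fun j => by
    rw [hdd, hq, Real.mul_rpow hd.le (by positivity), ← Real.rpow_natCast, ← Real.rpow_natCast,
      ← Real.rpow_mul (by norm_num), ← Real.rpow_mul (by norm_num), mul_comm κ]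
  set z : ℕ → E := fun j => germRemainder S x u φ (t - d j) t with hz
  have hzlim : Tendsto z atTop (𝓝 0) := by
    refine squeeze_zero_norm (a := fun j => K * (H * B) * d j ^ (η + ρ)) (fun j => ?_) ?_
    · have h := hK x u φ (t - d j) t H B hH hB (by linarith [hd0 j]) (by linarith [hd1 j])
        (fun r q h1 h2 h3 => hx r q (by linarith [hd1 j]) h2 h3)
        (fun r q h1 h2 h3 => hφ r q (by linarith [hd1 j]) h2 h3)
        (hu.mono (by linarith [hd1 j]) le_rfl)
      rwa [sub_sub_cancel] at h
    · have h := (hdlim.rpow_const (p := η + ρ) (Or.inr (by linarith))).const_mul (K * (H * B))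
      rwa [Real.zero_rpow (by linarith), mul_zero] at h
  have hstep : ∀ j, X.NormLE l (z j - z (j + 1))
      (L * (K + 1) * (H * B) * (t - s) ^ κ * q ^ j) := fun j => by
    have hj := hd0 j
    have hj1 := hd1 j
    have hm1 : t - d j ≤ t - d (j + 1) := by rw [hds]; linarith
    have hm2 : t - d (j + 1) ≤ t := by linarith [hd0 (j + 1)]
    have e := hS.germRemainder_split x u φ hm1 hm2
    have e1 : z j - z (j + 1) = S (d (j + 1)) (germRemainder S x u φ (t - d j) (t - d (j + 1))
        + (x t - x (t - d (j + 1))) • hatDeltaOne S φ (t - d j) (t - d (j + 1))) := by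
      simp only [hz]
      rw [e, sub_sub_cancel, map_add]
      abel
    have hlen : t - d (j + 1) - (t - d j) = d (j + 1) := by rw [hds]; ring
    have e2 := hK x u φ (t - d j) (t - d (j + 1)) H B hH hB hm1 (by linarith [hd1 (j + 1)])
        (fun r q h1 h2 h3 => hx r q (by linarith) h2 (by linarith))
        (fun r q h1 h2 h3 => hφ r q (by linarith) h2 (by linarith))
        (hu.mono (by linarith) (by linarith))
    have e3 := hx (t - d (j + 1)) t (by linarith) hm2 le_rfl
    have e4 := hφ (t - d j) (t - d (j + 1)) (by linarith) hm1 hm2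
    rw [hlen] at e2 e4
    rw [sub_sub_cancel] at e3
    have hj' := hd0 (j + 1)
    have e5 : ‖germRemainder S x u φ (t - d j) (t - d (j + 1))
        + (x t - x (t - d (j + 1))) • hatDeltaOne S φ (t - d j) (t - d (j + 1))‖
        ≤ (K + 1) * (H * B) * d (j + 1) ^ (η + ρ) := by
      refine (norm_add_le _ _).trans ?_
      rw [norm_smul, Real.norm_eq_abs]
      calc _ ≤ K * (H * B) * d (j + 1) ^ (η + ρ)
            + H * d (j + 1) ^ η * (B * d (j + 1) ^ ρ) := by gcongr
        _ = K * (H * B) * d (j + 1) ^ (η + ρ)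
            + (H * B) * (d (j + 1) ^ η * d (j + 1) ^ ρ) := by ring
        _ = _ := by rw [← Real.rpow_add hj']; ring
    rw [e1]
    refine (hL (d (j + 1)) ⟨hj', by linarith [hd1 (j + 1)]⟩ _ _ (normLE_zero_iff.2 e5)).mono ?_
    calc _ = L * (K + 1) * (H * B) * (d (j + 1) ^ (0 - l) * d (j + 1) ^ (η + ρ)) := by ring
      _ = L * (K + 1) * (H * B) * d (j + 1) ^ κ := by
        rw [← Real.rpow_add hj', hκ]; congr 2; ring
      _ ≤ L * (K + 1) * (H * B) * d j ^ κ := by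
        have : d (j + 1) ≤ d j := by rw [hds]; linarith
        gcongr
      _ = _ := by rw [hdpow]; ring
  have h := normLE_of_geometric hq0.le hq1 hstep hzlim
  have hz0 : z 0 - 0 = germRemainder S x u φ s t := by simp [hz, hdd]
  rw [hz0] at h
  refine h.mono ?_
  calc _ = (L * (K + 1) / (1 - q)) * (H * B) * (t - s) ^ κ := by ring
    _ ≤ _ := by
      gcongr
      exact le_max_right _ _

end BanachScale.IsSmoothingSemigroup

/-! ### Increments of solutions of the linear equation -/

namespace BanachScale

variable {E : Type u} [NormedAddCommGroup E] [NormedSpace ℝ E] {X : BanachScale.{u, v} E}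
  {S : ℝ → E →L[ℝ] E} {A : E →ₗ.[ℝ] E}

/-- Relations between the Hölder exponent `η` of the driving path, the regularity `α` in the scale
and the Hölder exponent `ρ` in time of the solutions. -/
structure IsExponentTriple (η α ρ : ℝ) : Prop where
  one_lt : 1 < η + ρ
  lt_one : η < 1
  le : ρ ≤ α
  lt : α < η
  add_le : α + ρ ≤ 1

theorem IsExponentTriple.pos {η α ρ : ℝ} (h : IsExponentTriple η α ρ) : 0 < ρ := by
  linarith [h.one_lt, h.lt_one]

/-- Weighted bounds for a function `φ` on `(a,b]` with values in `X_α` and increments in the base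
space. -/
structure ForcingBound (X : BanachScale.{u, v} E) (α ρ g a b N : ℝ) (φ : ℝ → E) : Prop where
  norm : ∀ s ∈ Ioc a b, X.NormLE α (φ s) (N * (s - a) ^ (-g))
  incr : ∀ s t, a < s → s < t → t ≤ b → ‖φ t - φ s‖ ≤ N * (t - s) ^ ρ * (s - a) ^ (-g - ρ)

/-- Weighted bounds for a function `u` on `(a,b]` with values and increments in `X_α`. -/
structure PathBound (X : BanachScale.{u, v} E) (α ρ γ g a b N : ℝ) (u : ℝ → E) : Prop where
  norm : ∀ s ∈ Ioc a b, X.NormLE α (u s) (N * (s - a) ^ (-γ))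
  incr : ∀ s t, a < s → s < t → t ≤ b →
    X.NormLE α (u t - u s) (N * (t - s) ^ ρ * (s - a) ^ (-g - ρ))

/-- `du = A u dt + φ dx` on `(a,b]`, together with quantitative bounds on `x` and `φ`. -/
structure ForcedSolution (X : BanachScale.{u, v} E) (S : ℝ → E →L[ℝ] E) (x : ℝ → ℝ)
    (η α ρ g a b H N : ℝ) (u φ : ℝ → E) : Prop where
  lt : a < b
  le_one : b - a ≤ 1
  holder_nonneg : 0 ≤ H
  holder : ∀ r q, a ≤ r → r ≤ q → q ≤ b → |x q - x r| ≤ H * (q - r) ^ η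
  sol : IsSolution S x u φ a b
  nonneg : 0 ≤ N
  forcing : X.ForcingBound α ρ g a b N φ

namespace IsSmoothingSemigroup

/-- The difference `S(t-r)u(r) - S(t-s)u(s)` is `S(t-r)` applied to `δ̂₁u(s,r)`, which is small with
`r - s`. The limit condition in `IsSolution` thus has content only when the germ bound fails at the
initial time. -/
theorem tendsto_of_isPrimitive (hS : X.IsSmoothingSemigroup S A) {x : ℝ → ℝ} {u φ : ℝ → E}
    {s b H η : ℝ} (hη : 0 < η) (hsb : b - s ≤ 1)
    (hx : ∀ r q, s ≤ r → r ≤ q → q ≤ b → |x q - x r| ≤ H * (q - r) ^ η)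
    (h : IsPrimitive S x u φ s b) {t : ℝ} (ht : t ∈ Ioc s b) :
    Tendsto (fun r => S (t - r) (u r)) (𝓝[>] s) (𝓝 (S (t - s) (u s))) := by
  obtain ⟨L, hL1, hL⟩ := hS.exists_norm_bound
  obtain ⟨C, p, hC, hp, h⟩ := h
  rw [tendsto_iff_norm_sub_tendsto_zero]
  have hbd : ∀ᶠ r in 𝓝[>] s, ‖S (t - r) (u r) - S (t - s) (u s)‖
      ≤ L * (C * (r - s) ^ p + L * (H * (r - s) ^ η * ‖φ s‖)) := by
    filter_upwards [Ioo_mem_nhdsGT ht.1] with r hr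
    have hr1 : s ≤ r := hr.1.le
    have hr2 : r ≤ t := hr.2.le
    have e1 : S (t - r) (u r) - S (t - s) (u s) = S (t - r) (hatDeltaOne S u s r) := by
      rw [hatDeltaOne, map_sub, hS.apply_apply (by linarith) (by linarith), sub_add_sub_cancel]
    have e2 : hatDeltaOne S u s r = germRemainder S x u φ s r + S (r - s) ((x r - x s) • φ s) := by
      rw [germRemainder, sub_add_cancel]
    rw [e1]
    refine (hL _ ⟨by linarith, by linarith [ht.2]⟩ _).trans ?_
    gcongr
    rw [e2]
    refine (norm_add_le _ _).trans (add_le_add (h s r le_rfl hr1 (by linarith [ht.2])) ?_)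
    refine (hL _ ⟨by linarith, by linarith [ht.2]⟩ _).trans ?_
    rw [norm_smul, Real.norm_eq_abs]
    gcongr
    exact hx s r le_rfl hr1 (by linarith [ht.2])
  refine squeeze_zero' (Eventually.of_forall fun _ => norm_nonneg _) hbd ?_
  have h0 : Tendsto (fun r => r - s) (𝓝[>] s) (𝓝 0) := by
    have : Tendsto (fun r => r - s) (𝓝 s) (𝓝 (s - s)) := tendsto_id.sub_const s
    rw [sub_self] at this
    exact this.mono_left nhdsWithin_le_nhds
  have h1 := h0.rpow_const (p := p) (Or.inr (by linarith))
  have h2 := h0.rpow_const (p := η) (Or.inr hη.le)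
  rw [Real.zero_rpow (by linarith)] at h1
  rw [Real.zero_rpow hη.ne'] at h2
  simpa using ((h1.const_mul C).add (((h2.const_mul H).mul_const ‖φ s‖).const_mul L)).const_mul L

theorem isSolution_of_isPrimitive (hS : X.IsSmoothingSemigroup S A) {x : ℝ → ℝ} {u φ : ℝ → E}
    {s b H η : ℝ} (hη : 0 < η) (hsb : b - s ≤ 1)
    (hx : ∀ r q, s ≤ r → r ≤ q → q ≤ b → |x q - x r| ≤ H * (q - r) ^ η)
    (h : IsPrimitive S x u φ s b) : IsSolution S x u φ s b :=
  ⟨fun _ hr => h.mono hr.1.le le_rfl, fun _ ht => hS.tendsto_of_isPrimitive hη hsb hx h ht⟩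

theorem isSolution_restrict (hS : X.IsSmoothingSemigroup S A) {x : ℝ → ℝ} {u φ : ℝ → E}
    {a b H η : ℝ} (hη : 0 < η) (hab : b - a ≤ 1)
    (hx : ∀ r q, a ≤ r → r ≤ q → q ≤ b → |x q - x r| ≤ H * (q - r) ^ η)
    (h : IsSolution S x u φ a b) {s : ℝ} (has : a ≤ s) (hsb : s ≤ b) :
    IsSolution S x u φ s b := by
  rcases has.eq_or_lt with rfl | has'
  · exact h
  · exact hS.isSolution_of_isPrimitive hη (by linarith)
      (fun r q h1 h2 h3 => hx r q (by linarith) h2 h3) (h.1 s ⟨has', hsb⟩)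

/-- Bounds for the increments over intervals whose length does not exceed the distance from the
initial time extend to all intervals starting at the initial time. -/
theorem exists_dyadic_bound (hS : X.IsSmoothingSemigroup S A) {l κ : ℝ} (hl0 : 0 ≤ l) (hl : l < 2)
    (hκ : 0 < κ) : ∃ K : ℝ, 1 ≤ K ∧ ∀ (x : ℝ → ℝ) (u φ : ℝ → E) (a b C : ℝ), b - a ≤ 1 →
      IsSolution S x u φ a b → 0 ≤ C →
      (∀ p q, a < p → p < q → q ≤ b → q - p ≤ p - a →
        X.NormLE l (hatDeltaOne S u p q) (C * (q - p) ^ κ)) →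
      ∀ t ∈ Ioc a b, X.NormLE l (hatDeltaOne S u a t) (K * C * (t - a) ^ κ) := by
  obtain ⟨L, hL1, hL⟩ := hS.exists_bound hl0 hl
  set q : ℝ := (1 / 2 : ℝ) ^ κ with hq
  have hq0 : 0 < q := by positivity
  have hq1 : q < 1 := Real.rpow_lt_one (by norm_num) (by norm_num) hκ
  have hq2 : 0 < 1 - q := by linarith
  refine ⟨max 1 (L / (1 - q)), le_max_left _ _, ?_⟩
  intro x u φ a b C hab hsol hC h t ht
  have hd : 0 < t - a := by linarith [ht.1]
  -- The points `a + d j` decrease to `a`, and the interval between two consecutive ones is exactly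
  -- as long as its distance from `a`, the extreme case allowed by the hypothesis.
  set d : ℕ → ℝ := fun j => (t - a) * (1 / 2 : ℝ) ^ j with hdd
  have hd0 : ∀ j, 0 < d j := fun j => by positivity
  have hds : ∀ j, d (j + 1) = d j / 2 := fun j => by simp only [hdd, pow_succ]; ring
  have hd1 : ∀ j, d j ≤ t - a := fun j =>
    mul_le_of_le_one_right hd.le (pow_le_one₀ (by norm_num) (by norm_num))
  have hdlim : Tendsto d atTop (𝓝 0) := by
    simpa [hdd] using (tendsto_pow_atTop_nhds_zero_of_lt_one (r := (1 / 2 : ℝ)) (by norm_num)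
      (by norm_num)).const_mul (t - a)
  have hdpow : ∀ j, d j ^ κ = (t - a) ^ κ * q ^ j := fun j => by
    rw [hdd, hq, Real.mul_rpow hd.le (by positivity), ← Real.rpow_natCast, ← Real.rpow_natCast,
      ← Real.rpow_mul (by norm_num), ← Real.rpow_mul (by norm_num), mul_comm κ]
  set z : ℕ → E := fun j => hatDeltaOne S u (a + d j) t with hz
  -- This is where the weak initial condition is used: it identifies the limit of the telescoping
  -- sum.
  have hzlim : Tendsto z atTop (𝓝 (hatDeltaOne S u a t)) := by
    have h1 : Tendsto (fun j => a + d j) atTop (𝓝[>] a) := by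
      refine tendsto_nhdsWithin_iff.2 ⟨by simpa using hdlim.const_add a, ?_⟩
      exact Eventually.of_forall fun j => lt_add_of_pos_right a (hd0 j)
    exact tendsto_const_nhds.sub ((hsol.2 t ht).comp h1)
  have hstep : ∀ j, X.NormLE l (z j - z (j + 1)) (L * C * (t - a) ^ κ * q ^ j) := fun j => by
    have hj := hd0 j
    have hj' := hd0 (j + 1)
    have hj1 := hd1 j
    have e := hS.hatDeltaOne_split u (r := a + d (j + 1)) (m := a + d j) (q := t)
      (by rw [hds]; linarith) (by linarith)
    have e1 : z j - z (j + 1)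
        = -(S (t - (a + d j)) (hatDeltaOne S u (a + d (j + 1)) (a + d j))) := by
      simp only [hz]
      rw [e]
      abel
    rw [e1]
    have e2 := h (a + d (j + 1)) (a + d j) (by linarith) (by rw [hds]; linarith)
      (by linarith [ht.2]) (by rw [hds]; linarith)
    refine (hL _ ⟨by linarith, by linarith [ht.2]⟩ _ _ e2).neg.mono ?_
    have e3 : a + d j - (a + d (j + 1)) ≤ d j := by linarith
    have e4 : 0 ≤ a + d j - (a + d (j + 1)) := by rw [hds]; linarith
    calc _ ≤ L * (C * d j ^ κ) := by gcongr
      _ = _ := by rw [hdpow]; ring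
  have h2 := normLE_of_geometric hq0.le hq1 hstep hzlim
  have hz0 : z 0 - hatDeltaOne S u a t = -hatDeltaOne S u a t := by
    simp [hz, hdd, hatDeltaOne, hS.apply_zero]
  rw [hz0] at h2
  have h3 := h2.neg
  rw [neg_neg] at h3
  refine h3.mono ?_
  calc _ = (L / (1 - q)) * C * (t - a) ^ κ := by ring
    _ ≤ _ := by
      gcongr
      exact le_max_right _ _

/-- Restart at `s`: an interval that is short relative to its distance from `s` is also short
relative to its distance from `a`. -/
theorem exists_dyadic_bound_of_le (hS : X.IsSmoothingSemigroup S A) {l κ η : ℝ} (hl0 : 0 ≤ l)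
    (hl : l < 2) (hκ : 0 < κ) (hη : 0 < η) :
    ∃ K : ℝ, 1 ≤ K ∧ ∀ (x : ℝ → ℝ) (u φ : ℝ → E) (a b C H : ℝ), b - a ≤ 1 →
      (∀ r q, a ≤ r → r ≤ q → q ≤ b → |x q - x r| ≤ H * (q - r) ^ η) →
      IsSolution S x u φ a b → 0 ≤ C →
      (∀ p q, a < p → p < q → q ≤ b → q - p ≤ p - a →
        X.NormLE l (hatDeltaOne S u p q) (C * (q - p) ^ κ)) →
      ∀ s t, a ≤ s → s < t → t ≤ b →
        X.NormLE l (hatDeltaOne S u s t) (K * C * (t - s) ^ κ) := by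
  obtain ⟨K, hK1, hK⟩ := hS.exists_dyadic_bound hl0 hl hκ
  refine ⟨K, hK1, fun x u φ a b C H hab hx hsol hC h s t has hst htb => ?_⟩
  refine hK x u φ s b C (by linarith)
    (hS.isSolution_restrict hη hab hx hsol has (by linarith)) hC ?_ t ⟨hst, htb⟩
  exact fun p q h1 h2 h3 h4 => h p q (by linarith) h2 h3 (by linarith)

theorem exists_norm_sub_le (hS : X.IsSmoothingSemigroup S A) {μ : ℝ} (h0 : 0 < μ) (h1 : μ ≤ 1) :
    ∃ C : ℝ, 1 ≤ C ∧ ∀ t ∈ Icc (0 : ℝ) 1, ∀ w c, X.NormLE μ w c → ‖S t w - w‖ ≤ C * t ^ μ * c := by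
  obtain ⟨C, hC1, hC⟩ := hS.exists_approx le_rfl h0 h1
  refine ⟨C, hC1, fun t ht w c hw => ?_⟩
  simpa using normLE_zero_iff.1 (hC t ht w c hw)

/-- The bound on the semigroup increments of the forcing term. -/
theorem exists_hatDeltaOne_forcing (hS : X.IsSmoothingSemigroup S A) {η α ρ : ℝ}
    (he : IsExponentTriple η α ρ) : ∃ C : ℝ, 1 ≤ C ∧ ∀ (φ : ℝ → E) (g a b N : ℝ), b - a ≤ 1 →
      0 ≤ N → X.ForcingBound α ρ g a b N φ → ∀ s t, a < s → s < t → t ≤ b →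
      ‖hatDeltaOne S φ s t‖ ≤ C * N * (t - s) ^ ρ * (s - a) ^ (-g - ρ) := by
  have hρ := he.pos
  obtain ⟨C, hC1, hC⟩ := hS.exists_norm_sub_le (by linarith [he.le])
    (show α ≤ 1 by linarith [he.lt, he.lt_one])
  refine ⟨1 + C, by linarith, fun φ g a b N hab hN hφ s t has hst htb => ?_⟩
  have e1 : hatDeltaOne S φ s t = (φ t - φ s) - (S (t - s) (φ s) - φ s) := by
    rw [hatDeltaOne]; abel
  have e2 := hφ.incr s t has hst htb
  have e3 := hC (t - s) ⟨by linarith, by linarith⟩ _ _ (hφ.norm s ⟨has, by linarith⟩)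
  have hts : 0 < t - s := by linarith
  have hsa : 0 < s - a := by linarith
  have e4 : (t - s) ^ α ≤ (t - s) ^ ρ :=
    Real.rpow_le_rpow_of_exponent_ge hts (by linarith) he.le
  have e5 : (s - a) ^ (-g) ≤ (s - a) ^ (-g - ρ) :=
    Real.rpow_le_rpow_of_exponent_ge hsa (by linarith) (by linarith)
  rw [e1]
  calc _ ≤ N * (t - s) ^ ρ * (s - a) ^ (-g - ρ) + C * (t - s) ^ α * (N * (s - a) ^ (-g)) :=
        (norm_sub_le _ _).trans (add_le_add e2 e3)
    _ ≤ N * (t - s) ^ ρ * (s - a) ^ (-g - ρ) + C * (t - s) ^ ρ * (N * (s - a) ^ (-g - ρ)) := by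
        gcongr
    _ = _ := by ring

theorem hatDeltaOne_self (hS : X.IsSmoothingSemigroup S A) (φ : ℝ → E) (s : ℝ) :
    hatDeltaOne S φ s s = 0 := by
  rw [hatDeltaOne, sub_self, hS.apply_zero, sub_self]

/-- Below `α` the embedding loses nothing, above `α` smoothing loses `l - α`; the maximum treats
both cases with one exponent. -/
theorem exists_germ (hS : X.IsSmoothingSemigroup S A) {α l : ℝ} (hα : 0 ≤ α) (hα2 : α < 2)
    (hl0 : 0 ≤ l) (hl : l < 2) :
    ∃ C : ℝ, 1 ≤ C ∧ ∀ t ∈ Ioc (0 : ℝ) 1, ∀ w c, X.NormLE α w c →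
      X.NormLE l (S t w) (C * t ^ (-max (l - α) 0) * c) := by
  rcases le_total l α with h | h
  · obtain ⟨C, hC1, hC⟩ := hS.exists_bound hl0 hl
    obtain ⟨K, hK1, hK⟩ := X.exists_normLE_embed hl0 h hα2
    refine ⟨C * K, by nlinarith, fun t ht w c hw => ?_⟩
    refine (hC t ⟨ht.1.le, ht.2⟩ _ _ (hK _ _ hw)).mono (le_of_eq ?_)
    rw [max_eq_right (by linarith)]
    simp [mul_assoc]
  · obtain ⟨C, hC1, hC⟩ := hS.exists_smoothing hα h hl
    refine ⟨C, hC1, fun t ht w c hw => (hC t ht w c hw).mono (le_of_eq ?_)⟩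
    rw [max_eq_left (by linarith), neg_sub]

/-- The basic estimate of the increments of a solution of the linear equation. -/
theorem exists_increment_bound (hS : X.IsSmoothingSemigroup S A) {η α ρ g l : ℝ}
    (he : IsExponentTriple η α ρ) (hg : 0 ≤ g) (hl0 : 0 ≤ l) (hl : l < 2) (hlηρ : l < η + ρ) :
    ∃ C : ℝ, 1 ≤ C ∧ ∀ (x : ℝ → ℝ) (u φ : ℝ → E) (a b H N : ℝ),
      X.ForcedSolution S x η α ρ g a b H N u φ → ∀ s t, a < s → s < t → t ≤ b →
      X.NormLE l (hatDeltaOne S u s t) (C * (H * N) * ((s - a) ^ (-g) * (t - s) ^ (η - max (l - α) 0)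
        + (s - a) ^ (-g - ρ) * (t - s) ^ (η + ρ - l))) := by
  have hρ := he.pos
  obtain ⟨C₁, hC₁, h₁⟩ := hS.exists_sewing he.one_lt hl0 hl hlηρ
  obtain ⟨C₂, hC₂, h₂⟩ := hS.exists_hatDeltaOne_forcing he
  obtain ⟨C₃, hC₃, h₃⟩ := hS.exists_germ (show 0 ≤ α by linarith [he.le])
    (show α < 2 by linarith [he.lt, he.lt_one]) hl0 hl
  refine ⟨max C₃ (C₁ * C₂), hC₃.trans (le_max_left _ _), ?_⟩
  intro x u φ a b H N hf s t has hst htb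
  have hH := hf.holder_nonneg
  have hN := hf.nonneg
  have hts : 0 < t - s := by linarith
  have hsa : 0 < s - a := by linarith
  have hba := hf.le_one
  -- The constant for `δ̂₁φ` is frozen at the left end point `s`, where the singular weight is
  -- largest.
  have e1 := h₁ x u φ s t H (C₂ * N * (s - a) ^ (-g - ρ)) hH (by positivity) hst (by linarith)
    (fun r q h1 h2 h3 => hf.holder r q (by linarith) h2 (by linarith))
    (fun r q h1 h2 h3 => by
      rcases h2.eq_or_lt with rfl | h2'
      · rw [hS.hatDeltaOne_self, norm_zero, sub_self]
        positivity
      · refine (h₂ φ g a b N hba hN hf.forcing r q (by linarith) h2' (by linarith)).trans ?_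
        have e : (r - a) ^ (-g - ρ) ≤ (s - a) ^ (-g - ρ) :=
          Real.rpow_le_rpow_of_nonpos hsa (by linarith) (by linarith)
        have hqr : 0 ≤ q - r := by linarith
        calc _ ≤ C₂ * N * (q - r) ^ ρ * (s - a) ^ (-g - ρ) := by gcongr
          _ = _ := by ring)
    ((hf.sol.1 s ⟨has, by linarith⟩).mono le_rfl htb)
  have e2 := (h₃ (t - s) ⟨hts, by linarith⟩ _ _
    ((hf.forcing.norm s ⟨has, by linarith⟩).smul (x t - x s)))
  have e3 := e1.add e2
  rw [germRemainder, sub_add_cancel] at e3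
  refine e3.mono ?_
  have e4 := hf.holder s t has.le hst.le htb
  have e5 : (t - s) ^ η * (t - s) ^ (-max (l - α) 0) = (t - s) ^ (η - max (l - α) 0) := by
    rw [← Real.rpow_add hts, ← sub_eq_add_neg]
  have hHN : 0 ≤ H * N := mul_nonneg hH hN
  calc _ ≤ C₁ * (H * (C₂ * N * (s - a) ^ (-g - ρ))) * (t - s) ^ (η + ρ - l)
        + C₃ * (t - s) ^ (-max (l - α) 0) * (H * (t - s) ^ η * (N * (s - a) ^ (-g))) := by gcongr
    _ = C₃ * (H * N) * ((s - a) ^ (-g) * ((t - s) ^ η * (t - s) ^ (-max (l - α) 0)))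
        + C₁ * C₂ * (H * N) * ((s - a) ^ (-g - ρ) * (t - s) ^ (η + ρ - l)) := by ring
    _ ≤ max C₃ (C₁ * C₂) * (H * N) * ((s - a) ^ (-g) * (t - s) ^ (η - max (l - α) 0))
        + max C₃ (C₁ * C₂) * (H * N) * ((s - a) ^ (-g - ρ) * (t - s) ^ (η + ρ - l)) := by
      rw [e5]
      gcongr
      · exact le_max_left _ _
      · exact le_max_right _ _
    _ = _ := by ring

/-- The increment estimate on intervals whose length does not exceed the distance from the initial
time. -/
theorem exists_increment_bound_away (hS : X.IsSmoothingSemigroup S A) {η α ρ g l : ℝ}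
    (he : IsExponentTriple η α ρ) (hg : 0 ≤ g) (hl0 : 0 ≤ l) (hl : l < 2) (hlηρ : l < η + ρ) :
    ∃ C : ℝ, 1 ≤ C ∧ ∀ (x : ℝ → ℝ) (u φ : ℝ → E) (a b H N : ℝ),
      X.ForcedSolution S x η α ρ g a b H N u φ → ∀ s t, a < s → s < t → t ≤ b → t - s ≤ s - a →
      X.NormLE l (hatDeltaOne S u s t) (C * (H * N) * ((s - a) ^ (-g) * (t - s) ^ (η - l))) := by
  have hρ := he.pos
  obtain ⟨C, hC, h⟩ := hS.exists_increment_bound he hg hl0 hl hlηρ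
  refine ⟨C * 2, by linarith, ?_⟩
  intro x u φ a b H N hf s t has hst htb hle
  refine (h x u φ a b H N hf s t has hst htb).mono ?_
  have hts : 0 < t - s := by linarith
  have hsa : 0 < s - a := by linarith
  have hHN := mul_nonneg hf.holder_nonneg hf.nonneg
  have e1 : (t - s) ^ (η - max (l - α) 0) ≤ (t - s) ^ (η - l) :=
    Real.rpow_le_rpow_of_exponent_ge hts (by linarith [hf.le_one])
      (by linarith [max_le (show l - α ≤ l by linarith [he.le]) hl0])
  -- As `t - s ≤ s - a`, the surplus weight `(s-a)^{-ρ}` can be traded for `(t-s)^{-ρ}`.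
  have e2 : (s - a) ^ (-g - ρ) * (t - s) ^ (η + ρ - l) ≤ (s - a) ^ (-g) * (t - s) ^ (η - l) := by
    have f1 : (s - a) ^ (-g - ρ) = (s - a) ^ (-g) * (s - a) ^ (-ρ) := by
      rw [← Real.rpow_add hsa, ← sub_eq_add_neg]
    have f2 : (s - a) ^ (-ρ) ≤ (t - s) ^ (-ρ) :=
      Real.rpow_le_rpow_of_nonpos hts hle (by linarith)
    have f3 : (t - s) ^ (-ρ) * (t - s) ^ (η + ρ - l) = (t - s) ^ (η - l) := by
      rw [← Real.rpow_add hts]; congr 1; ring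
    calc _ = (s - a) ^ (-g) * ((s - a) ^ (-ρ) * (t - s) ^ (η + ρ - l)) := by rw [f1]; ring
      _ ≤ (s - a) ^ (-g) * ((t - s) ^ (-ρ) * (t - s) ^ (η + ρ - l)) := by gcongr
      _ = _ := by rw [f3]
  calc _ ≤ C * (H * N) * ((s - a) ^ (-g) * (t - s) ^ (η - l)
        + (s - a) ^ (-g) * (t - s) ^ (η - l)) := by gcongr
    _ = _ := by ring

/-- The increment estimate up to the initial time. -/
theorem exists_increment_bound_full (hS : X.IsSmoothingSemigroup S A) {η α ρ g l : ℝ}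
    (he : IsExponentTriple η α ρ) (hg : 0 ≤ g) (hl0 : 0 ≤ l) (hl : l < 2) (hlη : l < η - g) :
    ∃ C : ℝ, 1 ≤ C ∧ ∀ (x : ℝ → ℝ) (u φ : ℝ → E) (a b H N : ℝ),
      X.ForcedSolution S x η α ρ g a b H N u φ → ∀ s t, a ≤ s → s < t → t ≤ b →
      X.NormLE l (hatDeltaOne S u s t) (C * (H * N) * (t - s) ^ (η - g - l)) := by
  have hρ := he.pos
  obtain ⟨C, hC, h⟩ := hS.exists_increment_bound_away he hg hl0 hl (by linarith)
  obtain ⟨K, hK1, hK⟩ := hS.exists_dyadic_bound_of_le hl0 hl (show 0 < η - g - l by linarith)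
    (show 0 < η by linarith)
  refine ⟨K * C, by nlinarith, ?_⟩
  intro x u φ a b H N hf s t has hst htb
  have hHN := mul_nonneg hf.holder_nonneg hf.nonneg
  refine (hK x u φ a b (C * (H * N)) H hf.le_one hf.holder hf.sol (by positivity) ?_ s t has hst
    htb).mono (le_of_eq (by ring))
  intro p q h1 h2 h3 h4
  refine (h x u φ a b H N hf p q h1 h2 h3 h4).mono ?_
  have hqp : 0 < q - p := by linarith
  have e1 : (p - a) ^ (-g) ≤ (q - p) ^ (-g) :=
    Real.rpow_le_rpow_of_nonpos hqp h4 (by linarith)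
  have e2 : (q - p) ^ (-g) * (q - p) ^ (η - l) = (q - p) ^ (η - g - l) := by
    rw [← Real.rpow_add hqp]; congr 1; ring
  rw [← e2]
  gcongr

end IsSmoothingSemigroup

end BanachScale

/-! ### Weighted bounds for solutions of the linear equation -/

namespace BanachScale

variable {E : Type u} [NormedAddCommGroup E] [NormedSpace ℝ E] {X : BanachScale.{u, v} E}
  {S : ℝ → E →L[ℝ] E} {A : E →ₗ.[ℝ] E}

theorem half_rpow_neg_le {d e : ℝ} (hd : 0 < d) (he1 : e ≤ 1) :
    (d / 2) ^ (-e) ≤ 2 * d ^ (-e) := by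
  rw [Real.div_rpow hd.le (by norm_num), Real.rpow_neg (by norm_num : (0 : ℝ) ≤ 2), div_inv_eq_mul,
    mul_comm]
  have : (2 : ℝ) ^ e ≤ 2 ^ (1 : ℝ) := Real.rpow_le_rpow_of_exponent_le (by norm_num) he1
  rw [Real.rpow_one] at this
  have := Real.rpow_nonneg hd.le (-e)
  gcongr

theorem add_hatDeltaOne (S : ℝ → E →L[ℝ] E) (u : ℝ → E) (s t : ℝ) :
    hatDeltaOne S u s t + S (t - s) (u s) = u t := by
  rw [hatDeltaOne, sub_add_cancel]

theorem sub_eq_hatDeltaOne_add (S : ℝ → E →L[ℝ] E) (u : ℝ → E) (s t : ℝ) :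
    u t - u s = hatDeltaOne S u s t + (S (t - s) (u s) - u s) := by
  rw [hatDeltaOne]; abel

namespace IsSmoothingSemigroup

/-- In `u(t) = δ̂₁u(a,t) + S(t-a)u(a)` the second term produces the singularity `(t-a)^{-γ}`, while
the first carries the positive power `η - α - g` of the length. That small factor drives the
contraction and the a priori estimate. -/
theorem exists_value_bound (hS : X.IsSmoothingSemigroup S A) {η α ρ γ g : ℝ}
    (he : IsExponentTriple η α ρ) (hγ : 0 ≤ γ) (hγα : γ ≤ α) (hγg : γ ≤ g) (hg : g < η - α) :
    ∃ C : ℝ, 1 ≤ C ∧ ∀ (x : ℝ → ℝ) (u φ : ℝ → E) (a b H N U : ℝ),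
      X.ForcedSolution S x η α ρ g a b H N u φ → X.NormLE (α - γ) (u a) U →
      ∀ t ∈ Ioc a b,
        X.NormLE α (u t) (C * (U + H * N * (b - a) ^ (η - α - g)) * (t - a) ^ (-γ)) := by
  have hρ := he.pos
  obtain ⟨C, hC, h⟩ := hS.exists_increment_bound_full he (hγ.trans hγg)
    (show 0 ≤ α by linarith) (show α < 2 by linarith [he.lt, he.lt_one]) (by linarith)
  obtain ⟨L, hL1, hL⟩ := hS.exists_smoothing (show 0 ≤ α - γ by linarith)
    (show α - γ ≤ α by linarith) (show α < 2 by linarith [he.lt, he.lt_one])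
  refine ⟨max L C, hL1.trans (le_max_left _ _), fun x u φ a b H N U hf hU t ht => ?_⟩
  have hta : 0 < t - a := by linarith [ht.1]
  have hba := hf.le_one
  have hHN := mul_nonneg hf.holder_nonneg hf.nonneg
  have hU0 := hU.nonneg
  have e1 := (h x u φ a b H N hf a t le_rfl ht.1 ht.2).add
    (hL (t - a) ⟨hta, by linarith [ht.2]⟩ _ _ hU)
  rw [add_hatDeltaOne] at e1
  refine e1.mono ?_
  have e2 : (t - a) ^ (η - g - α) ≤ (b - a) ^ (η - α - g) := by
    rw [show η - g - α = η - α - g by ring]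
    have := ht.2
    gcongr
  have e3 : 1 ≤ (t - a) ^ (-γ) :=
    Real.one_le_rpow_of_pos_of_le_one_of_nonpos hta (by linarith [ht.2]) (by linarith)
  have e4 : α - γ - α = -γ := by ring
  have e5 : 0 ≤ (b - a) ^ (η - α - g) := Real.rpow_nonneg (by linarith [hf.lt]) _
  rw [e4]
  calc _ ≤ C * (H * N) * ((b - a) ^ (η - α - g) * (t - a) ^ (-γ)) + L * (t - a) ^ (-γ) * U := by
        gcongr
        exact e2.trans (le_mul_of_one_le_right e5 e3)
    _ ≤ max L C * (H * N) * ((b - a) ^ (η - α - g) * (t - a) ^ (-γ))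
        + max L C * (t - a) ^ (-γ) * U := by
        gcongr
        · exact le_max_right _ _
        · exact le_max_left _ _
    _ = _ := by ring

/-- The extra spatial regularity `ρ` is what `exists_pathBound` turns into `ρ`-Hölder continuity in
time. Restarting at the midpoint of `[a,t]` keeps away from the singularity at `a`. -/
theorem exists_value_bound_add (hS : X.IsSmoothingSemigroup S A) {η α ρ γ g : ℝ}
    (he : IsExponentTriple η α ρ) (hγ : 0 ≤ γ) (hγα : γ ≤ α) (hγg : γ ≤ g) (hg : g < η - α) :
    ∃ C : ℝ, 1 ≤ C ∧ ∀ (x : ℝ → ℝ) (u φ : ℝ → E) (a b H N U : ℝ),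
      X.ForcedSolution S x η α ρ g a b H N u φ → X.NormLE (α - γ) (u a) U →
      ∀ t ∈ Ioc a b, X.NormLE (α + ρ) (u t)
        (C * (U + H * N * (b - a) ^ (η - α - g)) * (t - a) ^ (-γ - ρ)) := by
  have hρ := he.pos
  have hle := he.le
  have hlt := he.lt
  have hlt1 := he.lt_one
  have hadd := he.add_le
  obtain ⟨C, hC, h⟩ := hS.exists_value_bound he hγ hγα hγg hg
  obtain ⟨K, hK, hK'⟩ := hS.exists_increment_bound_away he (hγ.trans hγg)
    (show 0 ≤ α + ρ by linarith) (show α + ρ < 2 by linarith) (by linarith)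
  obtain ⟨L, hL1, hL⟩ := hS.exists_smoothing (show 0 ≤ α by linarith)
    (show α ≤ α + ρ by linarith) (show α + ρ < 2 by linarith)
  refine ⟨2 * K + 4 * L * C, by nlinarith, fun x u φ a b H N U hf hU t ht => ?_⟩
  have hta : 0 < t - a := by linarith [ht.1]
  have hba := hf.le_one
  have hHN := mul_nonneg hf.holder_nonneg hf.nonneg
  have hU0 := hU.nonneg
  set m := (a + t) / 2 with hm
  have hma : m - a = (t - a) / 2 := by rw [hm]; ring
  have htm : t - m = (t - a) / 2 := by rw [hm]; ring
  have ham : a < m := by linarith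
  have hmt : m < t := by linarith
  have e1 := hK' x u φ a b H N hf m t ham hmt ht.2 (by linarith)
  have e2 := hL (t - m) ⟨by linarith, by linarith [ht.2]⟩ _ _
    (h x u φ a b H N U hf hU m ⟨ham, by linarith [ht.2]⟩)
  have e3 := e1.add e2
  rw [add_hatDeltaOne, hma, htm] at e3
  refine e3.mono ?_
  have hT : 0 ≤ (b - a) ^ (η - α - g) := Real.rpow_nonneg (by linarith [hf.lt]) _
  set T := (b - a) ^ (η - α - g) with hTdef
  set d := t - a with hd
  have f1 : (d / 2) ^ (-g) * (d / 2) ^ (η - (α + ρ)) = (d / 2) ^ (-ρ) * (d / 2) ^ (η - α - g) := by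
    rw [← Real.rpow_add (by linarith), ← Real.rpow_add (by linarith)]; congr 1; ring
  have f2 : (d / 2) ^ (η - α - g) ≤ T := by
    have := ht.2
    rw [hTdef]
    gcongr
    linarith
  have f3 : (d / 2) ^ (-ρ) ≤ 2 * d ^ (-ρ) := half_rpow_neg_le hta (by linarith)
  have f4 : (d / 2) ^ (-γ) ≤ 2 * d ^ (-γ) := half_rpow_neg_le hta (by linarith)
  have f5 : 1 ≤ d ^ (-γ) :=
    Real.one_le_rpow_of_pos_of_le_one_of_nonpos hta (by linarith [ht.2]) (by linarith)
  have f6 : d ^ (-γ) * d ^ (-ρ) = d ^ (-γ - ρ) := by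
    rw [← Real.rpow_add hta, ← sub_eq_add_neg]
  have f7 : α - (α + ρ) = -ρ := by ring
  rw [f1, f7]
  calc _ ≤ K * (H * N) * ((2 * d ^ (-ρ)) * (T * d ^ (-γ)))
        + L * (2 * d ^ (-ρ)) * (C * (U + H * N * T) * (2 * d ^ (-γ))) := by
        gcongr
        exact f2.trans (le_mul_of_one_le_right hT f5)
    _ = 2 * K * (H * N * T) * (d ^ (-γ) * d ^ (-ρ))
        + 4 * L * C * (U + H * N * T) * (d ^ (-γ) * d ^ (-ρ)) := by ring
    _ ≤ 2 * K * (U + H * N * T) * (d ^ (-γ) * d ^ (-ρ))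
        + 4 * L * C * (U + H * N * T) * (d ^ (-γ) * d ^ (-ρ)) := by
        gcongr
        linarith
    _ = _ := by rw [f6]; ring

/-- Solutions of the linear equation satisfy weighted bounds with values and increments in
`X_α`. -/
theorem exists_pathBound (hS : X.IsSmoothingSemigroup S A) {η α ρ γ g : ℝ}
    (he : IsExponentTriple η α ρ) (hγ : 0 ≤ γ) (hγα : γ ≤ α) (hγg : γ ≤ g) (hg : g < η - α) :
    ∃ C : ℝ, 1 ≤ C ∧ ∀ (x : ℝ → ℝ) (u φ : ℝ → E) (a b H N U : ℝ),
      X.ForcedSolution S x η α ρ g a b H N u φ → X.NormLE (α - γ) (u a) U →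
      X.PathBound α ρ γ g a b (C * (U + H * N * (b - a) ^ (η - α - g))) u := by
  have hρ := he.pos
  have hle := he.le
  have hlt := he.lt
  have hlt1 := he.lt_one
  have hadd := he.add_le
  obtain ⟨C₁, hC₁, h₁⟩ := hS.exists_value_bound he hγ hγα hγg hg
  obtain ⟨C₂, hC₂, h₂⟩ := hS.exists_value_bound_add he hγ hγα hγg hg
  obtain ⟨C₃, hC₃, h₃⟩ := hS.exists_increment_bound he (hγ.trans hγg)
    (show 0 ≤ α by linarith) (show α < 2 by linarith) (by linarith)
  obtain ⟨C₄, hC₄, h₄⟩ := hS.exists_approx (show 0 ≤ α by linarith)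
    (show α < α + ρ by linarith) hadd
  refine ⟨max C₁ (2 * C₃ + C₄ * C₂), hC₁.trans (le_max_left _ _), ?_⟩
  intro x u φ a b H N U hf hU
  have hHN := mul_nonneg hf.holder_nonneg hf.nonneg
  have hU0 := hU.nonneg
  have hba := hf.le_one
  have hT : 0 ≤ (b - a) ^ (η - α - g) := Real.rpow_nonneg (by linarith [hf.lt]) _
  refine ⟨fun t ht => ?_, fun s t has hst htb => ?_⟩
  · refine (h₁ x u φ a b H N U hf hU t ht).mono ?_
    have := Real.rpow_nonneg (show 0 ≤ t - a by linarith [ht.1]) (-γ)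
    gcongr
    exact le_max_left _ _
  · have hsa : 0 < s - a := by linarith
    have hts : 0 < t - s := by linarith
    have e1 := h₃ x u φ a b H N hf s t has hst htb
    have e2 := h₄ (t - s) ⟨hts.le, by linarith⟩ _ _ (h₂ x u φ a b H N U hf hU s
      ⟨has, by linarith⟩)
    have e3 := e1.add e2
    rw [← sub_eq_hatDeltaOne_add] at e3
    refine e3.mono ?_
    set T := (b - a) ^ (η - α - g) with hTdef
    set d := s - a with hd
    set r := t - s with hr
    have f0 : r ^ (η - α - g) ≤ T := by
      rw [hTdef]
      gcongr
      linarith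
    -- From every power of `r`, the exponent `ρ` is kept for the Hölder bound, `η - α - g` is turned
    -- into the small factor `T`, and the rest is dropped because `r ≤ 1`.
    have f1 : r ^ (η - max (α - α) 0) ≤ r ^ ρ * r ^ (η - α - g) := by
      rw [← Real.rpow_add hts, sub_self, max_self]
      exact Real.rpow_le_rpow_of_exponent_ge hts (by linarith) (by linarith)
    have f2 : r ^ (η + ρ - α) ≤ r ^ ρ * r ^ (η - α - g) := by
      rw [← Real.rpow_add hts]
      exact Real.rpow_le_rpow_of_exponent_ge hts (by linarith) (by linarith)
    have f3 : d ^ (-g) ≤ d ^ (-g - ρ) :=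
      Real.rpow_le_rpow_of_exponent_ge hsa (by linarith) (by linarith)
    have f4 : d ^ (-γ - ρ) ≤ d ^ (-g - ρ) :=
      Real.rpow_le_rpow_of_exponent_ge hsa (by linarith) (by linarith)
    have f5 : α + ρ - α = ρ := by ring
    have f6 : 0 ≤ d ^ (-g - ρ) := Real.rpow_nonneg hsa.le _
    rw [f5]
    calc _ ≤ C₃ * (H * N) * (d ^ (-g - ρ) * (r ^ ρ * T) + d ^ (-g - ρ) * (r ^ ρ * T))
          + C₄ * r ^ ρ * (C₂ * (U + H * N * T) * d ^ (-g - ρ)) := by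
          have f7 : r ^ ρ * r ^ (η - α - g) ≤ r ^ ρ * T := by gcongr
          gcongr
          · exact f1.trans f7
          · exact f2.trans f7
      _ = 2 * C₃ * (H * N * T) * r ^ ρ * d ^ (-g - ρ)
          + C₄ * C₂ * (U + H * N * T) * r ^ ρ * d ^ (-g - ρ) := by ring
      _ ≤ 2 * C₃ * (U + H * N * T) * r ^ ρ * d ^ (-g - ρ)
          + C₄ * C₂ * (U + H * N * T) * r ^ ρ * d ^ (-g - ρ) := by
          gcongr
          linarith
      _ = (2 * C₃ + C₄ * C₂) * (U + H * N * T) * r ^ ρ * d ^ (-g - ρ) := by ring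
      _ ≤ _ := by
          gcongr
          exact le_max_right _ _

/-- Solutions of the linear equation are `α`-Hölder continuous in the base space. -/
theorem exists_holder_bound (hS : X.IsSmoothingSemigroup S A) {η α ρ γ g : ℝ}
    (he : IsExponentTriple η α ρ) (hγ : 0 ≤ γ) (hγα : γ ≤ α) (hγg : γ ≤ g) (hg : g < η - α) :
    ∃ C : ℝ, 1 ≤ C ∧ ∀ (x : ℝ → ℝ) (u φ : ℝ → E) (a b H N U : ℝ),
      X.ForcedSolution S x η α ρ g a b H N u φ → X.NormLE (α - γ) (u a) U →
      ∀ s t, a < s → s < t → t ≤ b →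
        ‖u t - u s‖ ≤ C * (U + H * N) * (t - s) ^ α * (s - a) ^ (-γ) := by
  have hρ := he.pos
  have hle := he.le
  have hlt := he.lt
  have hlt1 := he.lt_one
  have hadd := he.add_le
  obtain ⟨C₁, hC₁, h₁⟩ := hS.exists_value_bound he hγ hγα hγg hg
  obtain ⟨C₂, hC₂, h₂⟩ := hS.exists_increment_bound_full he (hγ.trans hγg) le_rfl two_pos
    (by linarith)
  obtain ⟨C₃, hC₃, h₃⟩ := hS.exists_norm_sub_le (show 0 < α by linarith) (by linarith)
  refine ⟨C₂ + C₃ * C₁, by nlinarith, ?_⟩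
  intro x u φ a b H N U hf hU s t has hst htb
  have hHN := mul_nonneg hf.holder_nonneg hf.nonneg
  have hU0 := hU.nonneg
  have hba := hf.le_one
  have hab := hf.lt
  have hsa : 0 < s - a := by linarith
  have hts : 0 < t - s := by linarith
  have hT : 0 ≤ (b - a) ^ (η - α - g) := Real.rpow_nonneg (by linarith) _
  have hT1 : (b - a) ^ (η - α - g) ≤ 1 :=
    Real.rpow_le_one (by linarith) hba (by linarith)
  have e1 := normLE_zero_iff.1 (h₂ x u φ a b H N hf s t has.le hst htb)
  have e2 := h₃ (t - s) ⟨hts.le, by linarith⟩ _ _ (h₁ x u φ a b H N U hf hU s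
      ⟨has, by linarith⟩)
  have f1 : (t - s) ^ (η - g - 0) ≤ (t - s) ^ α :=
    Real.rpow_le_rpow_of_exponent_ge hts (by linarith) (by linarith)
  have f2 : 1 ≤ (s - a) ^ (-γ) :=
    Real.one_le_rpow_of_pos_of_le_one_of_nonpos hsa (by linarith) (by linarith)
  have f3 : U + H * N * (b - a) ^ (η - α - g) ≤ U + H * N := by
    linarith [mul_le_of_le_one_right hHN hT1]
  have f4 : H * N ≤ U + H * N := by linarith
  have f5 : 0 ≤ (t - s) ^ α := Real.rpow_nonneg hts.le _
  rw [sub_eq_hatDeltaOne_add S]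
  calc _ ≤ C₂ * (H * N) * (t - s) ^ (η - g - 0)
        + C₃ * (t - s) ^ α * (C₁ * (U + H * N * (b - a) ^ (η - α - g)) * (s - a) ^ (-γ)) :=
        (norm_add_le _ _).trans (add_le_add e1 e2)
    _ ≤ C₂ * (U + H * N) * ((t - s) ^ α * (s - a) ^ (-γ))
        + C₃ * (t - s) ^ α * (C₁ * (U + H * N) * (s - a) ^ (-γ)) := by
        gcongr
        exact f1.trans (le_mul_of_one_le_right f5 f2)
    _ = _ := by ring

end IsSmoothingSemigroup

end BanachScale

/-! ### The nonlinearity on weighted bounds -/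

namespace BanachScale

variable {E : Type u} [NormedAddCommGroup E] [NormedSpace ℝ E] {X : BanachScale.{u, v} E}

theorem PathBound.exists_forcingBound (X : BanachScale.{u, v} E) {α : ℝ} (hα0 : 0 ≤ α)
    (hα2 : α < 2) : ∃ K : ℝ, 1 ≤ K ∧ ∀ (ρ γ g a b N : ℝ) (u : ℝ → E), γ ≤ g → b - a ≤ 1 →
      0 ≤ N → X.PathBound α ρ γ g a b N u → X.ForcingBound α ρ g a b (K * N) u := by
  obtain ⟨K, hK1, hK⟩ := X.exists_normLE_embed le_rfl hα0 hα2
  refine ⟨K, hK1, fun ρ γ g a b N u hγg hab hN hu => ⟨fun s hs => ?_, fun s t h1 h2 h3 => ?_⟩⟩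
  · refine (hu.norm s hs).mono ?_
    have hsa : 0 < s - a := by linarith [hs.1]
    have e : (s - a) ^ (-γ) ≤ (s - a) ^ (-g) :=
      Real.rpow_le_rpow_of_exponent_ge hsa (by linarith [hs.2]) (by linarith)
    gcongr
    exact le_mul_of_one_le_left hN hK1
  · exact (normLE_zero_iff.1 (hK _ _ (hu.incr s t h1 h2 h3))).trans (le_of_eq (by ring))

theorem PathBound.mono {α ρ γ g g' a b N N' : ℝ} {u : ℝ → E} (h : X.PathBound α ρ γ g a b N u)
    (hab : b - a ≤ 1) (hN : 0 ≤ N) (hNN' : N ≤ N') (hg : g ≤ g') :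
    X.PathBound α ρ γ g' a b N' u := by
  refine ⟨fun s hs => (h.norm s hs).mono ?_, fun s t h1 h2 h3 => (h.incr s t h1 h2 h3).mono ?_⟩
  · have hsa : 0 < s - a := by linarith [hs.1]
    gcongr
  · have hsa : 0 < s - a := by linarith
    have hts : 0 < t - s := by linarith
    have e : (s - a) ^ (-g - ρ) ≤ (s - a) ^ (-g' - ρ) :=
      Real.rpow_le_rpow_of_exponent_ge hsa (by linarith) (by linarith)
    have := hN.trans hNN'
    gcongr

theorem PathBound.sub {α ρ γ g a b N N' : ℝ} {u u' : ℝ → E} (h : X.PathBound α ρ γ g a b N u)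
    (h' : X.PathBound α ρ γ g a b N' u') : X.PathBound α ρ γ g a b (N + N') (u - u') := by
  refine ⟨fun s hs => ((h.norm s hs).sub (h'.norm s hs)).mono (le_of_eq (by ring)),
    fun s t h1 h2 h3 => ?_⟩
  have e := (h.incr s t h1 h2 h3).sub (h'.incr s t h1 h2 h3)
  rw [sub_sub_sub_comm] at e
  exact e.mono (le_of_eq (by ring))

namespace IsAdmissibleNonlinearity

variable {σ : E → E} {α ω : ℝ}

/-- Mean value inequality along a segment; directional derivatives suffice for this. -/
theorem exists_lipschitz (hσ : X.IsAdmissibleNonlinearity σ α ω) :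
    ∃ C : ℝ, 1 ≤ C ∧ ∀ w z, ‖σ w - σ z‖ ≤ C * ‖w - z‖ := by
  obtain ⟨σ', h1, ⟨C, hC⟩, -⟩ := hσ.gateaux
  refine ⟨max 1 C, le_max_left _ _, fun w z => ?_⟩
  have hd : ∀ r : ℝ, HasDerivAt (fun r : ℝ => σ (z + r • (w - z)))
      (σ' (z + r • (w - z)) (w - z)) r := fun r => by
    have h := h1 (z + r • (w - z)) (w - z)
    rw [HasLineDerivAt] at h
    have h2 := HasDerivAt.comp_sub_const (f := fun t : ℝ => σ (z + r • (w - z) + t • (w - z))) r r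
      (by rwa [sub_self])
    refine h2.congr_of_eventuallyEq (Eventually.of_forall fun q => ?_)
    simp only [sub_smul]
    congr 1
    abel
  have h := norm_image_sub_le_of_norm_deriv_le_segment_01'
    (C := max 1 C * ‖w - z‖) (fun r _ => (hd r).hasDerivWithinAt) (fun r _ => by
      refine ((σ' _).le_opNorm _).trans ?_
      gcongr
      exact (hC _).trans (le_max_right _ _))
  simpa using h

theorem exists_growth (hσ : X.IsAdmissibleNonlinearity σ α ω) :
    ∃ L : ℝ, 1 ≤ L ∧ ∀ w c, X.NormLE α w c → X.NormLE α (σ w) (L * (1 + c)) := by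
  obtain ⟨σα, h1, -, L, hL, h2⟩ := hσ.restriction
  refine ⟨max 1 L, le_max_left _ _, ?_⟩
  rintro w c ⟨v, rfl, hv⟩
  refine ⟨σα v, h1 v, (h2 v).trans ?_⟩
  have := norm_nonneg v
  gcongr
  exact le_max_right _ _

theorem exists_local_lipschitz (hσ : X.IsAdmissibleNonlinearity σ α ω) (hα : α ∈ Ico (0 : ℝ) 2) :
    ∃ K : ℝ, 1 ≤ K ∧ ∀ R, 0 < R → ∀ w z d, X.NormLE α w R → X.NormLE α z R →
      X.NormLE α (w - z) d → X.NormLE α (σ w - σ z) (K * (1 + R) ^ ω * d) := by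
  obtain ⟨σα, h1, ⟨K, hK, h2⟩, -⟩ := hσ.restriction
  refine ⟨max 1 K, le_max_left _ _, ?_⟩
  rintro R hR w z d ⟨v, rfl, hv⟩ ⟨v', rfl, hv'⟩ hd
  rw [← map_sub, normLE_incl_iff hα] at hd
  refine ⟨σα v - σα v', by rw [map_sub, h1, h1], (h2 R hR v v' hv hv').trans ?_⟩
  gcongr
  exact le_max_right _ _

/-- Along the segments from `z_i` to `y_i`, the difference of the derivatives splits into `σ'`
applied to the second difference and a difference of two values of `σ'` applied to `y₀ - z₀`. The
latter is small in time through `d` and linear in the distance of the two paths, as a contraction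
needs. -/
theorem exists_second_difference (hσ : X.IsAdmissibleNonlinearity σ α ω)
    (hα : α ∈ Ico (0 : ℝ) 2) :
    ∃ K : ℝ, 1 ≤ K ∧ ∀ R, 0 < R → ∀ y₀ y₁ z₀ z₁ d, X.NormLE α y₀ R → X.NormLE α y₁ R →
      X.NormLE α z₀ R → X.NormLE α z₁ R → X.NormLE α (y₁ - y₀) d → X.NormLE α (z₁ - z₀) d →
      ‖(σ y₁ - σ z₁) - (σ y₀ - σ z₀)‖ ≤ K * (‖(y₁ - z₁) - (y₀ - z₀)‖
        + (1 + R) ^ (ω - 1) * d * ‖y₀ - z₀‖) := by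
  obtain ⟨σ', h1, ⟨C, hC⟩, K, hK, h2⟩ := hσ.gateaux
  refine ⟨max 1 (max C K), le_max_left _ _, ?_⟩
  rintro R hR _ _ _ _ d ⟨y₀, rfl, hy₀⟩ ⟨y₁, rfl, hy₁⟩ ⟨z₀, rfl, hz₀⟩ ⟨z₁, rfl, hz₁⟩ hdy hdz
  rw [← map_sub, normLE_incl_iff hα] at hdy hdz
  have hd0 : 0 ≤ d := (norm_nonneg _).trans hdy
  have hd : ∀ (w z : E) (r : ℝ), HasDerivAt (fun r : ℝ => σ (z + r • (w - z)))
      (σ' (z + r • (w - z)) (w - z)) r := fun w z r => by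
    have h := h1 (z + r • (w - z)) (w - z)
    rw [HasLineDerivAt] at h
    have h2 := HasDerivAt.comp_sub_const (f := fun t : ℝ => σ (z + r • (w - z) + t • (w - z))) r r
      (by rwa [sub_self])
    refine h2.congr_of_eventuallyEq (Eventually.of_forall fun q => ?_)
    simp only [sub_smul]
    congr 1
    abel
  set i := X.incl α with hi
  have hconv : ∀ (y z : X.Sp α) (c r : ℝ), r ∈ Icc (0 : ℝ) 1 → ‖y‖ ≤ c → ‖z‖ ≤ c →
      ‖z + r • (y - z)‖ ≤ c := fun y z c r hr hy hz => by
    have e : z + r • (y - z) = (1 - r) • z + r • y := by module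
    rw [e]
    refine (norm_add_le _ _).trans ?_
    rw [norm_smul, norm_smul, Real.norm_of_nonneg hr.1, Real.norm_of_nonneg (by linarith [hr.2])]
    nlinarith [hr.1, hr.2]
  have hle : ∀ r ∈ Ico (0 : ℝ) 1,
      ‖σ' (i z₁ + r • (i y₁ - i z₁)) (i y₁ - i z₁) - σ' (i z₀ + r • (i y₀ - i z₀)) (i y₀ - i z₀)‖
      ≤ max 1 (max C K) * (‖(i y₁ - i z₁) - (i y₀ - i z₀)‖
        + (1 + R) ^ (ω - 1) * d * ‖i y₀ - i z₀‖) := fun r hr => by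
    have hr' : r ∈ Icc (0 : ℝ) 1 := ⟨hr.1, hr.2.le⟩
    have e1 : i z₁ + r • (i y₁ - i z₁) = i (z₁ + r • (y₁ - z₁)) := by simp
    have e2 : i z₀ + r • (i y₀ - i z₀) = i (z₀ + r • (y₀ - z₀)) := by simp
    have e3 := h2 R hR _ _ (hconv y₁ z₁ R r hr' hy₁ hz₁) (hconv y₀ z₀ R r hr' hy₀ hz₀)
      (i y₀ - i z₀)
    have e4 : ‖z₁ + r • (y₁ - z₁) - (z₀ + r • (y₀ - z₀))‖ ≤ d := by
      have := hconv (y₁ - y₀) (z₁ - z₀) d r hr' hdy hdz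
      refine le_of_eq_of_le ?_ this
      congr 1
      module
    have e5 : σ' (i z₁ + r • (i y₁ - i z₁)) (i y₁ - i z₁)
          - σ' (i z₀ + r • (i y₀ - i z₀)) (i y₀ - i z₀)
        = σ' (i z₁ + r • (i y₁ - i z₁)) ((i y₁ - i z₁) - (i y₀ - i z₀))
          + (σ' (i z₁ + r • (i y₁ - i z₁)) (i y₀ - i z₀)
            - σ' (i z₀ + r • (i y₀ - i z₀)) (i y₀ - i z₀)) := by
      rw [map_sub _ (i y₁ - i z₁) (i y₀ - i z₀)]; abel
    rw [e5]
    rw [← e1, ← e2] at e3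
    have hCm : C ≤ max 1 (max C K) := (le_max_left _ _).trans (le_max_right _ _)
    have hKm : K ≤ max 1 (max C K) := (le_max_right _ _).trans (le_max_right _ _)
    calc _ ≤ max 1 (max C K) * ‖(i y₁ - i z₁) - (i y₀ - i z₀)‖
          + K * (1 + R) ^ (ω - 1) * ‖z₁ + r • (y₁ - z₁) - (z₀ + r • (y₀ - z₀))‖
            * ‖i y₀ - i z₀‖ := by
          refine (norm_add_le _ _).trans (add_le_add (((σ' _).le_opNorm _).trans ?_) e3)
          gcongr
          exact (hC _).trans hCm
      _ ≤ max 1 (max C K) * ‖(i y₁ - i z₁) - (i y₀ - i z₀)‖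
          + max 1 (max C K) * (1 + R) ^ (ω - 1) * d * ‖i y₀ - i z₀‖ := by gcongr
      _ = _ := by ring
  have h := norm_image_sub_le_of_norm_deriv_le_segment_01'
    (fun r _ => ((hd (i y₁) (i z₁) r).sub (hd (i y₀) (i z₀) r)).hasDerivWithinAt) hle
  refine le_of_eq_of_le ?_ h
  simp only [Pi.sub_apply, one_smul, zero_smul, add_zero, add_sub_cancel]
  congr 1
  abel

/-- The nonlinearity maps weighted bounds to weighted bounds, with linear growth. -/
theorem exists_forcingBound_comp (hσ : X.IsAdmissibleNonlinearity σ α ω) :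
    ∃ C : ℝ, 1 ≤ C ∧ ∀ (ρ γ a b N : ℝ) (u : ℝ → E), 0 ≤ γ → b - a ≤ 1 → 0 ≤ N →
      X.ForcingBound α ρ γ a b N u →
      X.ForcingBound α ρ γ a b (C * (1 + N)) (fun t => σ (u t)) := by
  obtain ⟨C, hC, h1⟩ := hσ.exists_lipschitz
  obtain ⟨L, hL, h2⟩ := hσ.exists_growth
  refine ⟨max C L, hC.trans (le_max_left _ _), fun ρ γ a b N u hγ hab hN hu =>
    ⟨fun s hs => (h2 _ _ (hu.norm s hs)).mono ?_, fun s t has hst htb => (h1 _ _).trans ?_⟩⟩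
  · have hsa : 0 < s - a := by linarith [hs.1]
    have e : 1 ≤ (s - a) ^ (-γ) :=
      Real.one_le_rpow_of_pos_of_le_one_of_nonpos hsa (by linarith [hs.2]) (by linarith)
    calc L * (1 + N * (s - a) ^ (-γ)) ≤ max C L * ((s - a) ^ (-γ) + N * (s - a) ^ (-γ)) := by
          gcongr
          exact le_max_right _ _
      _ = _ := by ring
  · have hsa : 0 < s - a := by linarith
    have hts : 0 < t - s := by linarith
    calc _ ≤ max C L * (N * (t - s) ^ ρ * (s - a) ^ (-γ - ρ)) := by
          gcongr
          · exact le_max_left _ _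
          · exact hu.incr s t has hst htb
      _ ≤ max C L * ((1 + N) * (t - s) ^ ρ * (s - a) ^ (-γ - ρ)) := by
          gcongr
          linarith
      _ = _ := by ring

/-- The nonlinearity is Lipschitz continuous with respect to the weighted bounds, on sets where
these bounds are uniform. -/
theorem exists_forcingBound_sub (hσ : X.IsAdmissibleNonlinearity σ α ω) (hα : α ∈ Ico (0 : ℝ) 2)
    (hω : 1 ≤ ω) {R : ℝ} (hR : 0 < R) :
    ∃ C : ℝ, 1 ≤ C ∧ ∀ (ρ γ a b N : ℝ) (y z : ℝ → E), 0 ≤ γ → b - a ≤ 1 → 0 ≤ N →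
      X.PathBound α ρ γ γ a b R y → X.PathBound α ρ γ γ a b R z →
      X.PathBound α ρ γ ((1 + ω) * γ) a b N (y - z) →
      X.ForcingBound α ρ ((1 + ω) * γ) a b (C * N)
        ((fun t => σ (y t)) - fun t => σ (z t)) := by
  obtain ⟨K₁, hK₁, h₁⟩ := hσ.exists_local_lipschitz hα
  obtain ⟨K₂, hK₂, h₂⟩ := hσ.exists_second_difference hα
  obtain ⟨K₃, hK₃, h₃⟩ := X.exists_normLE_embed le_rfl hα.1 hα.2
  have hR1 : 1 ≤ (1 + R) ^ ω := Real.one_le_rpow (by linarith) (by linarith)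
  have hR2 : 1 ≤ (1 + R) ^ (ω - 1) := Real.one_le_rpow (by linarith) (by linarith)
  refine ⟨max (K₁ * (1 + R) ^ ω) (K₂ * (K₃ + (1 + R) ^ (ω - 1) * R * K₃)), ?_, ?_⟩
  · exact (one_le_mul_of_one_le_of_one_le hK₁ hR1).trans (le_max_left _ _)
  intro ρ γ a b N y z hγ hab hN hy hz hyz
  refine ⟨fun s hs => ?_, fun s t has hst htb => ?_⟩
  · have hsa : 0 < s - a := by linarith [hs.1]
    have hD : 1 ≤ (s - a) ^ (-γ) :=
      Real.one_le_rpow_of_pos_of_le_one_of_nonpos hsa (by linarith [hs.2]) (by linarith)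
    -- The radius at time `s` is `R (s-a)^{-γ}`, so the Lipschitz constant contributes the weight
    -- `ωγ`; with the weight `γ` of `y - z` this is the origin of `(1 + ω)γ`.
    refine (h₁ (R * (s - a) ^ (-γ)) (by positivity) _ _ _ (hy.norm s hs) (hz.norm s hs)
      (hyz.norm s hs)).mono ?_
    have e1 : (1 + R * (s - a) ^ (-γ)) ^ ω ≤ (1 + R) ^ ω * (s - a) ^ (-γ * ω) := by
      rw [Real.rpow_mul hsa.le, ← Real.mul_rpow (by linarith) (by linarith)]
      gcongr
      linarith
    have e2 : (s - a) ^ (-γ * ω) * (s - a) ^ (-γ) = (s - a) ^ (-((1 + ω) * γ)) := by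
      rw [← Real.rpow_add hsa]; congr 1; ring
    calc _ ≤ K₁ * ((1 + R) ^ ω * (s - a) ^ (-γ * ω)) * (N * (s - a) ^ (-γ)) := by gcongr
      _ = K₁ * (1 + R) ^ ω * N * ((s - a) ^ (-γ * ω) * (s - a) ^ (-γ)) := by ring
      _ = K₁ * (1 + R) ^ ω * N * (s - a) ^ (-((1 + ω) * γ)) := by rw [e2]
      _ ≤ _ := by
        gcongr
        exact le_max_left _ _
  · have hsa : 0 < s - a := by linarith
    have hts : 0 < t - s := by linarith
    have hD : 1 ≤ (s - a) ^ (-γ) :=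
      Real.one_le_rpow_of_pos_of_le_one_of_nonpos hsa (by linarith) (by linarith)
    have hD' : R * (t - a) ^ (-γ) ≤ R * (s - a) ^ (-γ) := by
      have : (t - a) ^ (-γ) ≤ (s - a) ^ (-γ) :=
        Real.rpow_le_rpow_of_nonpos hsa (by linarith) (by linarith)
      gcongr
    have hs : s ∈ Ioc a b := ⟨has, by linarith⟩
    have ht : t ∈ Ioc a b := ⟨by linarith, htb⟩
    have e := h₂ (R * (s - a) ^ (-γ)) (by positivity) _ _ _ _ _ (hy.norm s hs)
      ((hy.norm t ht).mono hD') (hz.norm s hs) ((hz.norm t ht).mono hD') (hy.incr s t has hst htb)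
      (hz.incr s t has hst htb)
    have f1 := normLE_zero_iff.1 (h₃ _ _ (hyz.incr s t has hst htb))
    have f2 := normLE_zero_iff.1 (h₃ _ _ (hyz.norm s hs))
    simp only [Pi.sub_apply] at f1 f2 ⊢
    refine e.trans ?_
    have e1 : (1 + R * (s - a) ^ (-γ)) ^ (ω - 1)
        ≤ (1 + R) ^ (ω - 1) * (s - a) ^ (-γ * (ω - 1)) := by
      rw [Real.rpow_mul hsa.le, ← Real.mul_rpow (by linarith) (by linarith)]
      gcongr
      · linarith
    -- The weights are `(ω-1)γ` from the Lipschitz constant of `σ'`, `γ + ρ` from the time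
    -- increments and `γ` from `y - z`, in total again `(1+ω)γ + ρ`.
    have e2 : (s - a) ^ (-γ * (ω - 1)) * (s - a) ^ (-γ - ρ) * (s - a) ^ (-γ)
        = (s - a) ^ (-((1 + ω) * γ) - ρ) := by
      rw [← Real.rpow_add hsa, ← Real.rpow_add hsa]; congr 1; ring
    calc _ ≤ K₂ * (K₃ * (N * (t - s) ^ ρ * (s - a) ^ (-((1 + ω) * γ) - ρ))
          + ((1 + R) ^ (ω - 1) * (s - a) ^ (-γ * (ω - 1)))
            * (R * (t - s) ^ ρ * (s - a) ^ (-γ - ρ)) * (K₃ * (N * (s - a) ^ (-γ)))) := by gcongr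
      _ = K₂ * (K₃ * (N * (t - s) ^ ρ * (s - a) ^ (-((1 + ω) * γ) - ρ))
          + (1 + R) ^ (ω - 1) * R * K₃ * N * (t - s) ^ ρ
            * ((s - a) ^ (-γ * (ω - 1)) * (s - a) ^ (-γ - ρ) * (s - a) ^ (-γ))) := by ring
      _ = (K₂ * (K₃ + (1 + R) ^ (ω - 1) * R * K₃)) * N * (t - s) ^ ρ
            * (s - a) ^ (-((1 + ω) * γ) - ρ) := by rw [e2]; ring
      _ ≤ _ := by
        gcongr
        exact le_max_right _ _

end IsAdmissibleNonlinearity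

end BanachScale

/-! ### Mollification of the driving path -/

section Mollification

theorem continuousOn_of_holder_bound {F : Type*} [NormedAddCommGroup F] {f : ℝ → F} {c d C p : ℝ}
    (hp : 0 < p) (h : ∀ s t, c ≤ s → s ≤ t → t ≤ d → ‖f t - f s‖ ≤ C * (t - s) ^ p) :
    ContinuousOn f (Icc c d) := by
  intro r hr
  rw [ContinuousWithinAt, tendsto_iff_norm_sub_tendsto_zero]
  have h1 : ∀ᶠ q in 𝓝[Icc c d] r, ‖f q - f r‖ ≤ C * |q - r| ^ p := by
    filter_upwards [self_mem_nhdsWithin] with q hq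
    rcases le_total q r with hqr | hqr
    · rw [norm_sub_rev, abs_of_nonpos (by linarith), neg_sub]
      exact h q r hq.1 hqr hr.2
    · rw [abs_of_nonneg (by linarith)]
      exact h r q hr.1 hqr hq.2
  refine squeeze_zero' (Eventually.of_forall fun _ => norm_nonneg _) h1 ?_
  have h2 : Tendsto (fun q => |q - r|) (𝓝[Icc c d] r) (𝓝 |r - r|) :=
    ((tendsto_id.sub_const r).abs).mono_left nhdsWithin_le_nhds
  rw [sub_self, abs_zero] at h2
  have h3 := (h2.rpow_const (p := p) (Or.inr hp.le)).const_mul C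
  rwa [Real.zero_rpow hp.ne', mul_zero] at h3

/-- Mollification of a Hölder continuous function. -/
theorem exists_mollification {x : ℝ → ℝ} {H η : ℝ} (hH : 0 ≤ H) (hη : 0 < η)
    (hx : ∀ s t, s ≤ t → |x t - x s| ≤ H * (t - s) ^ η) {δ : ℝ} (hδ : 0 < δ) :
    ∃ m m' : ℝ → ℝ, Continuous m' ∧ (∀ t, HasDerivAt m (m' t) t) ∧
      (∀ s t, s ≤ t → |m t - m s| ≤ H * (t - s) ^ η) ∧ ∀ t, |m t - x t| ≤ H * δ ^ η := by
  have hcont : Continuous x := by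
    rw [continuous_iff_continuousAt]
    intro t
    have h := continuousOn_of_holder_bound (f := x) (c := t - 1) (d := t + 1) hη
      (fun r q _ h2 _ => by rw [Real.norm_eq_abs]; exact hx r q h2)
    exact h.continuousAt (Icc_mem_nhds (by linarith) (by linarith))
  have hint : ∀ p q, IntervalIntegrable x MeasureTheory.volume p q :=
    fun p q => hcont.intervalIntegrable p q
  have hshift : ∀ t, ∫ r in t..(t + δ), x r = ∫ r in (0 : ℝ)..δ, x (t + r) := fun t => by
    rw [intervalIntegral.integral_comp_add_left, add_zero]
  have hint' : ∀ t, IntervalIntegrable (fun r => x (t + r)) MeasureTheory.volume 0 δ :=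
    fun t => (hcont.comp (continuous_const.add continuous_id)).intervalIntegrable _ _
  -- The mollification is the average over `[t, t+δ]`: being an average of translates of `x`, it
  -- inherits the Hölder constant `H`.
  refine ⟨fun t => δ⁻¹ * ∫ r in t..(t + δ), x r, fun t => δ⁻¹ * (x (t + δ) - x t), by fun_prop,
    fun t => ?_, fun s t hst => ?_, fun t => ?_⟩
  · have h1 : ∀ t, HasDerivAt (fun t => ∫ r in (0 : ℝ)..t, x r) (x t) t := fun t =>
      intervalIntegral.integral_hasDerivAt_right (hint 0 t)
        (hcont.stronglyMeasurableAtFilter _ _) hcont.continuousAt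
    have h2 := (((h1 (t + δ)).comp_add_const t δ).sub (h1 t)).const_mul δ⁻¹
    refine h2.congr_of_eventuallyEq (Eventually.of_forall fun s => ?_)
    simp only [Pi.sub_apply]
    rw [intervalIntegral.integral_interval_sub_left (hint _ _) (hint _ _)]
  · have h1 : (δ⁻¹ * ∫ r in t..(t + δ), x r) - δ⁻¹ * ∫ r in s..(s + δ), x r
        = δ⁻¹ * ∫ r in (0 : ℝ)..δ, (x (t + r) - x (s + r)) := by
      rw [hshift, hshift, intervalIntegral.integral_sub (hint' t) (hint' s), mul_sub]
    have h2 := intervalIntegral.norm_integral_le_of_norm_le_const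
      (f := fun r => x (t + r) - x (s + r)) (a := 0) (b := δ) (C := H * (t - s) ^ η)
      (fun r _ => by
        rw [Real.norm_eq_abs]
        refine (hx _ _ (by linarith)).trans (le_of_eq ?_)
        rw [add_sub_add_right_eq_sub])
    rw [h1, abs_mul, abs_of_pos (inv_pos.2 hδ), ← Real.norm_eq_abs (∫ r in (0 : ℝ)..δ, _)]
    rw [sub_zero, abs_of_pos hδ] at h2
    calc _ ≤ δ⁻¹ * (H * (t - s) ^ η * δ) := by gcongr
      _ = _ := by field_simp
  · have h1 : (δ⁻¹ * ∫ r in t..(t + δ), x r) - x t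
        = δ⁻¹ * ∫ r in (0 : ℝ)..δ, (x (t + r) - x t) := by
      rw [hshift, intervalIntegral.integral_sub (hint' t) (by simp)]
      simp only [intervalIntegral.integral_const, sub_zero, smul_eq_mul]
      field_simp
    have h2 := intervalIntegral.norm_integral_le_of_norm_le_const
      (f := fun r => x (t + r) - x t) (a := 0) (b := δ) (C := H * δ ^ η)
      (fun r hr => by
        rw [uIoc_of_le hδ.le] at hr
        rw [Real.norm_eq_abs]
        refine (hx _ _ (by linarith [hr.1])).trans ?_
        have := hr.1.le
        have := hr.2
        rw [add_sub_cancel_left]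
        gcongr)
    rw [h1, abs_mul, abs_of_pos (inv_pos.2 hδ), ← Real.norm_eq_abs (∫ r in (0 : ℝ)..δ, _)]
    rw [sub_zero, abs_of_pos hδ] at h2
    calc _ ≤ δ⁻¹ * (H * δ ^ η * δ) := by gcongr
      _ = _ := by field_simp

/-- A Hölder continuous function is approximated in weaker Hölder norms by smoother functions which
are uniformly Hölder continuous. -/
theorem exists_smooth_approximation {x : ℝ → ℝ} {H η η' a b : ℝ} (hH : 0 ≤ H) (hη' : 0 < η')
    (hηη' : η' ≤ η) (hab : a ≤ b)
    (hx : ∀ s t, a ≤ s → s ≤ t → t ≤ b → |x t - x s| ≤ H * (t - s) ^ η) {δ : ℝ} (hδ : 0 < δ) :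
    ∃ m m' : ℝ → ℝ, Continuous m' ∧ (∀ t, HasDerivAt m (m' t) t) ∧
      (∀ s t, s ≤ t → |m t - m s| ≤ H * (t - s) ^ η) ∧
      (∀ t ∈ Icc a b, |m t - x t| ≤ H * δ ^ η) ∧
      ∀ s t, a ≤ s → s ≤ t → t ≤ b →
        |(m t - x t) - (m s - x s)| ≤ 2 * H * δ ^ (η - η') * (t - s) ^ η' := by
  have hη : 0 < η := hη'.trans_le hηη'
  -- Extension by constants outside `[a,b]`; the projection onto the interval is nonexpansive, so
  -- the Hölder constant is unchanged.
  set x' : ℝ → ℝ := fun t => x (projIcc a b hab t) with hx'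
  have hx'eq : ∀ t ∈ Icc a b, x' t = x t := fun t ht => by
    simp only [hx', projIcc_of_mem hab ht]
  have hx'h : ∀ s t, s ≤ t → |x' t - x' s| ≤ H * (t - s) ^ η := fun s t hst => by
    have h1 : (projIcc a b hab s : ℝ) ≤ projIcc a b hab t := monotone_projIcc hab hst
    have h2 : (projIcc a b hab t : ℝ) - projIcc a b hab s ≤ t - s := by
      simp only [coe_projIcc]
      simp only [max_def, min_def]
      split_ifs <;> linarith
    refine (hx _ _ (projIcc a b hab s).2.1 h1 (projIcc a b hab t).2.2).trans ?_
    have : (0 : ℝ) ≤ projIcc a b hab t - projIcc a b hab s := by linarith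
    gcongr
  obtain ⟨m, m', h1, h2, h3, h4⟩ := exists_mollification hH hη hx'h hδ
  have h5 : ∀ t ∈ Icc a b, |m t - x t| ≤ H * δ ^ η := fun t ht => by
    rw [← hx'eq t ht]; exact h4 t
  refine ⟨m, m', h1, h2, h3, h5, fun s t has hst htb => ?_⟩
  have hts : 0 ≤ t - s := by linarith
  -- Interpolation: increments shorter than `δ` use the common `η`-Hölder bound, longer ones the
  -- uniform distance of `m` and `x`.
  rcases le_total (t - s) δ with h | h
  · have e1 : |(m t - x t) - (m s - x s)| ≤ H * (t - s) ^ η + H * (t - s) ^ η := by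
      rw [sub_sub_sub_comm]
      exact (abs_sub _ _).trans (add_le_add (h3 s t hst) (hx s t has hst htb))
    refine e1.trans ?_
    have e2 : (t - s) ^ η = (t - s) ^ (η - η') * (t - s) ^ η' := by
      rw [← Real.rpow_add_of_nonneg hts (by linarith) hη'.le, sub_add_cancel]
    have e3 : (t - s) ^ (η - η') ≤ δ ^ (η - η') := by
      gcongr
    rw [e2]
    calc _ = 2 * H * (t - s) ^ (η - η') * (t - s) ^ η' := by ring
      _ ≤ _ := by gcongr
  · have e1 : |(m t - x t) - (m s - x s)| ≤ H * δ ^ η + H * δ ^ η :=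
      (abs_sub _ _).trans (add_le_add (h5 t ⟨by linarith, htb⟩) (h5 s ⟨has, by linarith⟩))
    refine e1.trans ?_
    have e2 : δ ^ η = δ ^ (η - η') * δ ^ η' := by
      rw [← Real.rpow_add hδ, sub_add_cancel]
    rw [e2]
    calc _ = 2 * H * δ ^ (η - η') * δ ^ η' := by ring
      _ ≤ _ := by gcongr

end Mollification

/-! ### Existence for the linear equation -/

namespace BanachScale.IsSmoothingSemigroup

variable {E : Type u} [NormedAddCommGroup E] [NormedSpace ℝ E] {X : BanachScale.{u, v} E}
  {S : ℝ → E →L[ℝ] E} {A : E →ₗ.[ℝ] E}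

theorem convolution_sub (hS : X.IsSmoothingSemigroup S A) (φ : ℝ → E) {r r' t : ℝ} (h1 : r ≤ r')
    (h2 : r' ≤ t) : S (t - r') (φ r') - S (t - r) (φ r) = S (t - r') (hatDeltaOne S φ r r') := by
  rw [hatDeltaOne, map_sub, hS.apply_apply (by linarith) (by linarith), sub_add_sub_cancel t r' r]

/-- The integrand of the convolution integral is continuous away from the initial time. -/
theorem continuousOn_convolution (hS : X.IsSmoothingSemigroup S A) {η α ρ g a b N : ℝ}
    (he : IsExponentTriple η α ρ) (hg : 0 ≤ g) (hab : b - a ≤ 1) (hN : 0 ≤ N) {φ : ℝ → E}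
    (hφ : X.ForcingBound α ρ g a b N φ) {t : ℝ} (htb : t ≤ b) :
    ContinuousOn (fun r => S (t - r) (φ r)) (Ioc a t) := by
  obtain ⟨L, hL1, hL⟩ := hS.exists_norm_bound
  obtain ⟨C, hC, h⟩ := hS.exists_hatDeltaOne_forcing he
  have hρ := he.pos
  intro r hr
  set c := (a + r) / 2 with hc
  have hac : a < c := by linarith [hr.1]
  have hcr : c < r := by linarith [hr.1]
  have h1 : ContinuousOn (fun r => S (t - r) (φ r)) (Icc c t) := by
    refine continuousOn_of_holder_bound (C := L * (C * N * (c - a) ^ (-g - ρ))) hρ ?_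
    intro p q hcp hpq hqt
    rcases hpq.eq_or_lt with rfl | hpq'
    · rw [sub_self, norm_zero, sub_self]
      have := Real.rpow_nonneg (show 0 ≤ c - a by linarith) (-g - ρ)
      positivity
    · rw [hS.convolution_sub φ hpq hqt]
      refine (hL _ ⟨by linarith, by linarith⟩ _).trans ?_
      have e1 := h φ g a b N hab hN hφ p q (by linarith) hpq' (by linarith)
      have e2 : (p - a) ^ (-g - ρ) ≤ (c - a) ^ (-g - ρ) :=
        Real.rpow_le_rpow_of_nonpos (by linarith) (by linarith) (by linarith)
      have e3 : 0 ≤ q - p := by linarith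
      calc _ ≤ L * (C * N * (q - p) ^ ρ * (p - a) ^ (-g - ρ)) := by gcongr
        _ ≤ L * (C * N * (q - p) ^ ρ * (c - a) ^ (-g - ρ)) := by gcongr
        _ = _ := by ring
  refine (h1 r ⟨hcr.le, hr.2⟩).mono_of_mem_nhdsWithin ?_
  filter_upwards [mem_nhdsWithin_of_mem_nhds (Ioi_mem_nhds hcr), self_mem_nhdsWithin] with q hq hq'
  exact ⟨le_of_lt hq, hq'.2⟩

/-- The integrand is dominated by a multiple of `(r-a)^{-g}`, which is integrable up to `a` because
`g < 1`. -/
theorem integrableOn_convolution (hS : X.IsSmoothingSemigroup S A) {η α ρ g a b N : ℝ}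
    (he : IsExponentTriple η α ρ) (hg : 0 ≤ g) (hg1 : g < 1) (hab : b - a ≤ 1) (hN : 0 ≤ N)
    {φ : ℝ → E} (hφ : X.ForcingBound α ρ g a b N φ) {m' : ℝ → ℝ} (hm' : Continuous m') {t : ℝ}
    (hat : a ≤ t) (htb : t ≤ b) :
    IntervalIntegrable (fun r => m' r • S (t - r) (φ r)) MeasureTheory.volume a t := by
  obtain ⟨L, hL1, hL⟩ := hS.exists_norm_bound
  obtain ⟨K, hK1, hK⟩ := X.exists_normLE_embed le_rfl (show 0 ≤ α by linarith [he.pos, he.le])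
    (show α < 2 by linarith [he.lt, he.lt_one])
  have h1 : ContinuousOn (fun r => m' r • S (t - r) (φ r)) (Ioc a t) :=
    hm'.continuousOn.smul (hS.continuousOn_convolution he hg hab hN hφ htb)
  obtain ⟨B, hB⟩ := (isCompact_Icc (a := a) (b := t)).exists_bound_of_continuousOn
    hm'.continuousOn
  have h2 : IntervalIntegrable (fun r => B * (L * (K * N)) * (r - a) ^ (-g))
      MeasureTheory.volume a t := by
    have h := (intervalIntegral.intervalIntegrable_rpow' (a := 0) (b := t - a) (r := -g)
      (by linarith)).comp_sub_right a
    simp only [zero_add, sub_add_cancel] at h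
    exact h.const_mul _
  rw [intervalIntegrable_iff_integrableOn_Ioc_of_le hat] at h2 ⊢
  refine h2.mono' (h1.aestronglyMeasurable measurableSet_Ioc) ?_
  rw [MeasureTheory.ae_restrict_iff' measurableSet_Ioc]
  refine Eventually.of_forall fun r hr => ?_
  have e1 := normLE_zero_iff.1 (hK _ _ (hφ.norm r ⟨hr.1, hr.2.trans htb⟩))
  have e2 := hL (t - r) ⟨by linarith [hr.2], by linarith [hr.1]⟩ (φ r)
  have e3 := hB r ⟨hr.1.le, hr.2⟩
  rw [norm_smul]
  calc _ ≤ B * (L * (K * (N * (r - a) ^ (-g)))) := by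
        gcongr
        · exact (norm_nonneg _).trans e3
        · exact e2.trans (by gcongr)
    _ = _ := by ring

/-- Convolution integrals with respect to smooth paths are solutions. -/
theorem exists_isSolution_smooth (hS : X.IsSmoothingSemigroup S A) [CompleteSpace E]
    {η α ρ g a b N : ℝ} (he : IsExponentTriple η α ρ) (hg : 0 ≤ g) (hg1 : g < 1)
    (hab1 : b - a ≤ 1) (hN : 0 ≤ N) {φ : ℝ → E}
    (hφ : X.ForcingBound α ρ g a b N φ) {m m' : ℝ → ℝ} (hm' : Continuous m')
    (hm : ∀ t, HasDerivAt m (m' t) t) : ∃ u : ℝ → E, u a = 0 ∧ IsSolution S m u φ a b := by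
  obtain ⟨L, hL1, hL⟩ := hS.exists_norm_bound
  obtain ⟨C, hC, h⟩ := hS.exists_hatDeltaOne_forcing he
  have hρ := he.pos
  set u : ℝ → E := fun t => ∫ r in a..t, m' r • S (t - r) (φ r) with hu
  have hint : ∀ t, a ≤ t → t ≤ b →
      IntervalIntegrable (fun r => m' r • S (t - r) (φ r)) MeasureTheory.volume a t :=
    fun t h1 h2 => hS.integrableOn_convolution he hg hg1 hab1 hN hφ hm' h1 h2
  have hshift : ∀ s t, a ≤ s → s ≤ t → t ≤ b →
      S (t - s) (u s) = ∫ r in a..s, m' r • S (t - r) (φ r) := fun s t h1 h2 h3 => by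
    rw [hu, ← ContinuousLinearMap.intervalIntegral_comp_comm _ (hint s h1 (h2.trans h3))]
    refine intervalIntegral.integral_congr_ae (Eventually.of_forall fun r hr => ?_)
    rw [uIoc_of_le h1] at hr
    rw [map_smul, hS.apply_apply (by linarith) (by linarith [hr.2]), sub_add_sub_cancel t s r]
  have hsub : ∀ s t, a ≤ s → s ≤ t → t ≤ b →
      IntervalIntegrable (fun r => m' r • S (t - r) (φ r)) MeasureTheory.volume s t :=
    fun s t h1 h2 h3 => (hint t (h1.trans h2) h3).mono_set (by
      rw [uIcc_of_le h2, uIcc_of_le (h1.trans h2)]; exact Icc_subset_Icc_left h1)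
  have hsub' : ∀ s t, a ≤ s → s ≤ t → t ≤ b →
      IntervalIntegrable (fun r => m' r • S (t - r) (φ r)) MeasureTheory.volume a s :=
    fun s t h1 h2 h3 => (hint t (h1.trans h2) h3).mono_set (by
      rw [uIcc_of_le h1, uIcc_of_le (h1.trans h2)]; exact Icc_subset_Icc_right h2)
  have hdelta : ∀ s t, a ≤ s → s ≤ t → t ≤ b →
      hatDeltaOne S u s t = ∫ r in s..t, m' r • S (t - r) (φ r) := fun s t h1 h2 h3 => by
    rw [hatDeltaOne, hshift s t h1 h2 h3]
    exact intervalIntegral.integral_interval_sub_left (hint t (h1.trans h2) h3)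
      (hsub' s t h1 h2 h3)
  refine ⟨u, intervalIntegral.integral_same, fun s hs => ?_, fun t ht => ?_⟩
  · obtain ⟨B, hB⟩ := (isCompact_Icc (a := s) (b := b)).exists_bound_of_continuousOn
      hm'.continuousOn
    have hB0 : 0 ≤ B := (norm_nonneg _).trans (hB s ⟨le_rfl, hs.2⟩)
    have hsa : 0 < s - a := by linarith [hs.1]
    refine ⟨B * (L * (C * N * (s - a) ^ (-g - ρ))), 1 + ρ, by positivity, by linarith, ?_⟩
    intro r q hsr hrq hqb
    have har : a ≤ r := hs.1.le.trans hsr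
    have hmi : m q - m r = ∫ v in r..q, m' v :=
      (intervalIntegral.integral_eq_sub_of_hasDerivAt (fun v _ => hm v)
        (hm'.intervalIntegrable _ _)).symm
    -- For a differentiable driver the remainder is an integral of `δ̂₁φ(r,v)` over `[r,q]`, hence
    -- of order `1 + ρ > 1`.
    have e1 : germRemainder S m u φ r q
        = ∫ v in r..q, m' v • S (q - v) (hatDeltaOne S φ r v) := by
      rw [germRemainder, hdelta r q har hrq hqb, map_smul, hmi,
        ← intervalIntegral.integral_smul_const,
        ← intervalIntegral.integral_sub (hsub r q har hrq hqb)
          (g := fun v => m' v • S (q - r) (φ r))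
          ((hm'.smul continuous_const).intervalIntegrable _ _)]
      refine intervalIntegral.integral_congr fun v hv => ?_
      rw [uIcc_of_le hrq] at hv
      rw [← smul_sub, hS.convolution_sub φ hv.1 hv.2]
    rw [e1]
    have hqr : 0 ≤ q - r := by linarith
    have e2 := intervalIntegral.norm_integral_le_of_norm_le_const (a := r) (b := q)
      (f := fun v => m' v • S (q - v) (hatDeltaOne S φ r v))
      (C := B * (L * (C * N * (s - a) ^ (-g - ρ) * (q - r) ^ ρ))) (fun v hv => by
        rw [uIoc_of_le hrq] at hv
        rw [norm_smul]
        have f1 := hB v ⟨by linarith [hv.1], by linarith [hv.2]⟩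
        have f2 := hL (q - v) ⟨by linarith [hv.2], by linarith [hv.1]⟩ (hatDeltaOne S φ r v)
        have f3 := h φ g a b N hab1 hN hφ r v (by linarith [hs.1]) hv.1 (by linarith [hv.2])
        have f4 : (r - a) ^ (-g - ρ) ≤ (s - a) ^ (-g - ρ) :=
          Real.rpow_le_rpow_of_nonpos hsa (by linarith) (by linarith)
        have f5 : (v - r) ^ ρ ≤ (q - r) ^ ρ := by
          have := hv.1
          have := hv.2
          gcongr
        have f6 : 0 ≤ v - r := by linarith [hv.1]
        calc _ ≤ B * (L * (C * N * (v - r) ^ ρ * (r - a) ^ (-g - ρ))) := by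
              gcongr
              exact f2.trans (by gcongr)
          _ ≤ B * (L * (C * N * (q - r) ^ ρ * (s - a) ^ (-g - ρ))) := by gcongr
          _ = _ := by ring)
    refine e2.trans (le_of_eq ?_)
    rw [abs_of_nonneg hqr, Real.rpow_add_of_nonneg hqr (by norm_num) hρ.le, Real.rpow_one]
    ring
  · have hi := hint t ht.1.le ht.2
    have hcont := intervalIntegral.continuousOn_primitive_interval
      ((intervalIntegrable_iff' (by simp)).1 hi)
    have h1 : Tendsto (fun s => ∫ r in a..s, m' r • S (t - r) (φ r)) (𝓝[>] a) (𝓝 0) := by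
      have h2 := hcont a left_mem_uIcc
      rw [ContinuousWithinAt, intervalIntegral.integral_same, uIcc_of_le ht.1.le] at h2
      refine h2.mono_left (nhdsWithin_le_iff.2 ?_)
      exact mem_of_superset (Ioo_mem_nhdsGT ht.1) Ioo_subset_Icc_self
    have h3 : u a = 0 := intervalIntegral.integral_same
    rw [h3, map_zero]
    refine h1.congr' ?_
    filter_upwards [Ioo_mem_nhdsGT ht.1] with s hs
    exact (hshift s t hs.1.le hs.2.le ht.2).symm

/-- Existence of solutions of the linear equation. -/
theorem exists_isSolution (hS : X.IsSmoothingSemigroup S A) [CompleteSpace E]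
    {η α ρ g a b H N : ℝ} (he : IsExponentTriple η α ρ) (hg : 0 ≤ g) (hgη : g < η - α)
    (hab : a < b) (hab1 : b - a ≤ 1) (hH : 0 ≤ H) (hN : 0 ≤ N) {x : ℝ → ℝ}
    (hx : ∀ r q, a ≤ r → r ≤ q → q ≤ b → |x q - x r| ≤ H * (q - r) ^ η) {φ : ℝ → E}
    (hφ : X.ForcingBound α ρ g a b N φ) (w₀ : E) :
    ∃ u : ℝ → E, u a = w₀ ∧ IsSolution S x u φ a b := by
  have hρ := he.pos
  have hle := he.le
  have hlt := he.lt
  have hlt1 := he.lt_one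
  have hone := he.one_lt
  -- The mollified paths converge only in Hölder norms weaker than `η`. The exponent `η'` is close
  -- enough to `η` to keep both `1 < η' + ρ` and `g < η' - α`.
  obtain ⟨η', hη'1, hη'2⟩ : ∃ η', max (α + g) (1 - ρ) < η' ∧ η' < η :=
    exists_between (max_lt (by linarith) (by linarith))
  have hη'3 := (le_max_left _ _).trans_lt hη'1
  have hη'4 := (le_max_right _ _).trans_lt hη'1
  have he' : IsExponentTriple η' α ρ :=
    ⟨by linarith, by linarith, hle, by linarith, he.add_le⟩
  obtain ⟨C₁, hC₁, h₁⟩ := hS.exists_increment_bound_full he' hg le_rfl two_pos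
    (show 0 < η' - g by linarith)
  obtain ⟨C₂, hC₂, h₂⟩ := hS.exists_increment_bound_full he hg le_rfl two_pos
    (show 0 < η - g by linarith)
  obtain ⟨C₃, hC₃, h₃⟩ := hS.exists_sewing_zero hone
  obtain ⟨C₄, hC₄, h₄⟩ := hS.exists_hatDeltaOne_forcing he
  obtain ⟨L, hL1, hL⟩ := hS.exists_norm_bound
  set δ : ℕ → ℝ := fun n => 1 / ((n : ℝ) + 1) with hδ
  have hδ0 : ∀ n, 0 < δ n := fun n => Nat.one_div_pos_of_nat
  have hδlim : Tendsto δ atTop (𝓝 0) := tendsto_one_div_add_atTop_nhds_zero_nat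
  have hδanti : ∀ n k, k ≤ n → δ n ≤ δ k := fun n k hk => Nat.one_div_le_one_div hk
  choose m m' hm' hm hmH hmx hmη using fun n =>
    exists_smooth_approximation hH (show 0 < η' by linarith) hη'2.le hab.le hx (hδ0 n)
  choose w hwa hwsol using fun n =>
    hS.exists_isSolution_smooth he hg (by linarith) hab1 hN hφ (hm' n) (hm n)
  have hforced : ∀ n, X.ForcedSolution S (m n) η α ρ g a b H N (w n) φ := fun n =>
    ⟨hab, hab1, hH, fun r q _ h _ => hmH n r q h, hwsol n, hN, hφ⟩
  have hval : ∀ n t, hatDeltaOne S (w n) a t = w n t := fun n t => by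
    rw [hatDeltaOne, hwa, map_zero, sub_zero]
  -- the sequence is Cauchy
  have hdiff : ∀ n k j, j ≤ n → j ≤ k → ∀ t ∈ Icc a b,
      dist (w n t) (w k t) ≤ C₁ * (4 * H * δ j ^ (η - η') * N) := fun n k j hn hk t ht => by
    have hδj := hδ0 j
    rcases ht.1.eq_or_lt with rfl | hat
    · rw [hwa, hwa, dist_self]
      positivity
    have hsol : IsSolution S (m n - m k) (w n - w k) φ a b := by
      refine ⟨fun s hs => ?_, fun t ht => ?_⟩
      · exact isPrimitive_of_sub (by linarith [hs.1]) ((hwsol n).1 s hs) ((hwsol k).1 s hs)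
          fun r q => germRemainder_sub_left ..
      · simpa only [Pi.sub_apply, map_sub] using ((hwsol n).2 t ht).sub ((hwsol k).2 t ht)
    -- The equation is linear in the driver: the difference of two approximations is driven by `m n
    -- - m k` with the same forcing, and its `η'`-Hölder constant is small.
    have hF : X.ForcedSolution S (m n - m k) η' α ρ g a b (4 * H * δ j ^ (η - η')) N
        (w n - w k) φ := by
      refine ⟨hab, hab1, by positivity, fun r q h1 h2 h3 => ?_, hsol, hN, hφ⟩
      have e1 := hmη n r q h1 h2 h3
      have e2 := hmη k r q h1 h2 h3
      have hqr : 0 ≤ (q - r) ^ η' := Real.rpow_nonneg (by linarith) _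
      have e3 : δ n ^ (η - η') ≤ δ j ^ (η - η') := by
        have := hδ0 n
        have := hδanti n j hn
        gcongr
      have e4 : δ k ^ (η - η') ≤ δ j ^ (η - η') := by
        have := hδ0 k
        have := hδanti k j hk
        gcongr
      have e5 : (m n - m k) q - (m n - m k) r
          = ((m n q - x q) - (m n r - x r)) - ((m k q - x q) - (m k r - x r)) := by
        simp only [Pi.sub_apply]; ring
      rw [e5]
      calc _ ≤ 2 * H * δ n ^ (η - η') * (q - r) ^ η' + 2 * H * δ k ^ (η - η') * (q - r) ^ η' :=
            (abs_sub _ _).trans (add_le_add e1 e2)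
        _ ≤ 2 * H * δ j ^ (η - η') * (q - r) ^ η' + 2 * H * δ j ^ (η - η') * (q - r) ^ η' := by
            gcongr
        _ = _ := by ring
    have e := normLE_zero_iff.1 (h₁ _ _ _ _ _ _ _ hF a t le_rfl hat ht.2)
    have e6 : hatDeltaOne S (w n - w k) a t = w n t - w k t := by
      simp [hatDeltaOne, hwa]
    rw [e6] at e
    rw [dist_eq_norm]
    refine e.trans (mul_le_of_le_one_right (by positivity) ?_)
    exact Real.rpow_le_one (by linarith) (by linarith [ht.2]) (by linarith)
  have hlim0 : Tendsto (fun j => C₁ * (4 * H * δ j ^ (η - η') * N)) atTop (𝓝 0) := by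
    have h := (hδlim.rpow_const (p := η - η') (Or.inr (by linarith)))
    rw [Real.zero_rpow (by linarith)] at h
    simpa using ((h.const_mul (4 * H)).mul_const N).const_mul C₁
  have hex : ∀ t, ∃ z, t ∈ Icc a b → Tendsto (fun n => w n t) atTop (𝓝 z) := fun t => by
    by_cases ht : t ∈ Icc a b
    · obtain ⟨z, hz⟩ := cauchySeq_tendsto_of_complete (cauchySeq_of_le_tendsto_0 _
        (fun n k j hn hk => hdiff n k j hn hk t ht) hlim0)
      exact ⟨z, fun _ => hz⟩
    · exact ⟨0, fun h => absurd h ht⟩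
  choose v hv using hex
  have hxlim : ∀ t ∈ Icc a b, Tendsto (fun n => m n t) atTop (𝓝 (x t)) := fun t ht => by
    rw [tendsto_iff_norm_sub_tendsto_zero]
    refine squeeze_zero (fun _ => norm_nonneg _) (fun n => hmx n t ht) ?_
    have h := (hδlim.rpow_const (p := η) (Or.inr (by linarith))).const_mul H
    rwa [Real.zero_rpow (by linarith), mul_zero] at h
  have hva : v a = 0 := by
    have h := hv a ⟨le_rfl, hab.le⟩
    simp only [hwa] at h
    exact tendsto_nhds_unique h tendsto_const_nhds
  have hvsmall : ∀ t ∈ Ioc a b, ‖v t‖ ≤ C₂ * (H * N) * (t - a) ^ (η - g - 0) := fun t ht => by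
    refine le_of_tendsto (hv t ⟨ht.1.le, ht.2⟩).norm (Eventually.of_forall fun n => ?_)
    have e := normLE_zero_iff.1 (h₂ _ _ _ _ _ _ _ (hforced n) a t le_rfl ht.1 ht.2)
    rwa [hval] at e
  -- The sewing bound for the approximations has constants independent of `n`, with the original
  -- exponent `η`, so it passes to the pointwise limit.
  have hgerm : ∀ s ∈ Ioc a b, ∀ r q, s ≤ r → r ≤ q → q ≤ b →
      ‖germRemainder S x v φ r q‖
        ≤ C₃ * (H * (C₄ * N * (s - a) ^ (-g - ρ))) * (q - r) ^ (η + ρ) := by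
    intro s hs r q hsr hrq hqb
    have hsa : 0 < s - a := by linarith [hs.1]
    have hr : r ∈ Icc a b := ⟨by linarith [hs.1], by linarith⟩
    have hq : q ∈ Icc a b := ⟨by linarith [hs.1], by linarith⟩
    have hl : Tendsto (fun n => germRemainder S (m n) (w n) φ r q) atTop
        (𝓝 (germRemainder S x v φ r q)) := by
      refine ((hv q hq).sub (((S (q - r)).continuous.tendsto _).comp (hv r hr))).sub ?_
      exact ((S (q - r)).continuous.tendsto _).comp
        (((hxlim q hq).sub (hxlim r hr)).smul_const (φ r))
    refine le_of_tendsto hl.norm (Eventually.of_forall fun n => ?_)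
    refine h₃ (m n) (w n) φ r q H _ hH (by positivity) hrq (by linarith)
      (fun r' q' _ h _ => hmH n r' q' h) (fun r' q' f1 f2 f3 => ?_)
      (((hwsol n).1 s hs).mono hsr hqb)
    rcases f2.eq_or_lt with rfl | f2'
    · rw [hS.hatDeltaOne_self, norm_zero, sub_self]
      positivity
    · refine (h₄ φ g a b N hab1 hN hφ r' q' (by linarith) f2' (by linarith)).trans ?_
      have e : (r' - a) ^ (-g - ρ) ≤ (s - a) ^ (-g - ρ) :=
        Real.rpow_le_rpow_of_nonpos hsa (by linarith) (by linarith)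
      have hqr : 0 ≤ q' - r' := by linarith
      calc _ ≤ C₄ * N * (q' - r') ^ ρ * (s - a) ^ (-g - ρ) := by gcongr
        _ = _ := by ring
  -- The free evolution has vanishing `δ̂₁`, so it corrects the initial value without changing the
  -- germ remainder.
  have hfree : ∀ s t, a ≤ s → s ≤ t →
      hatDeltaOne S (fun t => v t + S (t - a) w₀) s t = hatDeltaOne S v s t := fun s t h1 h2 => by
    simp only [hatDeltaOne, map_add]
    rw [hS.apply_apply (by linarith) (by linarith), sub_add_sub_cancel t s a]
    abel
  refine ⟨fun t => v t + S (t - a) w₀, by simp [hva, hS.apply_zero], fun s hs => ?_,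
    fun t ht => ?_⟩
  · have hsa : 0 < s - a := by linarith [hs.1]
    refine ⟨C₃ * (H * (C₄ * N * (s - a) ^ (-g - ρ))), η + ρ, by positivity, hone, ?_⟩
    intro r q hsr hrq hqb
    rw [germRemainder, hfree r q (by linarith [hs.1]) hrq]
    exact hgerm s hs r q hsr hrq hqb
  · simp only [sub_self, hS.apply_zero, hva, zero_add]
    rw [tendsto_iff_norm_sub_tendsto_zero]
    have hbd : ∀ᶠ s in 𝓝[>] a, ‖S (t - s) (v s + S (s - a) w₀) - S (t - a) w₀‖
        ≤ L * (C₂ * (H * N) * (s - a) ^ (η - g - 0)) := by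
      filter_upwards [Ioo_mem_nhdsGT ht.1] with s hs
      rw [map_add, hS.apply_apply (by linarith [hs.2]) (by linarith [hs.1]),
        sub_add_sub_cancel t s a, add_sub_cancel_right]
      refine (hL _ ⟨by linarith [hs.2], by linarith [hs.1, ht.2]⟩ _).trans ?_
      gcongr
      exact hvsmall s ⟨hs.1, by linarith [hs.2, ht.2]⟩
    refine squeeze_zero' (Eventually.of_forall fun _ => norm_nonneg _) hbd ?_
    have h0 : Tendsto (fun s => s - a) (𝓝[>] a) (𝓝 (a - a)) :=
      (tendsto_id.sub_const a).mono_left nhdsWithin_le_nhds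
    rw [sub_self] at h0
    have h1 := h0.rpow_const (p := η - g - 0) (Or.inr (by linarith))
    rw [Real.zero_rpow (by linarith)] at h1
    simpa using (h1.const_mul (C₂ * (H * N))).const_mul L

end BanachScale.IsSmoothingSemigroup

/-! ### The nonlinear equation on short intervals -/

theorem exists_small_rpow (c : ℝ) {ε : ℝ} (hε : 0 < ε) :
    ∃ τ ∈ Ioc (0 : ℝ) 1, ∀ r, 0 ≤ r → r ≤ τ → c * r ^ ε ≤ 1 / 2 := by
  have h1 : Tendsto (fun r : ℝ => |c| * r ^ ε) (𝓝[>] 0) (𝓝 0) := by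
    have h : Tendsto (fun r : ℝ => r ^ ε) (𝓝[>] 0) (𝓝 (0 ^ ε)) :=
      ((tendsto_id (α := ℝ)).mono_left nhdsWithin_le_nhds).rpow_const (Or.inr hε.le)
    rw [Real.zero_rpow hε.ne'] at h
    simpa using h.const_mul |c|
  have h2 : ∀ᶠ r : ℝ in 𝓝[>] 0, |c| * r ^ ε < 1 / 2 := h1.eventually_lt_const (by norm_num)
  have h3 : ∀ᶠ r : ℝ in 𝓝[>] 0, r ∈ Ioo (0 : ℝ) 1 := Ioo_mem_nhdsGT one_pos
  obtain ⟨τ, h4, h5⟩ := (h2.and h3).exists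
  refine ⟨τ, ⟨h5.1, h5.2.le⟩, fun r hr hrτ => ?_⟩
  calc c * r ^ ε ≤ |c| * τ ^ ε := by
        have := le_abs_self c
        gcongr
    _ ≤ _ := h4.le

theorem IsSolution.congr {E : Type u} [NormedAddCommGroup E] [NormedSpace ℝ E]
    {S : ℝ → E →L[ℝ] E} {x : ℝ → ℝ} {u φ u' φ' : ℝ → E} {a b : ℝ} (h : IsSolution S x u φ a b)
    (hu : EqOn u u' (Icc a b)) (hφ : EqOn φ φ' (Ioc a b)) : IsSolution S x u' φ' a b := by
  refine ⟨fun s hs => ?_, fun t ht => ?_⟩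
  · obtain ⟨C, p, hC, hp, h1⟩ := h.1 s hs
    refine ⟨C, p, hC, hp, fun r q h2 h3 h4 => ?_⟩
    have hr : a < r := hs.1.trans_le h2
    have e := h1 r q h2 h3 h4
    rwa [germRemainder, hatDeltaOne, hu ⟨by linarith, h4⟩, hu ⟨hr.le, h3.trans h4⟩,
      hφ ⟨hr, h3.trans h4⟩] at e
  · rw [← hu ⟨le_rfl, ht.1.le.trans ht.2⟩]
    refine (h.2 t ht).congr' ?_
    filter_upwards [Ioo_mem_nhdsGT ht.1] with s hs
    rw [hu ⟨hs.1.le, by linarith [hs.2, ht.2]⟩]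

namespace BanachScale

variable {E : Type u} [NormedAddCommGroup E] [NormedSpace ℝ E] {X : BanachScale.{u, v} E}
  {S : ℝ → E →L[ℝ] E} {A : E →ₗ.[ℝ] E}

namespace IsSmoothingSemigroup

variable {σ : E → E} {η α ρ γ ω H : ℝ} {x : ℝ → ℝ}

/-- The a priori estimate on short intervals. -/
theorem exists_apriori_local (hS : X.IsSmoothingSemigroup S A)
    (hσ : X.IsAdmissibleNonlinearity σ α ω) (he : IsExponentTriple η α ρ) (hγ : 0 ≤ γ)
    (hγα : γ ≤ α) (hγη : γ < η - α) (hH : 0 ≤ H)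
    (hx : ∀ r q, 0 ≤ r → r ≤ q → q ≤ 1 → |x q - x r| ≤ H * (q - r) ^ η) :
    ∃ τ ∈ Ioc (0 : ℝ) 1, ∃ C : ℝ, 1 ≤ C ∧
      (∀ a b U R, 0 ≤ a → a < b → b ≤ 1 → b - a ≤ τ → C * (1 + U) ≤ R → ∀ y u : ℝ → E,
        X.PathBound α ρ γ γ a b R y → IsSolution S x u (fun t => σ (y t)) a b →
        X.NormLE (α - γ) (u a) U → X.PathBound α ρ γ γ a b R u) ∧
      ∀ a b U N, 0 ≤ a → a < b → b ≤ 1 → b - a ≤ τ → 0 ≤ N → ∀ y : ℝ → E,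
        X.ForcingBound α ρ γ a b N y → IsSolution S x y (fun t => σ (y t)) a b →
        X.NormLE (α - γ) (y a) U → X.PathBound α ρ γ γ a b (C * (1 + U)) y := by
  obtain ⟨C₁, hC₁, h₁⟩ := hS.exists_pathBound he hγ hγα le_rfl hγη
  obtain ⟨C₂, hC₂, h₂⟩ := hσ.exists_forcingBound_comp
  obtain ⟨K, hK, hK'⟩ := PathBound.exists_forcingBound X
    (show 0 ≤ α by linarith) (show α < 2 by linarith [he.lt, he.lt_one])
  -- This choice makes the coefficient of the old bound `N` at most `1/2`. By linear growth of `σ`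
  -- it does not depend on `U`, which is what later allows steps of fixed length.
  obtain ⟨τ, hτ, hτ'⟩ := exists_small_rpow (C₁ * (H * (C₂ * K)))
    (show 0 < η - α - γ by linarith)
  have hfs : ∀ a b N, 0 ≤ a → a < b → b ≤ 1 → 0 ≤ N → ∀ y u : ℝ → E,
      X.ForcingBound α ρ γ a b N y → IsSolution S x u (fun t => σ (y t)) a b →
      X.ForcedSolution S x η α ρ γ a b H (C₂ * (1 + N)) u (fun t => σ (y t)) :=
    fun a b N ha hab hb hN y u hy hu => ⟨hab, by linarith, hH,
      fun r q h1 h2 h3 => hx r q (by linarith) h2 (by linarith), hu, by positivity,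
      h₂ ρ γ a b N y hγ (by linarith) hN hy⟩
  have hstep : ∀ a b U N, 0 ≤ a → a < b → b ≤ 1 → b - a ≤ τ → 0 ≤ N → ∀ y u : ℝ → E,
      X.PathBound α ρ γ γ a b N y → IsSolution S x u (fun t => σ (y t)) a b →
      X.NormLE (α - γ) (u a) U → X.PathBound α ρ γ γ a b (C₁ * U + 1 / 2 + N / 2) u := by
    intro a b U N ha hab hb hτab hN y u hy hu hU
    have hU0 := hU.nonneg
    have e := h₁ x u _ a b H _ U (hfs a b (K * N) ha hab hb (by positivity) y u
      (hK' ρ γ γ a b N y le_rfl (by linarith) hN hy) hu) hU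
    have hT : 0 ≤ (b - a) ^ (η - α - γ) := Real.rpow_nonneg (by linarith) _
    refine e.mono (by linarith) (by positivity) ?_ le_rfl
    have e1 := hτ' (b - a) (by linarith) hτab
    have e2 : 1 + K * N ≤ K * (1 + N) := by nlinarith
    calc _ ≤ C₁ * (U + H * (C₂ * (K * (1 + N))) * (b - a) ^ (η - α - γ)) := by gcongr
      _ = C₁ * U + (C₁ * (H * (C₂ * K)) * (b - a) ^ (η - α - γ)) * (1 + N) := by ring
      _ ≤ C₁ * U + 1 / 2 * (1 + N) := by gcongr
      _ = _ := by ring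
  refine ⟨τ, hτ, 2 * C₁, by linarith, ?_, ?_⟩
  · intro a b U R ha hab hb hτab hR y u hy hu hU
    have hU0 := hU.nonneg
    have hR0 : 0 ≤ R := le_trans (by positivity) hR
    refine (hstep a b U R ha hab hb hτab hR0 y u hy hu hU).mono (by linarith) (by positivity) ?_
      le_rfl
    nlinarith
  · intro a b U N ha hab hb hτab hN y hy hsol hU
    have hU0 := hU.nonneg
    obtain ⟨N₀, hN₀, hyN₀⟩ : ∃ N₀, 0 ≤ N₀ ∧ X.PathBound α ρ γ γ a b N₀ y := by
      have hT : 0 ≤ (b - a) ^ (η - α - γ) := Real.rpow_nonneg (by linarith) _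
      exact ⟨_, by positivity, h₁ x y _ a b H _ U (hfs a b N ha hab hb hN y y hy hsol) hU⟩
    -- For a solution the improvement `N ↦ C₁ U + 1/2 + N/2` applies to itself repeatedly; its fixed
    -- point is `2 C₁ U + 1`, and the initial finite bound `N₀` is forgotten geometrically.
    have hit : ∀ k : ℕ, X.PathBound α ρ γ γ a b (2 * C₁ * U + 1 + N₀ * (1 / 2) ^ k) y := by
      intro k
      induction k with
      | zero =>
        refine hyN₀.mono (by linarith) hN₀ ?_ le_rfl
        rw [pow_zero, mul_one]
        have : 0 ≤ 2 * C₁ * U := by positivity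
        linarith
      | succ k ih =>
        refine (hstep a b U _ ha hab hb hτab (by positivity) y y ih hsol hU).mono (by linarith)
          (by positivity) (le_of_eq ?_) le_rfl
        rw [pow_succ]
        ring
    have hlim : Tendsto (fun k : ℕ => N₀ * (1 / 2 : ℝ) ^ k) atTop (𝓝 0) := by
      simpa using (tendsto_pow_atTop_nhds_zero_of_lt_one (r := (1 / 2 : ℝ)) (by norm_num)
        (by norm_num)).const_mul N₀
    obtain ⟨k, hk⟩ := (hlim.eventually_lt_const one_pos).exists
    refine (hit k).mono (by linarith) (by positivity) ?_ le_rfl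
    nlinarith

/-- On short intervals the solution map is a contraction. -/
theorem exists_contraction (hS : X.IsSmoothingSemigroup S A)
    (hσ : X.IsAdmissibleNonlinearity σ α ω) (hω : 1 ≤ ω) (he : IsExponentTriple η α ρ)
    (hγ : 0 ≤ γ) (hγα : γ ≤ α) (hγη : (1 + ω) * γ < η - α) (hH : 0 ≤ H)
    (hx : ∀ r q, 0 ≤ r → r ≤ q → q ≤ 1 → |x q - x r| ≤ H * (q - r) ^ η) {R : ℝ} (hR : 0 < R) :
    ∃ τ ∈ Ioc (0 : ℝ) 1, ∀ a b N, 0 ≤ a → a < b → b ≤ 1 → b - a ≤ τ → 0 ≤ N →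
      ∀ y z u w : ℝ → E, X.PathBound α ρ γ γ a b R y → X.PathBound α ρ γ γ a b R z →
        X.PathBound α ρ γ ((1 + ω) * γ) a b N (y - z) →
        IsSolution S x u (fun t => σ (y t)) a b → IsSolution S x w (fun t => σ (z t)) a b →
        u a = w a → X.PathBound α ρ γ ((1 + ω) * γ) a b (N / 2) (u - w) := by
  obtain ⟨C₁, hC₁, h₁⟩ := hS.exists_pathBound he hγ hγα
    (show γ ≤ (1 + ω) * γ by nlinarith) hγη
  obtain ⟨C₂, hC₂, h₂⟩ := hσ.exists_forcingBound_sub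
    ⟨by linarith, by linarith [he.lt, he.lt_one]⟩ hω hR
  -- The decisive use of the assumption on `θ`: with `γ = α - θ` it states that the exponent `η - α
  -- - (1+ω)γ` is positive.
  obtain ⟨τ, hτ, hτ'⟩ := exists_small_rpow (C₁ * (H * C₂))
    (show 0 < η - α - (1 + ω) * γ by linarith)
  refine ⟨τ, hτ, fun a b N ha hab hb hτab hN y z u w hy hz hyz hu hw huw => ?_⟩
  have hfs : X.ForcedSolution S x η α ρ ((1 + ω) * γ) a b H (C₂ * N) (u - w)
      ((fun t => σ (y t)) - fun t => σ (z t)) :=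
    ⟨hab, by linarith, hH, fun r q h1 h2 h3 => hx r q (by linarith) h2 (by linarith),
      hu.sub (by linarith) hw, by positivity,
      h₂ ρ γ a b N y z hγ (by linarith) hN hy hz hyz⟩
  have hU : X.NormLE (α - γ) ((u - w) a) 0 := by
    rw [Pi.sub_apply, huw, sub_self]
    exact normLE_zero_vector le_rfl
  have hT : 0 ≤ (b - a) ^ (η - α - (1 + ω) * γ) := Real.rpow_nonneg (by linarith) _
  refine (h₁ x _ _ a b H _ 0 hfs hU).mono (by linarith) (by positivity) ?_ le_rfl
  have e1 := hτ' (b - a) (by linarith) hτab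
  calc _ = (C₁ * (H * C₂) * (b - a) ^ (η - α - (1 + ω) * γ)) * N := by ring
    _ ≤ 1 / 2 * N := by gcongr
    _ = _ := by ring

/-- Solutions are unique on short intervals. -/
theorem exists_unique_local (hS : X.IsSmoothingSemigroup S A)
    (hσ : X.IsAdmissibleNonlinearity σ α ω) (hω : 1 ≤ ω) (he : IsExponentTriple η α ρ)
    (hγ : 0 ≤ γ) (hγα : γ ≤ α) (hγη : (1 + ω) * γ < η - α) (hH : 0 ≤ H)
    (hx : ∀ r q, 0 ≤ r → r ≤ q → q ≤ 1 → |x q - x r| ≤ H * (q - r) ^ η) {R : ℝ} (hR : 0 < R) :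
    ∃ τ ∈ Ioc (0 : ℝ) 1, ∀ a b, 0 ≤ a → a < b → b ≤ 1 → b - a ≤ τ → ∀ y z : ℝ → E,
      X.PathBound α ρ γ γ a b R y → X.PathBound α ρ γ γ a b R z →
      IsSolution S x y (fun t => σ (y t)) a b → IsSolution S x z (fun t => σ (z t)) a b →
      y a = z a → EqOn y z (Icc a b) := by
  obtain ⟨τ, hτ, h⟩ := hS.exists_contraction hσ hω he hγ hγα hγη hH hx hR
  refine ⟨τ, hτ, fun a b ha hab hb hτab y z hy hz hys hzs hyz t ht => ?_⟩
  rcases ht.1.eq_or_lt with rfl | hat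
  · exact hyz
  -- Both paths are fixed points of the solution map, so the contraction applies to the same
  -- difference over and over.
  have hit : ∀ k : ℕ, X.PathBound α ρ γ ((1 + ω) * γ) a b ((R + R) * (1 / 2) ^ k) (y - z) := by
    intro k
    induction k with
    | zero =>
      rw [pow_zero, mul_one]
      exact (hy.sub hz).mono (by linarith) (by linarith) le_rfl (by nlinarith)
    | succ k ih =>
      have e := h a b _ ha hab hb hτab (by positivity) y z y z hy hz ih hys hzs hyz
      rw [pow_succ, ← mul_assoc, mul_one_div]
      exact e
  have hlim : Tendsto (fun k : ℕ => (R + R) * (1 / 2 : ℝ) ^ k * (t - a) ^ (-γ)) atTop (𝓝 0) := by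
    simpa using ((tendsto_pow_atTop_nhds_zero_of_lt_one (r := (1 / 2 : ℝ)) (by norm_num)
      (by norm_num)).const_mul (R + R)).mul_const ((t - a) ^ (-γ))
  have hα2 : α ∈ Ico (0 : ℝ) 2 := ⟨by linarith, by linarith [he.lt, he.lt_one]⟩
  obtain ⟨v, hv, hv0⟩ := normLE_of_tendsto hα2 (fun k => (hit k).norm t ⟨hat, ht.2⟩) hlim
  have hv1 : v = 0 := norm_le_zero_iff.1 hv0
  rw [hv1, map_zero, Pi.sub_apply] at hv
  exact (sub_eq_zero.1 hv.symm)

/-- Solutions exist on short intervals, the length of which depends on the initial value through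
its norm only. -/
theorem exists_solution_local (hS : X.IsSmoothingSemigroup S A) [CompleteSpace E]
    (hσ : X.IsAdmissibleNonlinearity σ α ω) (hω : 1 ≤ ω) (he : IsExponentTriple η α ρ)
    (hγ : 0 ≤ γ) (hγα : γ ≤ α) (hγη : (1 + ω) * γ < η - α) (hH : 0 ≤ H)
    (hx : ∀ r q, 0 ≤ r → r ≤ q → q ≤ 1 → |x q - x r| ≤ H * (q - r) ^ η) {U : ℝ} (hU : 0 ≤ U) :
    ∃ τ ∈ Ioc (0 : ℝ) 1, ∃ R : ℝ, 0 ≤ R ∧ ∀ a b, 0 ≤ a → a < b → b ≤ 1 → b - a ≤ τ → ∀ w₀ : E,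
      X.NormLE (α - γ) w₀ U → ∃ y : ℝ → E, y a = w₀ ∧
        IsSolution S x y (fun t => σ (y t)) a b ∧ X.PathBound α ρ γ γ a b R y := by
  have hα0 : 0 ≤ α := by linarith
  have hα2 : α < 2 := by linarith [he.lt, he.lt_one]
  have hγη' : γ < η - α := lt_of_le_of_lt (by nlinarith) hγη
  obtain ⟨τ₁, hτ₁, C, hC, hmap, -⟩ := hS.exists_apriori_local hσ he hγ hγα hγη' hH hx
  obtain ⟨C₁, hC₁, h₁⟩ := hS.exists_pathBound he hγ hγα le_rfl hγη'
  obtain ⟨C₂, hC₂, h₂⟩ := hσ.exists_forcingBound_comp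
  obtain ⟨K, hK, hK'⟩ := PathBound.exists_forcingBound X hα0 hα2
  obtain ⟨K₀, hK₀, hK₀'⟩ := X.exists_normLE_embed le_rfl hα0 hα2
  -- The first summand makes the ball of radius `R` invariant, the second makes room for the
  -- starting iterate.
  set R := C * (1 + U) + C₁ * U with hRdef
  have hR : 0 < R := by positivity
  obtain ⟨τ₂, hτ₂, hcon⟩ := hS.exists_contraction hσ hω he hγ hγα hγη hH hx hR
  refine ⟨min τ₁ τ₂, ⟨lt_min hτ₁.1 hτ₂.1, (min_le_left _ _).trans hτ₁.2⟩, R, hR.le, ?_⟩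
  intro a b ha hab hb hτab w₀ hw₀
  have hab1 : b - a ≤ 1 := by linarith
  have hxab : ∀ r q, a ≤ r → r ≤ q → q ≤ b → |x q - x r| ≤ H * (q - r) ^ η :=
    fun r q h1 h2 h3 => hx r q (by linarith) h2 (by linarith)
  have hg : 0 ≤ (1 + ω) * γ := by positivity
  have hnext : ∀ y : ℝ → E, X.PathBound α ρ γ γ a b R y → ∃ u : ℝ → E, u a = w₀ ∧
      IsSolution S x u (fun t => σ (y t)) a b ∧ X.PathBound α ρ γ γ a b R u := fun y hy => by
    obtain ⟨u, hua, hu⟩ := hS.exists_isSolution he hγ hγη' hab hab1 hH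
      (show 0 ≤ C₂ * (1 + K * R) by positivity) hxab
      (h₂ ρ γ a b (K * R) y hγ hab1 (by positivity)
        (hK' ρ γ γ a b R y le_rfl hab1 hR.le hy)) w₀
    refine ⟨u, hua, hu, hmap a b U R ha hab hb (hτab.trans (min_le_left _ _)) ?_ y u hy hu ?_⟩
    · rw [hRdef]
      have : 0 ≤ C₁ * U := by positivity
      linarith
    · rwa [hua]
  -- The Picard iteration starts from a solution with zero forcing.
  obtain ⟨y₀, hy₀a, hy₀⟩ : ∃ y₀ : ℝ → E, y₀ a = w₀ ∧ X.PathBound α ρ γ γ a b R y₀ := by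
    have hF : X.ForcingBound α ρ γ a b 0 (0 : ℝ → E) :=
      ⟨fun s _ => normLE_zero_vector (by simp), fun s t _ _ _ => by simp⟩
    obtain ⟨u, hua, hu⟩ := hS.exists_isSolution he hγ hγη' hab hab1 hH le_rfl hxab hF w₀
    refine ⟨u, hua, (h₁ x u 0 a b H 0 U ⟨hab, hab1, hH, hxab, hu, le_rfl, hF⟩
      (by rwa [hua])).mono hab1 (by simp only [mul_zero, zero_mul, add_zero]; positivity) ?_
      le_rfl⟩
    rw [hRdef]
    have : 0 ≤ C * (1 + U) := by positivity
    linarith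
  choose! f hfa hfsol hfb using hnext
  set y : ℕ → ℝ → E := fun n => f^[n] y₀ with hydef
  have hysucc : ∀ n, y (n + 1) = f (y n) := fun n => Function.iterate_succ_apply' f n y₀
  have hyb : ∀ n, X.PathBound α ρ γ γ a b R (y n) := fun n => by
    induction n with
    | zero => exact hy₀
    | succ n ih => rw [hysucc]; exact hfb _ ih
  have hya : ∀ n, y n a = w₀ := fun n => by
    cases n with
    | zero => exact hy₀a
    | succ n => rw [hysucc]; exact hfa _ (hyb n)
  have hysol : ∀ n, IsSolution S x (y (n + 1)) (fun t => σ (y n t)) a b := fun n => by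
    rw [hysucc]; exact hfsol _ (hyb n)
  have hτab₂ := hτab.trans (min_le_right _ _)
  have hdiff : ∀ n, X.PathBound α ρ γ ((1 + ω) * γ) a b ((R + R) * (1 / 2) ^ n)
      (y n - y (n + 1)) := fun n => by
    induction n with
    | zero =>
      rw [pow_zero, mul_one]
      exact ((hyb 0).sub (hyb 1)).mono hab1 (by linarith) le_rfl (by nlinarith)
    | succ n ih =>
      have e := hcon a b _ ha hab hb hτab₂ (by positivity) (y n) (y (n + 1)) (y (n + 1))
        (y (n + 2)) (hyb _) (hyb _) ih (hysol n) (hysol (n + 1)) ((hya _).trans (hya _).symm)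
      rw [pow_succ, ← mul_assoc, mul_one_div]
      exact e
  -- the limit of the Picard iteration
  have hex : ∀ t, ∃ z, t ∈ Ioc a b → Tendsto (fun n => y n t) atTop (𝓝 z) := fun t => by
    by_cases ht : t ∈ Ioc a b
    · have hc : CauchySeq fun n => y n t := by
        refine cauchySeq_of_le_geometric (1 / 2) (K₀ * ((R + R) * (t - a) ^ (-γ))) (by norm_num)
          fun n => ?_
        have e := normLE_zero_iff.1 (hK₀' _ _ ((hdiff n).norm t ht))
        rw [dist_eq_norm]
        exact e.trans (le_of_eq (by ring))
      obtain ⟨z, hz⟩ := cauchySeq_tendsto_of_complete hc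
      exact ⟨z, fun _ => hz⟩
    · exact ⟨0, fun h => absurd h ht⟩
  choose z hz using hex
  have hdz : ∀ n, X.PathBound α ρ γ ((1 + ω) * γ) a b (4 * R * (1 / 2) ^ n) (y n - z) := by
    intro n
    refine ⟨fun t ht => ?_, fun s t has hst htb => ?_⟩
    · have e := normLE_of_geometric (X := X) (l := α) (z := fun k => y (n + k) t) (z' := z t)
        (C := (R + R) * (1 / 2) ^ n * (t - a) ^ (-γ)) (q := 1 / 2) (by norm_num) (by norm_num)
        (fun k => ((hdiff (n + k)).norm t ht).mono (le_of_eq (by rw [pow_add]; ring)))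
        (by simpa only [add_comm n] using (tendsto_add_atTop_iff_nat n).2 (hz t ht))
      exact e.mono (le_of_eq (by ring))
    · have e := normLE_of_geometric (X := X) (l := α) (z := fun k => y (n + k) t - y (n + k) s)
        (z' := z t - z s) (C := (R + R) * (1 / 2) ^ n * (t - s) ^ ρ
          * (s - a) ^ (-((1 + ω) * γ) - ρ)) (q := 1 / 2) (by norm_num) (by norm_num)
        (fun k => by
          have e := ((hdiff (n + k)).incr s t has hst htb)
          simp only [Pi.sub_apply] at e
          rw [sub_sub_sub_comm]
          exact e.mono (le_of_eq (by rw [pow_add]; ring)))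
        (by
          have e1 := (tendsto_add_atTop_iff_nat n).2 (hz t ⟨by linarith, htb⟩)
          have e2 := (tendsto_add_atTop_iff_nat n).2 (hz s ⟨has, by linarith⟩)
          simpa only [add_comm n] using e1.sub e2)
      simp only [Pi.sub_apply, add_zero] at e ⊢
      rw [sub_sub_sub_comm] at e
      exact e.mono (le_of_eq (by ring))
  have hlim : ∀ c c' : ℝ, Tendsto (fun n : ℕ => c + 4 * R * (1 / 2) ^ n * c') atTop (𝓝 c) :=
    fun c c' => by
      simpa using (((tendsto_pow_atTop_nhds_zero_of_lt_one (r := (1 / 2 : ℝ)) (by norm_num)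
        (by norm_num)).const_mul (4 * R)).mul_const c').const_add c
  have hzb : X.PathBound α ρ γ γ a b R z := by
    refine ⟨fun t ht => ?_, fun s t has hst htb => ?_⟩
    · refine normLE_of_tendsto ⟨hα0, hα2⟩ (fun n => ?_) (hlim _ ((t - a) ^ (-γ)))
      have e := ((hyb n).norm t ht).sub ((hdz n).norm t ht)
      rwa [Pi.sub_apply, sub_sub_cancel] at e
    · refine normLE_of_tendsto ⟨hα0, hα2⟩ (fun n => ?_)
        (hlim _ ((t - s) ^ ρ * (s - a) ^ (-((1 + ω) * γ) - ρ)))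
      have e := ((hyb n).incr s t has hst htb).sub ((hdz n).incr s t has hst htb)
      simp only [Pi.sub_apply] at e
      rw [show y n t - y n s - (y n t - z t - (y n s - z s)) = z t - z s by abel] at e
      exact e.mono (le_of_eq (by ring))
  refine ⟨f z, hfa z hzb, ?_, hfb z hzb⟩
  -- The limit `z` carries no information at `a`. Its image `f z` has the right initial value and
  -- agrees with `z` on `(a,b]`, so `f z` is the solution.
  have hfz : EqOn z (f z) (Ioc a b) := fun t ht => by
    refine tendsto_nhds_unique ((tendsto_add_atTop_iff_nat 1).2 (hz t ht)) ?_
    rw [tendsto_iff_norm_sub_tendsto_zero]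
    refine squeeze_zero (fun _ => norm_nonneg _) (fun n => ?_)
      (hlim 0 (K₀ * ((t - a) ^ (-γ) / 2)))
    have e := hcon a b _ ha hab hb hτab₂ (by positivity) (y n) z (y (n + 1)) (f z) (hyb n) hzb
      (hdz n) (hysol n) (hfsol z hzb) ((hya _).trans (hfa z hzb).symm)
    exact (normLE_zero_iff.1 (hK₀' _ _ (e.norm t ht))).trans (le_of_eq (by ring))
  exact (hfsol z hzb).congr (fun _ _ => rfl) fun t ht => by simp only; rw [hfz ht]

end IsSmoothingSemigroup

end BanachScale

theorem IsPrimitive.congr {E : Type u} [NormedAddCommGroup E] [NormedSpace ℝ E]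
    {S : ℝ → E →L[ℝ] E} {x : ℝ → ℝ} {u φ u' φ' : ℝ → E} {s t : ℝ} (h : IsPrimitive S x u φ s t)
    (hu : EqOn u u' (Icc s t)) (hφ : EqOn φ φ' (Icc s t)) : IsPrimitive S x u' φ' s t := by
  obtain ⟨C, p, hC, hp, h1⟩ := h
  refine ⟨C, p, hC, hp, fun r q h2 h3 h4 => ?_⟩
  have e := h1 r q h2 h3 h4
  rwa [germRemainder, hatDeltaOne, hu ⟨h2.trans h3, h4⟩, hu ⟨h2, h3.trans h4⟩,
    hφ ⟨h2, h3.trans h4⟩] at e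

/-! ### Global bounds and uniqueness -/

namespace BanachScale

variable {E : Type u} [NormedAddCommGroup E] [NormedSpace ℝ E] {X : BanachScale.{u, v} E}
  {S : ℝ → E →L[ℝ] E} {A : E →ₗ.[ℝ] E}

theorem one_le_rpow_neg {r e : ℝ} (hr : 0 < r) (hr1 : r ≤ 1) (he : 0 ≤ e) : 1 ≤ r ^ (-e) :=
  Real.one_le_rpow_of_pos_of_le_one_of_nonpos hr hr1 (by linarith)

/-- After a restart at `a > 0` the singularity at `0` is a bounded factor, so the restarted path
satisfies the bounds with `γ = 0`, where only the increments keep a weight. -/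
theorem restart_weights {a s γ ρ : ℝ} (ha : 0 < a) (has : a < s) (hs : s ≤ 1) (hγ : 0 ≤ γ)
    (hρ : 0 ≤ ρ) : s ^ (-γ) ≤ a ^ (-γ - ρ) * (s - a) ^ (-(0 : ℝ)) ∧
      s ^ (-γ - ρ) ≤ a ^ (-γ - ρ) * (s - a) ^ (-(0 : ℝ) - ρ) := by
  have e1 : s ^ (-γ) ≤ a ^ (-γ) := Real.rpow_le_rpow_of_nonpos ha has.le (by linarith)
  have e2 : a ^ (-γ) ≤ a ^ (-γ - ρ) :=
    Real.rpow_le_rpow_of_exponent_ge ha (by linarith) (by linarith)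
  have e3 : s ^ (-γ - ρ) ≤ a ^ (-γ - ρ) :=
    Real.rpow_le_rpow_of_nonpos ha has.le (by linarith)
  have e4 : 1 ≤ (s - a) ^ (-ρ) := one_le_rpow_neg (by linarith) (by linarith) hρ
  rw [neg_zero, Real.rpow_zero, mul_one, zero_sub]
  exact ⟨e1.trans e2, e3.trans (le_mul_of_one_le_right (by positivity) e4)⟩

theorem ForcingBound.restart {α ρ γ a b c N : ℝ} {u : ℝ → E} (h : X.ForcingBound α ρ γ 0 c N u)
    (ha : 0 < a) (hbc : b ≤ c) (hb : b ≤ 1) (hN : 0 ≤ N) (hγ : 0 ≤ γ) (hρ : 0 ≤ ρ) :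
    X.ForcingBound α ρ 0 a b (N * a ^ (-γ - ρ)) u := by
  refine ⟨fun s hs => ?_, fun s t has hst htb => ?_⟩
  · refine (h.norm s ⟨ha.trans hs.1, hs.2.trans hbc⟩).mono ?_
    rw [sub_zero, mul_assoc]
    have := (restart_weights ha hs.1 (hs.2.trans hb) hγ hρ).1
    gcongr
  · refine (h.incr s t (ha.trans has) hst (htb.trans hbc)).trans ?_
    have e := (restart_weights ha has (hst.le.trans (htb.trans hb)) hγ hρ).2
    have : 0 ≤ t - s := by linarith
    rw [sub_zero]
    calc _ ≤ N * (t - s) ^ ρ * (a ^ (-γ - ρ) * (s - a) ^ (-(0 : ℝ) - ρ)) := by gcongr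
      _ = _ := by ring

theorem PathBound.restart {α ρ γ a b c N : ℝ} {u : ℝ → E} (h : X.PathBound α ρ γ γ 0 c N u)
    (ha : 0 < a) (hbc : b ≤ c) (hb : b ≤ 1) (hN : 0 ≤ N) (hγ : 0 ≤ γ) (hρ : 0 ≤ ρ) :
    X.PathBound α ρ 0 0 a b (N * a ^ (-γ - ρ)) u := by
  refine ⟨fun s hs => ?_, fun s t has hst htb => ?_⟩
  · refine (h.norm s ⟨ha.trans hs.1, hs.2.trans hbc⟩).mono ?_
    rw [sub_zero, mul_assoc]
    have := (restart_weights ha hs.1 (hs.2.trans hb) hγ hρ).1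
    gcongr
  · refine (h.incr s t (ha.trans has) hst (htb.trans hbc)).mono ?_
    have e := (restart_weights ha has (hst.le.trans (htb.trans hb)) hγ hρ).2
    have : 0 ≤ t - s := by linarith
    rw [sub_zero]
    calc _ ≤ N * (t - s) ^ ρ * (a ^ (-γ - ρ) * (s - a) ^ (-(0 : ℝ) - ρ)) := by gcongr
      _ = _ := by ring

/-- A solution of the nonlinear equation on `[0,c]` satisfying some weighted bounds. -/
structure NonlinearSolution (X : BanachScale.{u, v} E) (S : ℝ → E →L[ℝ] E) (σ : E → E)
    (x : ℝ → ℝ) (α ρ γ c : ℝ) (y : ℝ → E) : Prop where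
  sol : IsSolution S x y (fun t => σ (y t)) 0 c
  bound : ∃ N, 0 ≤ N ∧ X.ForcingBound α ρ γ 0 c N y

namespace IsSmoothingSemigroup

variable {σ : E → E} {η α ρ γ ω H : ℝ} {x : ℝ → ℝ}

/-- A priori bounds on short intervals, including Hölder continuity in the base space. -/
theorem exists_bounds_local (hS : X.IsSmoothingSemigroup S A)
    (hσ : X.IsAdmissibleNonlinearity σ α ω) (he : IsExponentTriple η α ρ) (hγ : 0 ≤ γ)
    (hγα : γ ≤ α) (hγη : γ < η - α) (hH : 0 ≤ H)
    (hx : ∀ r q, 0 ≤ r → r ≤ q → q ≤ 1 → |x q - x r| ≤ H * (q - r) ^ η) :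
    ∃ τ ∈ Ioc (0 : ℝ) 1, ∀ U, 0 ≤ U → ∃ R : ℝ, 1 ≤ R ∧
      ∀ a b N, 0 ≤ a → a < b → b ≤ 1 → b - a ≤ τ → 0 ≤ N → ∀ y : ℝ → E,
        X.ForcingBound α ρ γ a b N y → IsSolution S x y (fun t => σ (y t)) a b →
        X.NormLE (α - γ) (y a) U → (∀ t ∈ Ioc a b, X.NormLE α (y t) (R * (t - a) ^ (-γ))) ∧
          ∀ s t, a < s → s < t → t ≤ b → ‖y t - y s‖ ≤ R * (t - s) ^ α * (s - a) ^ (-γ) := by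
  obtain ⟨τ, hτ, C, hC, -, h⟩ := hS.exists_apriori_local hσ he hγ hγα hγη hH hx
  obtain ⟨C₁, hC₁, h₁⟩ := hS.exists_holder_bound he hγ hγα le_rfl hγη
  obtain ⟨C₂, hC₂, h₂⟩ := hσ.exists_forcingBound_comp
  obtain ⟨K, hK, hK'⟩ := PathBound.exists_forcingBound X
    (show 0 ≤ α by linarith) (show α < 2 by linarith [he.lt, he.lt_one])
  refine ⟨τ, hτ, fun U hU => ?_⟩
  set N' := C₂ * (1 + K * (C * (1 + U))) with hN'
  have hN'0 : 0 ≤ N' := by positivity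
  refine ⟨max (C * (1 + U)) (C₁ * (U + H * N')), ?_, ?_⟩
  · refine le_trans ?_ (le_max_left _ _)
    nlinarith
  intro a b N ha hab hb hτab hN y hy hsol hyU
  have hpb := h a b U N ha hab hb hτab hN y hy hsol hyU
  have hfs : X.ForcedSolution S x η α ρ γ a b H N' y (fun t => σ (y t)) :=
    ⟨hab, by linarith, hH, fun r q h1 h2 h3 => hx r q (by linarith) h2 (by linarith), hsol, hN'0,
      h₂ ρ γ a b _ y hγ (by linarith) (by positivity)
        (hK' ρ γ γ a b _ y le_rfl (by linarith) (by positivity) hpb)⟩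
  refine ⟨fun t ht => (hpb.norm t ht).mono ?_, fun s t has hst htb => ?_⟩
  · have := Real.rpow_nonneg (show 0 ≤ t - a by linarith [ht.1]) (-γ)
    gcongr
    exact le_max_left _ _
  · refine (h₁ x y _ a b H N' U hfs hyU s t has hst htb).trans ?_
    have := Real.rpow_nonneg (show 0 ≤ s - a by linarith) (-γ)
    have := Real.rpow_nonneg (show 0 ≤ t - s by linarith) α
    gcongr
    exact le_max_right _ _

theorem nonlinearSolution_restart (hS : X.IsSmoothingSemigroup S A) (he : IsExponentTriple η α ρ)
    (hx : ∀ r q, 0 ≤ r → r ≤ q → q ≤ 1 → |x q - x r| ≤ H * (q - r) ^ η) {c : ℝ} (hc : c ≤ 1)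
    {y : ℝ → E} (hsol : IsSolution S x y (fun t => σ (y t)) 0 c) {a b : ℝ} (ha : 0 ≤ a)
    (hab : a ≤ b) (hbc : b ≤ c) : IsSolution S x y (fun t => σ (y t)) a b :=
  hS.isSolution_restrict (by linarith [he.pos, he.le, he.lt]) (by linarith)
    (fun r q h1 h2 h3 => hx r q h1 h2 (by linarith)) (hsol.mono_right hbc) ha hab

/-- Global a priori bound. -/
theorem exists_value_bound_global (hS : X.IsSmoothingSemigroup S A)
    (hσ : X.IsAdmissibleNonlinearity σ α ω) (he : IsExponentTriple η α ρ) (hγ : 0 ≤ γ)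
    (hγα : γ ≤ α) (hγη : γ < η - α) (hH : 0 ≤ H)
    (hx : ∀ r q, 0 ≤ r → r ≤ q → q ≤ 1 → |x q - x r| ≤ H * (q - r) ^ η) {U : ℝ} (hU : 0 ≤ U) :
    ∃ R : ℝ, 1 ≤ R ∧ ∀ c ∈ Ioc (0 : ℝ) 1, ∀ y : ℝ → E, X.NonlinearSolution S σ x α ρ γ c y →
      X.NormLE (α - γ) (y 0) U → ∀ t ∈ Ioc 0 c, X.NormLE α (y t) (R * t ^ (-γ)) := by
  have hρ := he.pos
  obtain ⟨τ₁, hτ₁, h₁⟩ := hS.exists_bounds_local hσ he hγ hγα hγη hH hx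
  obtain ⟨τ₂, hτ₂, h₂⟩ := hS.exists_bounds_local (γ := 0) hσ he le_rfl (by linarith)
    (by linarith) hH hx
  set τ := min τ₁ τ₂ with hτdef
  have hτ : 0 < τ := lt_min hτ₁.1 hτ₂.1
  -- Induction over times up to `(n + 2) τ / 2`. The first step uses the weight `γ`; afterwards the
  -- equation is restarted at `t - τ/2` from a value in `X_α`, without weight. Since `τ` does not
  -- depend on the size reached, finitely many steps cover `[0,1]`.
  have hstep : ∀ n : ℕ, ∃ R : ℝ, 1 ≤ R ∧ ∀ c ∈ Ioc (0 : ℝ) 1, ∀ y : ℝ → E,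
      X.NonlinearSolution S σ x α ρ γ c y → X.NormLE (α - γ) (y 0) U →
      ∀ t ∈ Ioc 0 c, t ≤ (n + 2) * (τ / 2) → X.NormLE α (y t) (R * t ^ (-γ)) := by
    intro n
    induction n with
    | zero =>
      obtain ⟨R, hR, h⟩ := h₁ U hU
      refine ⟨R, hR, fun c hc y hy hyU t ht htτ => ?_⟩
      obtain ⟨N, hN, hyN⟩ := hy.bound
      have e := (h 0 t N le_rfl ht.1 (ht.2.trans hc.2) ?_ hN y ?_
        (hy.sol.mono_right ht.2) hyU).1 t ⟨ht.1, le_rfl⟩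
      · rwa [sub_zero] at e
      · have := min_le_left τ₁ τ₂
        push_cast at htτ
        linarith
      · exact ⟨fun s hs => hyN.norm s ⟨hs.1, hs.2.trans ht.2⟩,
          fun s r h1 h2 h3 => hyN.incr s r h1 h2 (h3.trans ht.2)⟩
    | succ n ih =>
      obtain ⟨R, hR, h⟩ := ih
      obtain ⟨R', hR', h'⟩ := h₂ (R * (τ / 2) ^ (-γ)) (by positivity)
      refine ⟨R + R', by linarith, fun c hc y hy hyU t ht htτ => ?_⟩
      have ht1 : 1 ≤ t ^ (-γ) := one_le_rpow_neg ht.1 (ht.2.trans hc.2) hγ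
      by_cases hle : t ≤ (n + 2) * (τ / 2)
      · refine (h c hc y hy hyU t ht hle).mono ?_
        gcongr
        linarith
      · push Not at hle
        push_cast at htτ
        obtain ⟨N, hN, hyN⟩ := hy.bound
        have hn : (0 : ℝ) ≤ n := Nat.cast_nonneg n
        have ha : τ / 2 ≤ t - τ / 2 := by nlinarith
        have hya := h c hc y hy hyU (t - τ / 2) ⟨by linarith, by linarith [ht.2]⟩ (by linarith)
        have e := (h' (t - τ / 2) t (N * (t - τ / 2) ^ (-γ - ρ)) (by linarith) (by linarith)
          (ht.2.trans hc.2) ?_ ?_ y ?_ ?_ ?_).1 t ⟨by linarith, le_rfl⟩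
        · refine e.mono ?_
          rw [neg_zero, Real.rpow_zero, mul_one]
          nlinarith
        · have := min_le_right τ₁ τ₂
          linarith
        · have : 0 ≤ t - τ / 2 := by linarith
          positivity
        · exact hyN.restart (by linarith) ht.2 (ht.2.trans hc.2) hN hγ hρ.le
        · exact hS.nonlinearSolution_restart he hx hc.2 hy.sol (by linarith) (by linarith) ht.2
        · rw [sub_zero]
          refine hya.mono ?_
          have : (t - τ / 2) ^ (-γ) ≤ (τ / 2) ^ (-γ) :=
            Real.rpow_le_rpow_of_nonpos (by linarith) ha (by linarith)
          gcongr
  obtain ⟨n, hn⟩ := exists_nat_ge (2 / τ)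
  obtain ⟨R, hR, h⟩ := hstep n
  refine ⟨R, hR, fun c hc y hy hyU t ht => h c hc y hy hyU t ht ?_⟩
  rw [div_le_iff₀ hτ] at hn
  linarith [ht.2, hc.2]

/-- Global bounds, including Hölder continuity in the base space, which depend on the initial value
through its norm only. -/
theorem exists_bounds_global (hS : X.IsSmoothingSemigroup S A)
    (hσ : X.IsAdmissibleNonlinearity σ α ω) (he : IsExponentTriple η α ρ) (hγ : 0 ≤ γ)
    (hγα : γ ≤ α) (hγη : γ < η - α) (hH : 0 ≤ H)
    (hx : ∀ r q, 0 ≤ r → r ≤ q → q ≤ 1 → |x q - x r| ≤ H * (q - r) ^ η) {U : ℝ} (hU : 0 ≤ U) :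
    ∃ R : ℝ, 1 ≤ R ∧ ∀ c ∈ Ioc (0 : ℝ) 1, ∀ y : ℝ → E, X.NonlinearSolution S σ x α ρ γ c y →
      X.NormLE (α - γ) (y 0) U → (∀ t ∈ Ioc 0 c, X.NormLE α (y t) (R * t ^ (-γ))) ∧
      ∀ s t, 0 < s → s < t → t ≤ c → ‖y t - y s‖ ≤ R * (t - s) ^ α * s ^ (-γ) := by
  have hρ := he.pos
  have hα0 : 0 ≤ α := by linarith
  obtain ⟨R₀, hR₀, h₀⟩ := hS.exists_value_bound_global hσ he hγ hγα hγη hH hx hU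
  obtain ⟨τ₁, hτ₁, h₁⟩ := hS.exists_bounds_local hσ he hγ hγα hγη hH hx
  obtain ⟨τ₂, hτ₂, h₂⟩ := hS.exists_bounds_local (γ := 0) hσ he le_rfl (by linarith)
    (by linarith) hH hx
  obtain ⟨K, hK, hK'⟩ := X.exists_normLE_embed le_rfl hα0
    (show α < 2 by linarith [he.lt, he.lt_one])
  set τ := min τ₁ τ₂ with hτdef
  have hτ : 0 < τ := lt_min hτ₁.1 hτ₂.1
  obtain ⟨R₁, hR₁, h₁⟩ := h₁ U hU
  obtain ⟨R₂, hR₂, h₂⟩ := h₂ (R₀ * (τ / 2) ^ (-γ)) (by positivity)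
  have hR₃ : 0 ≤ 2 * K * R₀ * (τ / 4) ^ (-α) := by positivity
  refine ⟨R₀ + R₁ + R₂ + 2 * K * R₀ * (τ / 4) ^ (-α), by linarith, ?_⟩
  intro c hc y hy hyU
  have hval := h₀ c hc y hy hyU
  refine ⟨fun t ht => (hval t ht).mono ?_, fun s t hs hst htc => ?_⟩
  · have := Real.rpow_nonneg ht.1.le (-γ)
    gcongr
    linarith
  have hts : 0 < t - s := by linarith
  have hs1 : 1 ≤ s ^ (-γ) := one_le_rpow_neg hs (by linarith [hc.2]) hγ
  have hs2 : 0 ≤ s ^ (-γ) := by linarith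
  have hts2 : 0 ≤ (t - s) ^ α := Real.rpow_nonneg hts.le _
  obtain ⟨N, hN, hyN⟩ := hy.bound
  -- Three regimes: `t` in the first short interval; `t - s ≤ τ/4` beyond it, where the equation is
  -- restarted at `s - τ/4 ≥ τ/2`; and longer increments, bounded through the values alone.
  suffices h : ‖y t - y s‖ ≤ R₁ * (t - s) ^ α * s ^ (-γ) ∨
      ‖y t - y s‖ ≤ R₂ * (t - s) ^ α * s ^ (-γ) ∨
      ‖y t - y s‖ ≤ 2 * K * R₀ * (τ / 4) ^ (-α) * (t - s) ^ α * s ^ (-γ) by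
    rcases h with h | h | h
    all_goals
      refine h.trans ?_
      gcongr
      linarith
  by_cases ht : t ≤ τ
  · left
    have e := (h₁ 0 t N le_rfl (by linarith) (htc.trans hc.2) ?_ hN y ?_
        (hy.sol.mono_right htc) hyU).2 s t hs hst le_rfl
    · rwa [sub_zero] at e
    · linarith [min_le_left τ₁ τ₂]
    · exact ⟨fun s hs => hyN.norm s ⟨hs.1, hs.2.trans htc⟩,
          fun s r h1 h2 h3 => hyN.incr s r h1 h2 (h3.trans htc)⟩
  right
  push Not at ht
  by_cases hle : t - s ≤ τ / 4
  · left
    have ha : τ / 2 ≤ s - τ / 4 := by linarith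
    have hya := hval (s - τ / 4) ⟨by linarith, by linarith⟩
    have e := (h₂ (s - τ / 4) t (N * (s - τ / 4) ^ (-γ - ρ)) (by linarith) (by linarith)
      (htc.trans hc.2) ?_ ?_ y ?_ ?_ ?_).2 s t (by linarith) hst le_rfl
    · refine e.trans ?_
      rw [neg_zero, Real.rpow_zero]
      gcongr
    · linarith [min_le_right τ₁ τ₂]
    · have : 0 ≤ s - τ / 4 := by linarith
      positivity
    · exact hyN.restart (by linarith) htc (htc.trans hc.2) hN hγ hρ.le
    · exact hS.nonlinearSolution_restart he hx hc.2 hy.sol (by linarith) (by linarith) htc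
    · rw [sub_zero]
      refine hya.mono ?_
      have : (s - τ / 4) ^ (-γ) ≤ (τ / 2) ^ (-γ) :=
        Real.rpow_le_rpow_of_nonpos (by linarith) ha (by linarith)
      gcongr
  · right
    push Not at hle
    have e1 := normLE_zero_iff.1 (hK' _ _ (hval s ⟨hs, by linarith⟩))
    have e2 := normLE_zero_iff.1 (hK' _ _ (hval t ⟨by linarith, htc⟩))
    have e3 : t ^ (-γ) ≤ s ^ (-γ) := Real.rpow_le_rpow_of_nonpos hs hst.le (by linarith)
    have e4 : 1 ≤ (τ / 4) ^ (-α) * (t - s) ^ α := by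
      have h4 : 0 < τ / 4 := by linarith
      rw [Real.rpow_neg h4.le, inv_mul_eq_div, one_le_div (by positivity)]
      gcongr
    calc _ ≤ K * (R₀ * t ^ (-γ)) + K * (R₀ * s ^ (-γ)) :=
          (norm_sub_le _ _).trans (add_le_add e2 e1)
      _ ≤ K * (R₀ * s ^ (-γ)) + K * (R₀ * s ^ (-γ)) := by gcongr
      _ = 2 * K * R₀ * s ^ (-γ) * 1 := by ring
      _ ≤ 2 * K * R₀ * s ^ (-γ) * ((τ / 4) ^ (-α) * (t - s) ^ α) := by gcongr
      _ = _ := by ring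

/-- Solutions satisfy weighted bounds with values and increments in `X_α`. -/
theorem exists_pathBound_nonlinear (hS : X.IsSmoothingSemigroup S A)
    (hσ : X.IsAdmissibleNonlinearity σ α ω) (he : IsExponentTriple η α ρ) (hγ : 0 ≤ γ)
    (hγα : γ ≤ α) (hγη : γ < η - α) (hH : 0 ≤ H)
    (hx : ∀ r q, 0 ≤ r → r ≤ q → q ≤ 1 → |x q - x r| ≤ H * (q - r) ^ η) {c U : ℝ}
    (hc : c ∈ Ioc (0 : ℝ) 1) {y : ℝ → E} (hy : X.NonlinearSolution S σ x α ρ γ c y)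
    (hyU : X.NormLE (α - γ) (y 0) U) : ∃ N, 0 < N ∧ X.PathBound α ρ γ γ 0 c N y := by
  obtain ⟨C₁, hC₁, h₁⟩ := hS.exists_pathBound he hγ hγα le_rfl hγη
  obtain ⟨C₂, hC₂, h₂⟩ := hσ.exists_forcingBound_comp
  obtain ⟨N, hN, hyN⟩ := hy.bound
  have hU := hyU.nonneg
  have h := h₁ x y _ 0 c H _ U ⟨hc.1, by linarith [hc.2], hH,
    fun r q h1 h2 h3 => hx r q h1 h2 (h3.trans hc.2), hy.sol, by positivity,
    h₂ ρ γ 0 c N y hγ (by linarith [hc.2]) hN hyN⟩ hyU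
  have hT : 0 ≤ (c - 0) ^ (η - α - γ) := Real.rpow_nonneg (by linarith [hc.1]) _
  exact ⟨_, by positivity, h.mono (by linarith [hc.2]) (by positivity)
    (le_add_of_nonneg_right zero_le_one) le_rfl⟩

/-- Uniqueness of solutions. -/
theorem nonlinearSolution_unique (hS : X.IsSmoothingSemigroup S A)
    (hσ : X.IsAdmissibleNonlinearity σ α ω) (hω : 1 ≤ ω) (he : IsExponentTriple η α ρ)
    (hγ : 0 ≤ γ) (hγα : γ ≤ α) (hγη : (1 + ω) * γ < η - α) (hH : 0 ≤ H)
    (hx : ∀ r q, 0 ≤ r → r ≤ q → q ≤ 1 → |x q - x r| ≤ H * (q - r) ^ η) {c U : ℝ}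
    (hc : c ∈ Ioc (0 : ℝ) 1) {y z : ℝ → E} (hy : X.NonlinearSolution S σ x α ρ γ c y)
    (hz : X.NonlinearSolution S σ x α ρ γ c z) (hyU : X.NormLE (α - γ) (y 0) U)
    (hyz : y 0 = z 0) : EqOn y z (Icc 0 c) := by
  have hρ := he.pos
  have hγη' : γ < η - α := lt_of_le_of_lt (by nlinarith) hγη
  obtain ⟨N₁, hN₁, hyN₁⟩ := hS.exists_pathBound_nonlinear hσ he hγ hγα hγη' hH hx hc hy hyU
  obtain ⟨N₂, hN₂, hzN₂⟩ := hS.exists_pathBound_nonlinear hσ he hγ hγα hγη' hH hx hc hz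
    (hyz ▸ hyU)
  set N := N₁ + N₂ with hNdef
  have hc1 := hc.2
  have hN : 0 < N := by linarith
  have hyN := hyN₁.mono (N' := N) (by linarith) hN₁.le (by linarith) le_rfl
  have hzN := hzN₂.mono (N' := N) (by linarith) hN₂.le (by linarith) le_rfl
  obtain ⟨τ₁, hτ₁, h₁⟩ := hS.exists_unique_local hσ hω he hγ hγα hγη hH hx hN
  set τ := min τ₁ c with hτdef
  have hτ : 0 < τ := lt_min hτ₁.1 hc.1
  -- The bound after a restart at any time `≥ τ` is at most `N τ^{-γ-ρ}`, so one step length `τ₂`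
  -- serves all restarts.
  obtain ⟨τ₂, hτ₂, h₂⟩ := hS.exists_unique_local (γ := 0) hσ hω he le_rfl (by linarith)
    (by linarith) hH hx (show 0 < N * τ ^ (-γ - ρ) by positivity)
  have hfirst : EqOn y z (Icc 0 τ) := by
    refine h₁ 0 τ le_rfl hτ ((min_le_right _ _).trans hc1)
      (by linarith [min_le_left τ₁ c]) y z ?_ ?_ (hy.sol.mono_right (min_le_right _ _))
      (hz.sol.mono_right (min_le_right _ _)) hyz
    · exact ⟨fun s hs => hyN.norm s ⟨hs.1, hs.2.trans (min_le_right _ _)⟩,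
        fun s r h1 h2 h3 => hyN.incr s r h1 h2 (h3.trans (min_le_right _ _))⟩
    · exact ⟨fun s hs => hzN.norm s ⟨hs.1, hs.2.trans (min_le_right _ _)⟩,
        fun s r h1 h2 h3 => hzN.incr s r h1 h2 (h3.trans (min_le_right _ _))⟩
  have hstep : ∀ n : ℕ, EqOn y z (Icc 0 (min (τ + n * τ₂) c)) := by
    intro n
    induction n with
    | zero =>
      rw [Nat.cast_zero, zero_mul, add_zero]
      exact hfirst.mono (Icc_subset_Icc_right (min_le_left _ _))
    | succ n ih =>
      intro t ht
      have hn : (0 : ℝ) ≤ n := Nat.cast_nonneg n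
      have hnτ : 0 ≤ n * τ₂ := mul_nonneg hn hτ₂.1.le
      have ht1 := ht.2.trans (min_le_left _ _)
      have htc := ht.2.trans (min_le_right _ _)
      push_cast at ht1
      by_cases hta : t ≤ min (τ + n * τ₂) c
      · exact ih ⟨ht.1, hta⟩
      push Not at hta
      have hac : τ + n * τ₂ < c := by
        by_contra hcon
        push Not at hcon
        rw [min_eq_right hcon] at hta
        linarith
      rw [min_eq_left hac.le] at hta ih
      have hle : N * (τ + n * τ₂) ^ (-γ - ρ) ≤ N * τ ^ (-γ - ρ) := by
        have : (τ + n * τ₂) ^ (-γ - ρ) ≤ τ ^ (-γ - ρ) :=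
          Real.rpow_le_rpow_of_nonpos hτ (by linarith) (by linarith)
        gcongr
      have h0 : 0 ≤ N * (τ + n * τ₂) ^ (-γ - ρ) := by positivity
      refine h₂ (τ + n * τ₂) t (by linarith) hta (by linarith) (by linarith) y z
        ((hyN.restart (by linarith) htc (by linarith) hN.le hγ hρ.le).mono (by linarith) h0 hle
          le_rfl)
        ((hzN.restart (by linarith) htc (by linarith) hN.le hγ hρ.le).mono (by linarith) h0 hle
          le_rfl)
        (hS.nonlinearSolution_restart he hx hc1 hy.sol (by linarith) hta.le htc)
        (hS.nonlinearSolution_restart he hx hc1 hz.sol (by linarith) hta.le htc)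
        (ih ⟨by linarith, le_rfl⟩) ⟨hta.le, le_rfl⟩
  obtain ⟨n, hn⟩ := exists_nat_ge (1 / τ₂)
  rw [div_le_iff₀ hτ₂.1] at hn
  have h := hstep n
  rwa [min_eq_right (by linarith)] at h

/-- An interval straddling `c` is split at `c`; besides the two known remainders only the defect
appears, and it involves just the increments of `φ` that end at `c`. -/
theorem isPrimitive_glue (hS : X.IsSmoothingSemigroup S A) {u φ : ℝ → E} {s c d B : ℝ}
    (hηρ : 1 < η + ρ) (hη : 0 < η) (hρ : 0 < ρ) (hH : 0 ≤ H) (hB : 0 ≤ B) (hds : d - s ≤ 1)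
    (hx : ∀ r q, s ≤ r → r ≤ q → q ≤ d → |x q - x r| ≤ H * (q - r) ^ η)
    (hφ : ∀ r, s ≤ r → r ≤ c → ‖hatDeltaOne S φ r c‖ ≤ B * (c - r) ^ ρ)
    (h₁ : IsPrimitive S x u φ s c) (h₂ : IsPrimitive S x u φ c d) : IsPrimitive S x u φ s d := by
  obtain ⟨L, hL1, hL⟩ := hS.exists_norm_bound
  obtain ⟨C₁, p₁, hC₁, hp₁, h₁⟩ := h₁
  obtain ⟨C₂, p₂, hC₂, hp₂, h₂⟩ := h₂
  set p := min (min p₁ p₂) (η + ρ) with hp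
  have hp1 : 1 < p := lt_min (lt_min hp₁ hp₂) hηρ
  have hmono : ∀ e l l' : ℝ, p ≤ e → 0 ≤ l → l ≤ l' → l' ≤ 1 → l ^ e ≤ l' ^ p := by
    intro e l l' hpe hl hll hl1
    calc l ^ e ≤ l ^ p := Real.rpow_le_rpow_of_exponent_ge_of_imp hl (hll.trans hl1) hpe
          (fun _ h => by linarith)
      _ ≤ _ := by gcongr
  have hpp₁ : p ≤ p₁ := (min_le_left _ _).trans (min_le_left _ _)
  have hpp₂ : p ≤ p₂ := (min_le_left _ _).trans (min_le_right _ _)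
  have hpp₃ : p ≤ η + ρ := min_le_right _ _
  refine ⟨C₂ + L * C₁ + L * (H * B), p, by positivity, hp1, fun r q hsr hrq hqd => ?_⟩
  have hqr : 0 ≤ (q - r) ^ p := Real.rpow_nonneg (by linarith) _
  rcases le_total q c with hqc | hcq
  · refine (h₁ r q hsr hrq hqc).trans ?_
    have e := hmono p₁ (q - r) (q - r) hpp₁ (by linarith) le_rfl (by linarith)
    calc _ ≤ C₁ * (q - r) ^ p := by gcongr
      _ ≤ _ := by
        gcongr
        have : 0 ≤ L * (H * B) := by positivity
        nlinarith
  rcases le_total c r with hcr | hrc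
  · refine (h₂ r q hcr hrq hqd).trans ?_
    have e := hmono p₂ (q - r) (q - r) hpp₂ (by linarith) le_rfl (by linarith)
    calc _ ≤ C₂ * (q - r) ^ p := by gcongr
      _ ≤ _ := by
        gcongr
        have : 0 ≤ L * (H * B) := by positivity
        have : 0 ≤ L * C₁ := by positivity
        linarith
  rw [hS.germRemainder_split x u φ hrc hcq]
  have hS1 : ∀ w, ‖S (q - c) w‖ ≤ L * ‖w‖ := hL (q - c) ⟨by linarith, by linarith⟩
  have e1 := h₂ c q le_rfl hcq hqd
  have e2 := h₁ r c hsr hrc le_rfl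
  have e3 := hx c q (by linarith) hcq hqd
  have e4 := hφ r hsr hrc
  have f1 := hmono p₂ (q - c) (q - r) hpp₂ (by linarith) (by linarith) (by linarith)
  have f2 := hmono p₁ (c - r) (q - r) hpp₁ (by linarith) (by linarith) (by linarith)
  have f3 := hmono (η + ρ) (q - r) (q - r) hpp₃ (by linarith) le_rfl (by linarith)
  have f4 : (q - c) ^ η ≤ (q - r) ^ η := by
    have : 0 ≤ q - c := by linarith
    gcongr
  have f5 : (c - r) ^ ρ ≤ (q - r) ^ ρ := by
    have : 0 ≤ c - r := by linarith
    gcongr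
  have f6 : (q - r) ^ η * (q - r) ^ ρ = (q - r) ^ (η + ρ) :=
    (Real.rpow_add_of_nonneg (by linarith) hη.le hρ.le).symm
  have hqr' : 0 ≤ q - r := by linarith
  have hcr' : 0 ≤ c - r := by linarith
  have hqc' : 0 ≤ q - c := by linarith
  refine (norm_add_le _ _).trans ((add_le_add (norm_add_le _ _) le_rfl).trans ?_)
  calc _ ≤ C₂ * (q - c) ^ p₂ + L * (C₁ * (c - r) ^ p₁)
        + L * (H * (q - c) ^ η * (B * (c - r) ^ ρ)) := by
        refine add_le_add (add_le_add e1 ((hS1 _).trans (by gcongr))) ((hS1 _).trans ?_)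
        rw [norm_smul, Real.norm_eq_abs]
        gcongr
    _ ≤ C₂ * (q - r) ^ p + L * (C₁ * (q - r) ^ p)
        + L * (H * (q - r) ^ η * (B * (q - r) ^ ρ)) := by gcongr
    _ = (C₂ + L * C₁) * (q - r) ^ p + L * (H * B) * ((q - r) ^ η * (q - r) ^ ρ) := by ring
    _ ≤ (C₂ + L * C₁) * (q - r) ^ p + L * (H * B) * (q - r) ^ p := by
        rw [f6]
        gcongr
    _ = _ := by ring

end IsSmoothingSemigroup

end BanachScale

/-! ### Continuation and global existence -/

namespace BanachScale

variable {E : Type u} [NormedAddCommGroup E] [NormedSpace ℝ E] {X : BanachScale.{u, v} E}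
  {S : ℝ → E →L[ℝ] E} {A : E →ₗ.[ℝ] E}

theorem tendsto_sub_rpow_nhdsGT (c : ℝ) {p : ℝ} (hp : 0 < p) :
    Tendsto (fun m => (m - c) ^ p) (𝓝[>] c) (𝓝 0) := by
  have h0 : Tendsto (fun s => s - c) (𝓝[>] c) (𝓝 (c - c)) :=
    (tendsto_id.sub_const c).mono_left nhdsWithin_le_nhds
  have h1 := h0.rpow_const (p := p) (Or.inr hp.le)
  rwa [sub_self, Real.zero_rpow hp.ne'] at h1

namespace IsSmoothingSemigroup

variable {σ : E → E} {η α ρ γ ω H : ℝ} {x : ℝ → ℝ}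

/-- On intervals starting after `c` the sewing constant does not depend on the left end. Splitting
`[c,q]` at `m` and letting `m` decrease to `c`, the extra terms vanish because `δ̂₁u(c,m)` does. -/
theorem isPrimitive_closed (hS : X.IsSmoothingSemigroup S A) {u φ : ℝ → E} {c d B : ℝ}
    (hηρ : 1 < η + ρ) (hη : 0 < η) (hρ : 0 < ρ) (hH : 0 ≤ H) (hB : 0 ≤ B) (hcd : d - c ≤ 1)
    (hx : ∀ r q, c ≤ r → r ≤ q → q ≤ d → |x q - x r| ≤ H * (q - r) ^ η)
    (hφ : ∀ r q, c ≤ r → r ≤ q → q ≤ d → ‖hatDeltaOne S φ r q‖ ≤ B * (q - r) ^ ρ)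
    (hu : IsSolution S x u φ c d) (hu0 : Tendsto (fun m => hatDeltaOne S u c m) (𝓝[>] c) (𝓝 0)) :
    IsPrimitive S x u φ c d := by
  obtain ⟨L, hL1, hL⟩ := hS.exists_norm_bound
  obtain ⟨C, hC, h⟩ := hS.exists_sewing_zero hηρ
  have hopen : ∀ r q, c < r → r ≤ q → q ≤ d →
      ‖germRemainder S x u φ r q‖ ≤ C * (H * B) * (q - r) ^ (η + ρ) := fun r q hcr hrq hqd =>
    h x u φ r q H B hH hB hrq (by linarith)
      (fun r' q' h1 h2 h3 => hx r' q' (by linarith) h2 (by linarith))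
      (fun r' q' h1 h2 h3 => hφ r' q' (by linarith) h2 (by linarith))
      ((hu.1 r ⟨hcr, by linarith⟩).mono le_rfl hqd)
  refine ⟨C * (H * B), η + ρ, by positivity, hηρ, fun r q hcr hrq hqd => ?_⟩
  rcases hcr.eq_or_lt with rfl | hcr
  swap
  · exact hopen r q hcr hrq hqd
  rcases hrq.eq_or_lt with rfl | hrq
  · rw [germRemainder, hS.hatDeltaOne_self, sub_self (x c), zero_smul, map_zero, sub_zero,
      norm_zero, sub_self]
    have := Real.rpow_nonneg (le_refl (0 : ℝ)) (η + ρ)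
    positivity
  have hlim : Tendsto (fun m => C * (H * B) * (q - c) ^ (η + ρ)
      + L * (‖hatDeltaOne S u c m‖ + L * (H * (m - c) ^ η * ‖φ c‖))
      + L * (H * (B * (m - c) ^ ρ))) (𝓝[>] c) (𝓝 (C * (H * B) * (q - c) ^ (η + ρ)
      + L * (‖(0 : E)‖ + L * (H * 0 * ‖φ c‖)) + L * (H * (B * 0)))) := by
    have h1 := tendsto_sub_rpow_nhdsGT c hη
    have h2 := tendsto_sub_rpow_nhdsGT c hρ
    exact ((((hu0.norm).add (((h1.const_mul H).mul_const _).const_mul L)).const_mul L).const_add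
      _).add (((h2.const_mul B).const_mul H).const_mul L)
  simp only [norm_zero, mul_zero, zero_mul, add_zero] at hlim
  refine ge_of_tendsto hlim ?_
  filter_upwards [Ioo_mem_nhdsGT hrq] with m hm
  have hcm : 0 ≤ m - c := by linarith [hm.1]
  have hmq : 0 ≤ q - m := by linarith [hm.2]
  have hS1 : ∀ t, 0 ≤ t → t ≤ 1 → ∀ w, ‖S t w‖ ≤ L * ‖w‖ := fun t h1 h2 => hL t ⟨h1, h2⟩
  rw [hS.germRemainder_split x u φ hm.1.le hm.2.le]
  refine (norm_add_le _ _).trans (add_le_add ((norm_add_le _ _).trans (add_le_add ?_ ?_)) ?_)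
  · refine (hopen m q hm.1 hm.2.le hqd).trans ?_
    have : 0 ≤ η + ρ := by linarith
    gcongr
    exact hm.1.le
  · refine (hS1 _ hmq (by linarith) _).trans ?_
    gcongr
    rw [germRemainder]
    refine (norm_sub_le _ _).trans (add_le_add le_rfl ((hS1 _ hcm (by linarith) _).trans ?_))
    gcongr
    rw [norm_smul, Real.norm_eq_abs]
    gcongr
    exact hx c m le_rfl hm.1.le (by linarith)
  · refine (hS1 _ hmq (by linarith) _).trans ?_
    gcongr
    rw [norm_smul, Real.norm_eq_abs]
    have e1 := hx m q hm.1.le hm.2.le hqd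
    have e2 := hφ c m le_rfl hm.1.le (by linarith [hm.2])
    have e3 : (q - m) ^ η ≤ 1 := Real.rpow_le_one hmq (by linarith) hη.le
    calc _ ≤ (H * (q - m) ^ η) * (B * (m - c) ^ ρ) := by gcongr
      _ ≤ (H * 1) * (B * (m - c) ^ ρ) := by gcongr
      _ = _ := by ring

/-- Solutions starting in `X_α` are regular up to the initial time. -/
theorem isPrimitive_of_regular_start (hS : X.IsSmoothingSemigroup S A)
    (hσ : X.IsAdmissibleNonlinearity σ α ω) (he : IsExponentTriple η α ρ) (hH : 0 ≤ H)
    (hx : ∀ r q, 0 ≤ r → r ≤ q → q ≤ 1 → |x q - x r| ≤ H * (q - r) ^ η) {c d R U : ℝ}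
    (hc : 0 ≤ c) (hcd : c < d) (hd : d ≤ 1) (hR : 0 ≤ R) {z : ℝ → E}
    (hz : IsSolution S x z (fun t => σ (z t)) c d) (hzR : X.PathBound α ρ 0 0 c d R z)
    (hzc : X.NormLE α (z c) U) : IsPrimitive S x z (fun t => σ (z t)) c d ∧
      ∃ B, 0 ≤ B ∧ ∀ r q, c ≤ r → r ≤ q → q ≤ d → ‖z q - z r‖ ≤ B * (q - r) ^ α := by
  have hρ := he.pos
  have hle := he.le
  have hlt := he.lt
  have hlt1 := he.lt_one
  obtain ⟨K, hK, hK'⟩ := PathBound.exists_forcingBound X (show 0 ≤ α by linarith)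
    (show α < 2 by linarith)
  obtain ⟨C₁, hC₁, h₁⟩ := hS.exists_holder_bound he (γ := 0) (g := 0) le_rfl (by linarith) le_rfl
    (by linarith)
  obtain ⟨C₂, hC₂, h₂⟩ := hS.exists_increment_bound_full he (g := 0) le_rfl le_rfl two_pos
    (by linarith)
  obtain ⟨C₃, hC₃, h₃⟩ := hS.exists_norm_sub_le (show 0 < α by linarith) (by linarith)
  obtain ⟨C₄, hC₄, h₄⟩ := hσ.exists_forcingBound_comp
  obtain ⟨C₅, hC₅, h₅⟩ := hσ.exists_lipschitz
  obtain ⟨C₆, hC₆, h₆⟩ := hσ.exists_growth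
  have hU := hzc.nonneg
  have hxcd : ∀ r q, c ≤ r → r ≤ q → q ≤ d → |x q - x r| ≤ H * (q - r) ^ η :=
    fun r q h1 h2 h3 => hx r q (by linarith) h2 (by linarith)
  set N := C₄ * (1 + K * R) with hN
  have hN0 : 0 ≤ N := by positivity
  have hfs : X.ForcedSolution S x η α ρ 0 c d H N z (fun t => σ (z t)) :=
    ⟨hcd, by linarith, hH, hxcd, hz, hN0, h₄ ρ 0 c d _ z le_rfl (by linarith) (by positivity)
      (hK' ρ 0 0 c d R z le_rfl (by linarith) hR hzR)⟩
  have hval : ∀ t ∈ Icc c d, X.NormLE α (z t) (R + U) := fun t ht => by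
    rcases ht.1.eq_or_lt with rfl | hct
    · exact hzc.mono (by linarith)
    · refine (hzR.norm t ⟨hct, ht.2⟩).mono ?_
      rw [neg_zero, Real.rpow_zero]
      linarith
  have hstart : ∀ t, c < t → t ≤ d → ‖hatDeltaOne S z c t‖ ≤ C₂ * (H * N) * (t - c) ^ η := by
    intro t h1 h2
    have e := normLE_zero_iff.1 (h₂ x z _ c d H N hfs c t le_rfl h1 h2)
    rwa [sub_zero, sub_zero] at e
  -- The first summand covers increments away from `c`, the other two those that start at `c`.
  set B := C₁ * (U + H * N) + C₂ * (H * N) + C₃ * U with hBdef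
  have hB : 0 ≤ B := by positivity
  have hholder : ∀ r q, c ≤ r → r ≤ q → q ≤ d → ‖z q - z r‖ ≤ B * (q - r) ^ α := by
    intro r q hcr hrq hqd
    have hqr : 0 ≤ (q - r) ^ α := Real.rpow_nonneg (by linarith) _
    rcases hrq.eq_or_lt with rfl | hrq
    · rw [sub_self, norm_zero]
      positivity
    rcases hcr.eq_or_lt with rfl | hcr
    · have e1 := hstart q hrq hqd
      have e2 := h₃ (q - c) ⟨by linarith, by linarith⟩ _ _ hzc
      have e3 : (q - c) ^ η ≤ (q - c) ^ α :=
        Real.rpow_le_rpow_of_exponent_ge (by linarith) (by linarith) hlt.le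
      rw [sub_eq_hatDeltaOne_add S]
      have e4 : 0 ≤ C₁ * (U + H * N) := by positivity
      calc _ ≤ C₂ * (H * N) * (q - c) ^ η + C₃ * (q - c) ^ α * U :=
            (norm_add_le _ _).trans (add_le_add e1 e2)
        _ ≤ C₂ * (H * N) * (q - c) ^ α + C₃ * (q - c) ^ α * U := by gcongr
        _ = (0 + C₂ * (H * N) + C₃ * U) * (q - c) ^ α := by ring
        _ ≤ _ := by
          rw [hBdef]
          gcongr
    · have e := h₁ x z _ c d H N U hfs (by rwa [sub_zero]) r q hcr hrq hqd
      rw [neg_zero, Real.rpow_zero, mul_one] at e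
      refine e.trans ?_
      rw [hBdef]
      gcongr
      have e5 : 0 ≤ C₂ * (H * N) := by positivity
      have e6 : 0 ≤ C₃ * U := by positivity
      linarith
  refine ⟨?_, B, hB, hholder⟩
  -- As `z` is `α`-Hölder up to `c`, sewing can be used with `α` in the role of `ρ` and without any
  -- weight.
  refine hS.isPrimitive_closed (ρ := α) (B := C₅ * B + C₃ * (C₆ * (1 + (R + U))))
    (by linarith [he.one_lt]) (by linarith) (by linarith) hH (by positivity) (by linarith) hxcd
    (fun r q hcr hrq hqd => ?_) hz ?_
  · have e1 : hatDeltaOne S (fun t => σ (z t)) r q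
        = (σ (z q) - σ (z r)) - (S (q - r) (σ (z r)) - σ (z r)) := by
      rw [hatDeltaOne]; abel
    have e2 := h₃ (q - r) ⟨by linarith, by linarith⟩ _ _ (h₆ _ _ (hval r ⟨hcr, by linarith⟩))
    rw [e1]
    calc _ ≤ C₅ * (B * (q - r) ^ α) + C₃ * (q - r) ^ α * (C₆ * (1 + (R + U))) := by
          refine (norm_sub_le _ _).trans (add_le_add ((h₅ _ _).trans ?_) e2)
          gcongr
          exact hholder r q hcr hrq hqd
      _ = _ := by ring
  · rw [tendsto_zero_iff_norm_tendsto_zero]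
    have h0 := (tendsto_sub_rpow_nhdsGT c (show 0 < η by linarith)).const_mul (C₂ * (H * N))
    rw [mul_zero] at h0
    refine squeeze_zero' (Eventually.of_forall fun _ => norm_nonneg _) ?_ h0
    filter_upwards [Ioo_mem_nhdsGT hcd] with m hm
    exact hstart m hm.1 hm.2.le

/-- Continuation of solutions. -/
theorem nonlinearSolution_extend (hS : X.IsSmoothingSemigroup S A)
    (hσ : X.IsAdmissibleNonlinearity σ α ω) (he : IsExponentTriple η α ρ) (hγ : 0 ≤ γ)
    (hH : 0 ≤ H) (hx : ∀ r q, 0 ≤ r → r ≤ q → q ≤ 1 → |x q - x r| ≤ H * (q - r) ^ η)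
    {c d R U : ℝ} (hc : 0 < c) (hcd : c < d) (hd : d ≤ 1) (hR : 0 ≤ R) {y z : ℝ → E}
    (hy : X.NonlinearSolution S σ x α ρ γ c y) (hyz : z c = y c)
    (hz : IsSolution S x z (fun t => σ (z t)) c d) (hzR : X.PathBound α ρ 0 0 c d R z)
    (hzc : X.NormLE α (z c) U) :
    X.NonlinearSolution S σ x α ρ γ d (fun t => if t ≤ c then y t else z t) := by
  have hρ := he.pos
  have hle := he.le
  have hlt := he.lt
  obtain ⟨hzprim, B, hB, hzB⟩ := hS.isPrimitive_of_regular_start hσ he hH hx hc.le hcd hd hR hz hzR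
    hzc
  obtain ⟨N, hN, hyN⟩ := hy.bound
  obtain ⟨C₄, hC₄, h₄⟩ := hσ.exists_forcingBound_comp
  obtain ⟨C₅, hC₅, h₅⟩ := hS.exists_hatDeltaOne_forcing he
  set w : ℝ → E := fun t => if t ≤ c then y t else z t with hw
  have hwy : ∀ t, t ≤ c → w t = y t := fun t ht => if_pos ht
  have hwz : ∀ t, c ≤ t → w t = z t := fun t ht => by
    rcases ht.eq_or_lt with rfl | h
    · rw [hwy c le_rfl, hyz]
    · exact if_neg (not_le.2 h)
  have hcdprim : IsPrimitive S x w (fun t => σ (w t)) c d :=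
    hzprim.congr (fun t ht => (hwz t ht.1).symm) fun t ht => by simp only; rw [hwz t ht.1]
  have hyprim : ∀ s ∈ Ioc 0 c, IsPrimitive S x w (fun t => σ (w t)) s c := fun s hs =>
    (hy.sol.1 s hs).congr (fun t ht => (hwy t ht.2).symm) fun t ht => by simp only; rw [hwy t ht.2]
  refine ⟨⟨fun s hs => ?_, fun t ht => ?_⟩, N + B + R, by positivity, fun s hs => ?_,
    fun s t hs hst htd => ?_⟩
  · rcases le_total c s with hcs | hsc
    · exact hcdprim.mono hcs le_rfl
    · have hs' := hs.1
      refine hS.isPrimitive_glue (c := c) (B := C₅ * (C₄ * (1 + N)) * s ^ (-γ - ρ)) he.one_lt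
        (by linarith) hρ hH (by positivity) (by linarith)
        (fun r q h1 h2 h3 => hx r q (by linarith) h2 (by linarith)) (fun r hsr hrc => ?_)
        (hyprim s ⟨hs.1, hsc⟩) hcdprim
      rcases hrc.eq_or_lt with rfl | hrc
      · rw [hS.hatDeltaOne_self, norm_zero, sub_self]
        have := Real.rpow_nonneg (le_refl (0 : ℝ)) ρ
        positivity
      · have e := h₅ _ γ 0 c _ (by linarith) (by positivity)
          (h₄ ρ γ 0 c N y hγ (by linarith) hN hyN) r c (by linarith) hrc le_rfl
        have e1 : hatDeltaOne S (fun t => σ (w t)) r c = hatDeltaOne S (fun t => σ (y t)) r c := by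
          simp only [hatDeltaOne]
          rw [hwy r hrc.le, hwy c le_rfl]
        rw [e1]
        refine e.trans ?_
        rw [sub_zero]
        have e2 : r ^ (-γ - ρ) ≤ s ^ (-γ - ρ) :=
          Real.rpow_le_rpow_of_nonpos hs' hsr (by linarith)
        have : 0 ≤ c - r := by linarith
        calc _ ≤ C₅ * (C₄ * (1 + N)) * (c - r) ^ ρ * s ^ (-γ - ρ) := by gcongr
          _ = _ := by ring
  · rw [hwy 0 hc.le, sub_zero]
    rcases le_total t c with htc | hct
    · have h := hy.sol.2 t ⟨ht.1, htc⟩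
      rw [sub_zero] at h
      refine h.congr' ?_
      filter_upwards [Ioo_mem_nhdsGT hc] with s hs
      rw [hwy s hs.2.le]
    · have h := ((S (t - c)).continuous.tendsto _).comp (hy.sol.2 c ⟨hc, le_rfl⟩)
      rw [hS.apply_apply (by linarith) (by linarith), sub_add_sub_cancel t c 0, sub_zero] at h
      refine h.congr' ?_
      filter_upwards [Ioo_mem_nhdsGT hc] with s hs
      rw [Function.comp_apply, hwy s hs.2.le, hS.apply_apply (by linarith) (by linarith [hs.2]),
        sub_add_sub_cancel t c s]
  · have hs' := hs.1
    have h1 : 1 ≤ (s - 0) ^ (-γ) :=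
      one_le_rpow_neg (by linarith) (by linarith [hs.2]) hγ
    rcases le_or_gt s c with hsc | hcs
    · rw [hwy s hsc]
      refine (hyN.norm s ⟨hs.1, hsc⟩).mono ?_
      gcongr
      linarith
    · rw [hwz s hcs.le]
      refine (hzR.norm s ⟨hcs, hs.2⟩).mono ?_
      rw [neg_zero, Real.rpow_zero, mul_one]
      nlinarith
  · have h1 : 1 ≤ (s - 0) ^ (-γ - ρ) := by
      have := one_le_rpow_neg (e := γ + ρ) (show 0 < s - 0 by linarith) (by linarith)
        (by linarith)
      rwa [neg_add, ← sub_eq_add_neg] at this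
    have h2 : 0 ≤ (s - 0) ^ (-γ - ρ) := by linarith
    have hts : 0 ≤ (t - s) ^ ρ := Real.rpow_nonneg (by linarith) _
    have hzle : ∀ r q, c ≤ r → s ≤ r → r ≤ q → q ≤ t →
        ‖z q - z r‖ ≤ B * (t - s) ^ ρ * (s - 0) ^ (-γ - ρ) := by
      intro r q hcr hsr hrq hqt
      refine (hzB r q hcr hrq (by linarith)).trans ?_
      have e1 : (q - r) ^ α ≤ (q - r) ^ ρ :=
        Real.rpow_le_rpow_of_exponent_ge_of_imp (by linarith) (by linarith) hle
          (fun _ h => by linarith)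
      have e2 : (q - r) ^ ρ ≤ (t - s) ^ ρ := by
        have : 0 ≤ q - r := by linarith
        gcongr
      calc B * (q - r) ^ α ≤ B * (t - s) ^ ρ := by
            gcongr
            exact e1.trans e2
        _ ≤ _ := le_mul_of_one_le_right (by positivity) h1
    rcases le_or_gt t c with htc | hct
    · rw [hwy s (by linarith), hwy t htc]
      refine (hyN.incr s t hs hst htc).trans ?_
      gcongr
      linarith
    · rcases le_or_gt c s with hcs | hsc
      · rw [hwz s hcs, hwz t hct.le]
        refine (hzle s t hcs le_rfl hst.le le_rfl).trans ?_
        gcongr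
        linarith
      · rw [hwy s hsc.le, hwz t hct.le]
        have e1 := hzle c t le_rfl hsc.le hct.le le_rfl
        have e2 := hyN.incr s c hs hsc le_rfl
        have e3 : (c - s) ^ ρ ≤ (t - s) ^ ρ := by
          have : 0 ≤ c - s := by linarith
          gcongr
        have e4 : z t - y s = (z t - z c) + (y c - y s) := by rw [hyz]; abel
        rw [e4]
        calc _ ≤ B * (t - s) ^ ρ * (s - 0) ^ (-γ - ρ) + N * (c - s) ^ ρ * (s - 0) ^ (-γ - ρ) :=
              (norm_add_le _ _).trans (add_le_add e1 e2)
          _ ≤ B * (t - s) ^ ρ * (s - 0) ^ (-γ - ρ) + N * (t - s) ^ ρ * (s - 0) ^ (-γ - ρ)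
              + R * (t - s) ^ ρ * (s - 0) ^ (-γ - ρ) := by
              have : 0 ≤ R * (t - s) ^ ρ * (s - 0) ^ (-γ - ρ) := by positivity
              have : N * (c - s) ^ ρ * (s - 0) ^ (-γ - ρ)
                ≤ N * (t - s) ^ ρ * (s - 0) ^ (-γ - ρ) := by gcongr
              linarith
          _ = _ := by ring

/-- Global existence of solutions. -/
theorem exists_nonlinearSolution (hS : X.IsSmoothingSemigroup S A) [CompleteSpace E]
    (hσ : X.IsAdmissibleNonlinearity σ α ω) (hω : 1 ≤ ω) (he : IsExponentTriple η α ρ)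
    (hγ : 0 ≤ γ) (hγα : γ ≤ α) (hγη : (1 + ω) * γ < η - α) (hH : 0 ≤ H)
    (hx : ∀ r q, 0 ≤ r → r ≤ q → q ≤ 1 → |x q - x r| ≤ H * (q - r) ^ η) {w₀ : E} {U : ℝ}
    (hU : X.NormLE (α - γ) w₀ U) : ∃ y : ℝ → E, y 0 = w₀ ∧
      X.NonlinearSolution S σ x α ρ γ 1 y := by
  have hγη' : γ < η - α := lt_of_le_of_lt (by nlinarith) hγη
  obtain ⟨τ₁, hτ₁, R₁, hR₁, h₁⟩ :=
    hS.exists_solution_local hσ hω he hγ hγα hγη hH hx hU.nonneg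
  obtain ⟨R, hR, hglob⟩ := hS.exists_value_bound_global hσ he hγ hγα hγη' hH hx hU.nonneg
  have hτ₁0 := hτ₁.1
  -- From time `τ₁` on the global a priori bound gives one `X_α` bound for all restart values, hence
  -- one step length `τ₂`.
  obtain ⟨τ₂, hτ₂, R₂, hR₂, h₂⟩ :=
    hS.exists_solution_local (γ := 0) (U := R * τ₁ ^ (-γ)) hσ hω he le_rfl (by linarith)
      (by linarith) hH hx (by positivity)
  obtain ⟨K, hK, hK'⟩ := PathBound.exists_forcingBound X (show 0 ≤ α by linarith)
    (show α < 2 by linarith [he.lt, he.lt_one])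
  have hstep : ∀ n : ℕ, ∃ y : ℝ → E, y 0 = w₀ ∧
      X.NonlinearSolution S σ x α ρ γ (min (τ₁ + n * τ₂) 1) y := by
    intro n
    induction n with
    | zero =>
      rw [Nat.cast_zero, zero_mul, add_zero, min_eq_left hτ₁.2]
      obtain ⟨y, hy0, hysol, hyb⟩ := h₁ 0 τ₁ le_rfl hτ₁0 hτ₁.2 (by linarith) w₀ hU
      exact ⟨y, hy0, hysol, K * R₁, by positivity,
        hK' ρ γ γ 0 τ₁ R₁ y le_rfl (by linarith [hτ₁.2]) hR₁ hyb⟩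
    | succ n ih =>
      obtain ⟨y, hy0, hy⟩ := ih
      have hn : (0 : ℝ) ≤ n := Nat.cast_nonneg n
      have hnτ : 0 ≤ n * τ₂ := mul_nonneg hn hτ₂.1.le
      by_cases h1 : 1 ≤ τ₁ + n * τ₂
      · refine ⟨y, hy0, ?_⟩
        rw [min_eq_right h1] at hy
        rwa [min_eq_right]
        push_cast
        linarith [hτ₂.1]
      push Not at h1
      rw [min_eq_left h1.le] at hy
      set c := τ₁ + n * τ₂ with hc
      set d := min (τ₁ + (n + 1 : ℕ) * τ₂) 1 with hd
      have hd1 : d ≤ 1 := min_le_right _ _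
      have hd2 : d ≤ c + τ₂ := (min_le_left _ _).trans (le_of_eq (by push_cast; ring))
      have hc0 : 0 < c := by linarith
      have hcd : c < d := lt_min (by push_cast; linarith [hτ₂.1]) h1
      have hyc : X.NormLE α (y c) (R * τ₁ ^ (-γ)) := by
        refine (hglob c ⟨hc0, h1.le⟩ y hy (by rwa [hy0]) c ⟨hc0, le_rfl⟩).mono ?_
        have : c ^ (-γ) ≤ τ₁ ^ (-γ) :=
          Real.rpow_le_rpow_of_nonpos hτ₁0 (by linarith) (by linarith)
        gcongr
      obtain ⟨z, hzc, hz, hzb⟩ := h₂ c d hc0.le hcd hd1 (by linarith) (y c) (by rwa [sub_zero])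
      refine ⟨_, ?_, hS.nonlinearSolution_extend hσ he hγ hH hx hc0 hcd hd1 hR₂ hy hzc hz hzb
        (by rw [hzc]; exact hyc)⟩
      rw [if_pos hc0.le, hy0]
  obtain ⟨n, hn⟩ := exists_nat_ge (1 / τ₂)
  rw [div_le_iff₀ hτ₂.1] at hn
  obtain ⟨y, hy0, hy⟩ := hstep n
  rw [min_eq_right (by linarith)] at hy
  exact ⟨y, hy0, hy⟩

end IsSmoothingSemigroup

end BanachScale

/-! ### Regularity estimates for solutions -/

namespace BanachScale.IsSmoothingSemigroup

variable {E : Type u} [NormedAddCommGroup E] [NormedSpace ℝ E] {X : BanachScale.{u, v} E}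
  {S : ℝ → E →L[ℝ] E} {A : E →ₗ.[ℝ] E} {σ : E → E} {η α ρ γ ω H : ℝ} {x : ℝ → ℝ}

/-- Once `y` is known to be `α`-Hölder in `E`, the forcing improves from order `ρ` with weight `γ +
ρ` to order `α` with weight `γ`. -/
theorem exists_hatDeltaOne_comp (hS : X.IsSmoothingSemigroup S A)
    (hσ : X.IsAdmissibleNonlinearity σ α ω) (hα : 0 < α) (hα1 : α ≤ 1) (hγ : 0 ≤ γ) :
    ∃ C : ℝ, 1 ≤ C ∧ ∀ (y : ℝ → E) (R : ℝ), 1 ≤ R →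
      (∀ t ∈ Ioc (0 : ℝ) 1, X.NormLE α (y t) (R * t ^ (-γ))) →
      (∀ s t, 0 < s → s < t → t ≤ 1 → ‖y t - y s‖ ≤ R * (t - s) ^ α * s ^ (-γ)) →
      ∀ s t, 0 < s → s ≤ t → t ≤ 1 →
        ‖hatDeltaOne S (fun r => σ (y r)) s t‖ ≤ C * R * s ^ (-γ) * (t - s) ^ α := by
  obtain ⟨L, hL1, hL⟩ := hσ.exists_lipschitz
  obtain ⟨G, hG1, hG⟩ := hσ.exists_growth
  obtain ⟨D, hD1, hD⟩ := hS.exists_norm_sub_le hα hα1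
  refine ⟨L + D * (G * 2), by nlinarith, fun y R hR hyα hy s t hs hst ht => ?_⟩
  have hsγ := one_le_rpow_neg hs (hst.trans ht) hγ
  rcases hst.eq_or_lt with rfl | hst'
  · rw [hS.hatDeltaOne_self, norm_zero]
    have := Real.rpow_nonneg (sub_nonneg.2 (le_refl s)) α
    positivity
  have hts : 0 ≤ t - s := by linarith
  have e : hatDeltaOne S (fun r => σ (y r)) s t
      = (σ (y t) - σ (y s)) - (S (t - s) (σ (y s)) - σ (y s)) := by
    rw [hatDeltaOne]; abel
  have h1 : ‖σ (y t) - σ (y s)‖ ≤ L * (R * (t - s) ^ α * s ^ (-γ)) :=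
    (hL _ _).trans (by gcongr; exact hy s t hs hst' ht)
  have h2 := hD (t - s) ⟨hts, by linarith⟩ _ _ (hG _ _ (hyα s ⟨hs, hst.trans ht⟩))
  have h3 : 1 ≤ R * s ^ (-γ) := by nlinarith
  have h4 : D * (t - s) ^ α * (G * (1 + R * s ^ (-γ)))
      ≤ D * (t - s) ^ α * (G * (2 * (R * s ^ (-γ)))) := by
    have := Real.rpow_nonneg hts α
    gcongr
    linarith
  rw [e]
  refine (norm_sub_le _ _).trans ((add_le_add h1 (h2.trans h4)).trans (le_of_eq ?_))
  ring

/-- Sewing is repeated with Hölder exponent `α` in place of `ρ`, which opens the whole range `l < η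
+ α`. The remainder then has the better order; the full increment is limited by the germ. -/
theorem exists_increment_bounds (hS : X.IsSmoothingSemigroup S A)
    (hσ : X.IsAdmissibleNonlinearity σ α ω) (he : IsExponentTriple η α ρ) (hγ : 0 ≤ γ)
    (hγα : γ ≤ α) (hγη : γ < η - α) (hH : 0 ≤ H)
    (hx : ∀ r q, 0 ≤ r → r ≤ q → q ≤ 1 → |x q - x r| ≤ H * (q - r) ^ η) {U : ℝ} (hU : 0 ≤ U)
    {l : ℝ} (hl0 : 0 ≤ l) (hl : l < 2) (hlη : l < η + α) :
    ∃ C : ℝ, 1 ≤ C ∧ ∀ y : ℝ → E, X.NonlinearSolution S σ x α ρ γ 1 y →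
      X.NormLE (α - γ) (y 0) U → ∀ s t, 0 < s → s < t → t ≤ 1 →
        X.NormLE l (germRemainder S x y (fun r => σ (y r)) s t)
          (C * s ^ (-γ) * (t - s) ^ (η + α - l)) ∧
        X.NormLE l (hatDeltaOne S y s t) (C * s ^ (-γ) * (t - s) ^ (η - max (l - α) 0)) := by
  have hα : 0 < α := he.pos.trans_le he.le
  have hα1 : α ≤ 1 := by linarith [he.lt, he.lt_one]
  obtain ⟨R, hR1, hR⟩ := hS.exists_bounds_global hσ he hγ hγα hγη hH hx hU
  obtain ⟨C₁, hC₁, h₁⟩ := hS.exists_hatDeltaOne_comp hσ hα hα1 hγ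
  obtain ⟨C₂, hC₂, h₂⟩ := hS.exists_sewing (show 1 < η + α by linarith [he.one_lt, he.le]) hl0 hl
    hlη
  obtain ⟨C₃, hC₃, h₃⟩ := hS.exists_germ hα.le (by linarith) hl0 hl
  obtain ⟨G, hG1, hG⟩ := hσ.exists_growth
  refine ⟨C₂ * (H * (C₁ * R)) + C₃ * (H * (G * (2 * R))) + 1, ?_, fun y hy hyU s t hs hst ht => ?_⟩
  · have : 0 ≤ C₂ * (H * (C₁ * R)) + C₃ * (H * (G * (2 * R))) := by positivity
    linarith
  obtain ⟨hyα, hyi⟩ := hR 1 ⟨one_pos, le_rfl⟩ y hy hyU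
  have hts : 0 < t - s := by linarith
  have hsγ := one_le_rpow_neg hs (hst.le.trans ht) hγ
  have hφ : ∀ r q, s ≤ r → r ≤ q → q ≤ t → ‖hatDeltaOne S (fun r => σ (y r)) r q‖
      ≤ C₁ * R * s ^ (-γ) * (q - r) ^ α := fun r q h1 h2 h3 => by
    refine (h₁ y R hR1 hyα hyi r q (by linarith) h2 (by linarith)).trans ?_
    have := Real.rpow_nonneg (sub_nonneg.2 h2) α
    have := Real.rpow_le_rpow_of_nonpos hs h1 (show -γ ≤ 0 by linarith)
    gcongr
  have hrem := h₂ x y _ s t H (C₁ * R * s ^ (-γ)) hH (by positivity) hst (by linarith)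
    (fun r q h1 h2 h3 => hx r q (by linarith) h2 (by linarith)) hφ
    ((hy.sol.1 s ⟨hs, by linarith⟩).mono le_rfl ht)
  have hE : C₂ * (H * (C₁ * R * s ^ (-γ))) = C₂ * (H * (C₁ * R)) * s ^ (-γ) := by ring
  rw [hE] at hrem
  have hpow := Real.rpow_nonneg hts.le (η + α - l)
  have hpow' := Real.rpow_nonneg hts.le (η - max (l - α) 0)
  have hpos : 0 ≤ C₃ * (H * (G * (2 * R))) := by positivity
  refine ⟨hrem.mono (by gcongr; linarith), ?_⟩
  have hgerm : X.NormLE l (S (t - s) ((x t - x s) • σ (y s)))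
      (C₃ * (H * (G * (2 * R))) * s ^ (-γ) * (t - s) ^ (η - max (l - α) 0)) := by
    refine (h₃ (t - s) ⟨hts, by linarith⟩ _ _
      ((hG _ _ (hyα s ⟨hs, by linarith⟩)).smul (x t - x s))).mono ?_
    have h3 : 1 ≤ R * s ^ (-γ) := by nlinarith
    have hxts := hx s t hs.le hst.le ht
    calc C₃ * (t - s) ^ (-max (l - α) 0) * (|x t - x s| * (G * (1 + R * s ^ (-γ))))
        ≤ C₃ * (t - s) ^ (-max (l - α) 0) * (H * (t - s) ^ η * (G * (2 * (R * s ^ (-γ))))) := by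
          gcongr
          linarith
      _ = C₃ * (H * (G * (2 * R))) * s ^ (-γ)
            * ((t - s) ^ η * (t - s) ^ (-max (l - α) 0)) := by ring
      _ = _ := by rw [← Real.rpow_add hts, ← sub_eq_add_neg]
  have hsum := hrem.add hgerm
  have e : germRemainder S x y (fun r => σ (y r)) s t + S (t - s) ((x t - x s) • σ (y s))
      = hatDeltaOne S y s t := by rw [germRemainder, sub_add_cancel]
  rw [e] at hsum
  refine hsum.mono ?_
  have hexp : (t - s) ^ (η + α - l) ≤ (t - s) ^ (η - max (l - α) 0) :=
    Real.rpow_le_rpow_of_exponent_ge hts (by linarith) (by linarith [le_max_left (l - α) 0])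
  have hA : 0 ≤ C₂ * (H * (C₁ * R)) := by positivity
  calc _ ≤ C₂ * (H * (C₁ * R)) * s ^ (-γ) * (t - s) ^ (η - max (l - α) 0)
        + C₃ * (H * (G * (2 * R))) * s ^ (-γ) * (t - s) ^ (η - max (l - α) 0) := by gcongr
    _ = (C₂ * (H * (C₁ * R)) + C₃ * (H * (G * (2 * R)))) * s ^ (-γ)
        * (t - s) ^ (η - max (l - α) 0) := by ring
    _ ≤ _ := mul_le_mul_of_nonneg_right
        (mul_le_mul_of_nonneg_right (by linarith) (by positivity)) hpow'

/-- On intervals no longer than their distance from `0` the weight `p^{-γ}` is absorbed by the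
length. The resulting exponent `η - γ` exceeds `α`, as membership in the space `Y` requires. -/
theorem exists_hatDeltaOne_bound (hS : X.IsSmoothingSemigroup S A)
    (hσ : X.IsAdmissibleNonlinearity σ α ω) (he : IsExponentTriple η α ρ) (hγ : 0 ≤ γ)
    (hγα : γ ≤ α) (hγη : γ < η - α) (hH : 0 ≤ H)
    (hx : ∀ r q, 0 ≤ r → r ≤ q → q ≤ 1 → |x q - x r| ≤ H * (q - r) ^ η) {U : ℝ} (hU : 0 ≤ U) :
    ∃ C : ℝ, 1 ≤ C ∧ ∀ y : ℝ → E, X.NonlinearSolution S σ x α ρ γ 1 y →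
      X.NormLE (α - γ) (y 0) U → ∀ s t, 0 ≤ s → s < t → t ≤ 1 →
        X.NormLE α (hatDeltaOne S y s t) (C * (t - s) ^ (η - γ)) := by
  have hα : 0 < α := he.pos.trans_le he.le
  have hαη := he.lt
  have hη1 := he.lt_one
  obtain ⟨C, hC1, hC⟩ := hS.exists_increment_bounds hσ he hγ hγα hγη hH hx hU hα.le
    (show α < 2 by linarith) (by linarith)
  obtain ⟨K, hK1, hK⟩ := hS.exists_dyadic_bound_of_le (l := α) (κ := η - γ) (η := η) hα.le
    (by linarith) (by linarith) (by linarith)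
  refine ⟨K * C, by nlinarith, fun y hy hyU s t hs hst ht => ?_⟩
  refine hK x y _ 0 1 C H (by norm_num) hx hy.sol (by linarith) (fun p q hp hpq hq hqp => ?_)
    s t hs hst ht
  have := (hC y hy hyU p q hp hpq hq).2
  rw [sub_self, max_self, sub_zero] at this
  refine this.mono ?_
  have hqp0 : 0 < q - p := by linarith
  have h1 := Real.rpow_le_rpow_of_nonpos hqp0 (show q - p ≤ p by linarith)
    (show -γ ≤ 0 by linarith)
  calc C * p ^ (-γ) * (q - p) ^ η ≤ C * (q - p) ^ (-γ) * (q - p) ^ η := by gcongr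
    _ = C * ((q - p) ^ η * (q - p) ^ (-γ)) := by ring
    _ = _ := by rw [← Real.rpow_add hqp0, ← sub_eq_add_neg]

/-- Restart at `t/2`: smoothing of `y(t/2)` from `X_α` to `X_l` costs `t^{α-l}` on top of `t^{-γ}`.
For `γ = α - θ` and `l = 1 + μ` the total exponent is `θ - 1 - μ`. -/
theorem exists_smooth_value_bound (hS : X.IsSmoothingSemigroup S A)
    (hσ : X.IsAdmissibleNonlinearity σ α ω) (he : IsExponentTriple η α ρ) (hγ : 0 ≤ γ)
    (hγα : γ ≤ α) (hγη : γ < η - α) (hH : 0 ≤ H)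
    (hx : ∀ r q, 0 ≤ r → r ≤ q → q ≤ 1 → |x q - x r| ≤ H * (q - r) ^ η) {U : ℝ} (hU : 0 ≤ U)
    {l : ℝ} (hlα : α ≤ l) (hl : l < 2) (hlη : l < η + α) :
    ∃ C : ℝ, 1 ≤ C ∧ ∀ y : ℝ → E, X.NonlinearSolution S σ x α ρ γ 1 y →
      X.NormLE (α - γ) (y 0) U → ∀ t ∈ Ioc (0 : ℝ) 1, X.NormLE l (y t) (C * t ^ (α - γ - l)) := by
  have hα : 0 < α := he.pos.trans_le he.le
  have hαη := he.lt
  have hη1 := he.lt_one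
  obtain ⟨C, hC1, hC⟩ := hS.exists_increment_bounds hσ he hγ hγα hγη hH hx hU
    (hα.le.trans hlα) hl hlη
  obtain ⟨R, hR1, hR⟩ := hS.exists_bounds_global hσ he hγ hγα hγη hH hx hU
  obtain ⟨L, hL1, hL⟩ := hS.exists_smoothing hα.le hlα hl
  refine ⟨(C + L * R) * (1 / 2) ^ (α - γ - l), ?_, fun y hy hyU t ht => ?_⟩
  · have := one_le_rpow_neg (show (0 : ℝ) < 1 / 2 by norm_num) (by norm_num)
      (show 0 ≤ -(α - γ - l) by linarith)
    rw [neg_neg] at this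
    have : 0 ≤ L * R := by positivity
    exact one_le_mul_of_one_le_of_one_le (by linarith) ‹_›
  have ht0 := ht.1
  have ht2 : 0 < t / 2 := by linarith
  have htt : t - t / 2 = t / 2 := by ring
  have h1 := (hC y hy hyU (t / 2) t ht2 (by linarith) ht.2).2
  have h2 := hL (t / 2) ⟨ht2, by linarith [ht.2]⟩ _ _
    ((hR 1 ⟨one_pos, le_rfl⟩ y hy hyU).1 (t / 2) ⟨ht2, by linarith [ht.2]⟩)
  have e := add_hatDeltaOne S y (t / 2) t
  rw [htt] at e h1
  rw [max_eq_left (by linarith)] at h1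
  rw [← e]
  refine (h1.add h2).mono ?_
  have e1 : (t / 2) ^ (-γ) * (t / 2) ^ (η - (l - α)) ≤ (t / 2) ^ (α - γ - l) := by
    rw [← Real.rpow_add ht2]
    exact Real.rpow_le_rpow_of_exponent_ge ht2 (by linarith [ht.2]) (by linarith)
  have e2 : (t / 2) ^ (α - l) * (t / 2) ^ (-γ) = (t / 2) ^ (α - γ - l) := by
    rw [← Real.rpow_add ht2]; ring_nf
  have e3 : (t / 2) ^ (α - γ - l) = (1 / 2) ^ (α - γ - l) * t ^ (α - γ - l) := by
    rw [← Real.mul_rpow (by norm_num) ht0.le]; ring_nf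
  calc C * (t / 2) ^ (-γ) * (t / 2) ^ (η - (l - α)) + L * (t / 2) ^ (α - l) * (R * (t / 2) ^ (-γ))
      = C * ((t / 2) ^ (-γ) * (t / 2) ^ (η - (l - α)))
        + L * R * ((t / 2) ^ (α - l) * (t / 2) ^ (-γ)) := by ring
    _ ≤ C * (t / 2) ^ (α - γ - l) + L * R * (t / 2) ^ (α - γ - l) := by rw [e2]; gcongr
    _ = _ := by rw [e3]; ring

/-- Local Hölder continuity of a path in the smoother spaces, from bounds on its mild increments. -/
theorem exists_smooth_increment_bound (hS : X.IsSmoothingSemigroup S A) {l δ N : ℝ} {y : ℝ → E}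
    (hα : 0 ≤ α) (hα1 : α ≤ 1) (hη : η < 1) (hlα : α ≤ l) (hl : l < 2) (hlη : l < η + α)
    (hδ : 0 < δ) (hN : 0 ≤ N) (hyα : ∀ t ∈ Icc δ 1, X.NormLE α (y t) N)
    (hyl : ∀ t ∈ Icc δ 1, X.NormLE l (y t) N)
    (hdα : ∀ s t, δ ≤ s → s < t → t ≤ 1 → X.NormLE α (hatDeltaOne S y s t) (N * (t - s) ^ η))
    (hdl : ∀ s t, δ ≤ s → s < t → t ≤ 1 →
      X.NormLE l (hatDeltaOne S y s t) (N * (t - s) ^ (η + α - l))) :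
    ∃ C : ℝ, 0 ≤ C ∧ ∀ s t, 2 * δ ≤ s → s < t → t ≤ 1 →
      X.NormLE l (y t - y s) (C * (t - s) ^ (η + α - l)) := by
  have hl0 : 0 ≤ l := hα.trans hlα
  set κ := η + α - l with hκ
  have hκ0 : 0 < κ := by linarith
  have hη0 : 0 < η := by linarith
  obtain ⟨C, hC1, hC⟩ := hS.exists_approx_smoothing hα hα1 hl0 hl
  obtain ⟨L, hL1, hL⟩ := hS.exists_bound hl0 hl
  set q : ℝ := 2 ^ (κ - 1) with hq
  have hq1 : q < 1 := Real.rpow_lt_one_of_one_lt_of_neg (by norm_num) (by linarith)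
  have hq0 : 0 < q := by positivity
  set D := C * N * (δ / 2) ^ (-η) + C * N / (1 - q) with hD
  have h1q : 0 < 1 - q := by linarith
  have hD0 : 0 ≤ D := by positivity
  -- Here `q` is the factor gained by `τ^{κ-1}` when `τ` is doubled, less than one as `κ < 1`; `D`
  -- is chosen so that the doubling induction closes.
  have hDq : D * q + C * N ≤ D := by
    have h1 : C * N / (1 - q) * (1 - q) = C * N := div_mul_cancel₀ _ h1q.ne'
    have h2 : 0 ≤ C * N * (δ / 2) ^ (-η) * (1 - q) := by positivity
    have h3 : D * (1 - q) = C * N * (δ / 2) ^ (-η) * (1 - q) + C * N := by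
      rw [hD, add_mul, h1]
    nlinarith
  -- The past is unrolled by `S(τ)y(s-τ) = S(τ)δ̂₁y(s-2τ,s-τ) + S(2τ)y(s-2τ)`, doubling the lag
  -- until it exceeds `δ/2`. Each increment has size `τ^η` in `X_α` and contributes `h τ^{κ-1}`
  -- after `(S(h) - I)S(τ)`. This works even for `l ≥ 1`, where the direct bound on `S(h) - I` is
  -- not available.
  have hQ : ∀ n : ℕ, ∀ s h τ, 2 * δ ≤ s → s ≤ 1 → 0 ≤ h → h ≤ 1 → 0 < τ → τ ≤ δ →
      δ < 2 ^ n * τ * 2 →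
      X.NormLE l (S h (S τ (y (s - τ))) - S τ (y (s - τ))) (D * h * τ ^ (κ - 1)) := by
    intro n
    have hbase : ∀ s h τ, 2 * δ ≤ s → s ≤ 1 → 0 ≤ h → h ≤ 1 → 0 < τ → τ ≤ δ → δ < τ * 2 →
        X.NormLE l (S h (S τ (y (s - τ))) - S τ (y (s - τ))) (D * h * τ ^ (κ - 1)) := by
      intro s h τ hs hs1 hh hh1 hτ hτδ hδτ
      refine (hC h ⟨hh, hh1⟩ τ ⟨hτ, by linarith⟩ _ _
        (hyα (s - τ) ⟨by linarith, by linarith⟩)).mono ?_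
      have e1 : τ ^ (α - 1 - l) = τ ^ (κ - 1) * τ ^ (-η) := by
        rw [← Real.rpow_add hτ, hκ]; ring_nf
      have e2 : τ ^ (-η) ≤ (δ / 2) ^ (-η) :=
        Real.rpow_le_rpow_of_nonpos (by positivity) (by linarith) (by linarith)
      have e3 : C * N * (δ / 2) ^ (-η) ≤ D := by
        have : 0 ≤ C * N / (1 - q) := by positivity
        rw [hD]; linarith
      calc C * h * τ ^ (α - 1 - l) * N = C * N * τ ^ (-η) * h * τ ^ (κ - 1) := by rw [e1]; ring
        _ ≤ C * N * (δ / 2) ^ (-η) * h * τ ^ (κ - 1) := by gcongr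
        _ ≤ _ := by gcongr
    induction n with
    | zero =>
      intro s h τ hs hs1 hh hh1 hτ hτδ hδτ
      exact hbase s h τ hs hs1 hh hh1 hτ hτδ (by simpa using hδτ)
    | succ n ih =>
      intro s h τ hs hs1 hh hh1 hτ hτδ hδτ
      rcases lt_or_ge δ (τ * 2) with h2 | h2
      · exact hbase s h τ hs hs1 hh hh1 hτ hτδ h2
      have hI := ih s h (τ * 2) hs hs1 hh hh1 (by linarith) h2 (by rw [pow_succ] at hδτ; linarith)
      have hd := hdα (s - τ * 2) (s - τ) (by linarith) (by linarith) (by linarith)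
      have hts : s - τ - (s - τ * 2) = τ := by ring
      have e0 := add_hatDeltaOne S y (s - τ * 2) (s - τ)
      rw [hts] at e0 hd
      have hJ := hC h ⟨hh, hh1⟩ τ ⟨hτ, by linarith⟩ _ _ hd
      have e1 : S τ (y (s - τ)) = S τ (hatDeltaOne S y (s - τ * 2) (s - τ))
          + S (τ * 2) (y (s - τ * 2)) := by
        rw [← e0, map_add, hS.apply_apply hτ.le hτ.le, mul_two]
      rw [e1, map_add, add_sub_add_comm]
      refine (hJ.add hI).mono ?_
      have e2 : τ ^ (α - 1 - l) * τ ^ η = τ ^ (κ - 1) := by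
        rw [← Real.rpow_add hτ, hκ]; ring_nf
      have e3 : (τ * 2) ^ (κ - 1) = τ ^ (κ - 1) * q := Real.mul_rpow hτ.le (by norm_num)
      calc C * h * τ ^ (α - 1 - l) * (N * τ ^ η) + D * h * (τ * 2) ^ (κ - 1)
          = C * N * h * (τ ^ (α - 1 - l) * τ ^ η) + D * h * (τ * 2) ^ (κ - 1) := by ring
        _ = (D * q + C * N) * h * τ ^ (κ - 1) := by rw [e2, e3]; ring
        _ ≤ _ := by gcongr
  -- In order: the mild increment over `[s,t]`, the unrolled past, `S(t-s) - I` acting on the last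
  -- increment before `s`, and the trivial bound for `t - s > δ`.
  refine ⟨N + D + (L + 1) * N + 2 * N * δ ^ (-κ), by positivity, fun s t hs hst ht => ?_⟩
  have hts : 0 < t - s := by linarith
  have hδκ : 0 ≤ 2 * N * δ ^ (-κ) := by positivity
  rcases lt_or_ge δ (t - s) with hbig | hsmall
  · refine ((hyl t ⟨by linarith, ht⟩).sub (hyl s ⟨by linarith, by linarith⟩)).mono ?_
    have h1 : 1 ≤ δ ^ (-κ) * (t - s) ^ κ := by
      rw [Real.rpow_neg hδ.le, ← div_eq_inv_mul, one_le_div (by positivity)]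
      gcongr
    have h2 : 0 ≤ (N + D + (L + 1) * N) * (t - s) ^ κ := by positivity
    nlinarith
  obtain ⟨n, hn⟩ := pow_unbounded_of_one_lt (δ / (t - s)) (one_lt_two (α := ℝ))
  rw [div_lt_iff₀ hts] at hn
  have hQ1 := hQ n s (t - s) (t - s) hs (by linarith) hts.le (by linarith) hts hsmall
    (by have : 0 < 2 ^ n * (t - s) := by positivity
        linarith)
  have hd1 := hdl s t (by linarith) hst ht
  have hd2 := hdl (s - (t - s)) s (by linarith) (by linarith) (by linarith)
  have e0 := add_hatDeltaOne S y (s - (t - s)) s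
  rw [sub_sub_cancel] at hd2 e0
  have hd3 := (hL (t - s) ⟨hts.le, by linarith⟩ _ _ hd2).sub hd2
  -- The value `y(s)` is rewritten with lag `t - s`, so that `S(t-s) - I` falls mostly on a smoothed
  -- term, with `h = τ = t - s`.
  have e1 : y t - y s = hatDeltaOne S y s t
      + ((S (t - s) (S (t - s) (y (s - (t - s)))) - S (t - s) (y (s - (t - s))))
      + (S (t - s) (hatDeltaOne S y (s - (t - s)) s) - hatDeltaOne S y (s - (t - s)) s)) := by
    rw [sub_eq_hatDeltaOne_add S y s t]
    congr 1
    nth_rewrite 1 2 [← e0]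
    rw [map_add]
    abel
  rw [e1]
  refine (hd1.add (hQ1.add hd3)).mono ?_
  have e2 : D * (t - s) * (t - s) ^ (κ - 1) = D * (t - s) ^ κ := by
    rw [Real.rpow_sub_one hts.ne']; field_simp
  rw [e2]
  have : 0 ≤ 2 * N * δ ^ (-κ) * (t - s) ^ κ := by positivity
  linarith

end BanachScale.IsSmoothingSemigroup

/-! ### Continuity and local Hölder continuity in the scale -/

namespace BanachScale

variable {E : Type u} [NormedAddCommGroup E] [NormedSpace ℝ E] {X : BanachScale.{u, v} E}
  {S : ℝ → E →L[ℝ] E} {A : E →ₗ.[ℝ] E} {P : Type*} [TopologicalSpace P] {D : Set P} {l : ℝ}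
  {f g : P → E} {p : P}

theorem LocHolder.contOn {r : ℝ} (hr : 0 < r) {f : ℝ → E} (h : X.LocHolder l r f) :
    X.ContOn l (Ioc (0 : ℝ) 1) f := by
  obtain ⟨g, hg, hC⟩ := h
  refine ⟨g, fun t ht => ?_, hg⟩
  obtain ⟨C, hC⟩ := hC (t / 2) ⟨by linarith [ht.1], by linarith [ht.1, ht.2]⟩
  have h1 := (hC.continuousOn (Real.toNNReal_pos.2 hr)) t ⟨by linarith [ht.1], ht.2⟩
  refine h1.mono_of_mem_nhdsWithin ?_
  filter_upwards [self_mem_nhdsWithin, nhdsWithin_le_nhds (Ioi_mem_nhds (half_lt_self ht.1))]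
    with q hq hq'
  exact ⟨le_of_lt hq', hq.2⟩

theorem LocHolder.embed {b l r : ℝ} (hb : 0 ≤ b) (hbl : b ≤ l) (hl : l < 2) {f : ℝ → E}
    (h : X.LocHolder l r f) : X.LocHolder b r f := by
  rcases hbl.eq_or_lt with rfl | hbl
  · exact h
  obtain ⟨g, hg, hC⟩ := h
  obtain ⟨j, hj⟩ := X.embed b ⟨hb, hbl.trans hl⟩ l ⟨hb.trans hbl.le, hl⟩ hbl
  refine ⟨fun t => j (g t), fun t ht => by rw [hj, hg t ht], fun ε hε => ?_⟩
  obtain ⟨C, hC⟩ := hC ε hε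
  refine ⟨‖j‖₊ * C, ?_⟩
  have h1 : HolderOnWith (‖j‖₊ * C ^ ((1 : NNReal) : ℝ)) (1 * r.toNNReal) (j ∘ g) (Icc ε 1) :=
    j.lipschitz.holderWith.comp_holderOnWith hC
  rw [NNReal.coe_one, NNReal.rpow_one, one_mul] at h1
  exact h1

theorem locHolder_of_normLE (hl : l ∈ Ico (0 : ℝ) 2) {r : ℝ} (hr : 0 < r) {f : ℝ → E}
    (h1 : ∀ t ∈ Ioc (0 : ℝ) 1, ∃ c, X.NormLE l (f t) c)
    (h2 : ∀ ε ∈ Ioc (0 : ℝ) 1, ∃ C, 0 ≤ C ∧ ∀ s t, ε ≤ s → s < t → t ≤ 1 →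
      X.NormLE l (f t - f s) (C * (t - s) ^ r)) : X.LocHolder l r f := by
  have hex : ∀ t, ∃ w : X.Sp l, t ∈ Ioc (0 : ℝ) 1 → X.incl l w = f t := by
    intro t
    by_cases ht : t ∈ Ioc (0 : ℝ) 1
    · obtain ⟨c, w, hw, -⟩ := h1 t ht
      exact ⟨w, fun _ => hw⟩
    · exact ⟨0, fun h => absurd h ht⟩
  choose g hg using hex
  refine ⟨g, fun t ht => hg t ht, fun ε hε => ?_⟩
  obtain ⟨C, hC0, hC⟩ := h2 ε hε
  have key : ∀ s ∈ Icc ε 1, ∀ t ∈ Icc ε 1, s < t → edist (g s) (g t)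
      ≤ (C.toNNReal : ENNReal) * edist s t ^ (r.toNNReal : ℝ) := by
    intro s hs t ht hst
    have h := hC s t hs.1 hst ht.2
    rw [← hg t ⟨hε.1.trans_le ht.1, ht.2⟩, ← hg s ⟨hε.1.trans_le hs.1, hs.2⟩, ← map_sub,
      normLE_incl_iff hl] at h
    rw [edist_comm (g s), edist_comm s, edist_dist, edist_dist, dist_eq_norm, Real.dist_eq,
      abs_of_pos (by linarith), Real.coe_toNNReal r hr.le,
      ENNReal.ofReal_rpow_of_nonneg (by linarith) hr.le,
      show (C.toNNReal : ENNReal) = ENNReal.ofReal C from rfl, ← ENNReal.ofReal_mul hC0]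
    exact ENNReal.ofReal_le_ofReal h
  refine ⟨C.toNNReal, fun s hs t ht => ?_⟩
  rcases lt_trichotomy s t with hst | rfl | hst
  · exact key s hs t ht hst
  · simp
  · rw [edist_comm (g s), edist_comm s]
    exact key t ht s hs hst

/-- Continuity of `f` within `D` at `p`, measured in `X_l`. -/
def ContAt (X : BanachScale.{u, v} E) (l : ℝ) (D : Set P) (f : P → E) (p : P) : Prop :=
  ∀ ε > 0, ∀ᶠ q in 𝓝[D] p, X.NormLE l (f q - f p) ε

theorem ContOn.continuousOn (h : X.ContOn l D f) : ContinuousOn f D := by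
  obtain ⟨g, hg, hgf⟩ := h
  exact ((X.incl l).continuous.comp_continuousOn hg).congr fun q hq => (hgf q hq).symm

theorem ContOn.embed {b : ℝ} (hb : 0 ≤ b) (hbl : b ≤ l) (hl : l < 2) (h : X.ContOn l D f) :
    X.ContOn b D f := by
  rcases hbl.eq_or_lt with rfl | hbl
  · exact h
  obtain ⟨g, hg, hgf⟩ := h
  obtain ⟨j, hj⟩ := X.embed b ⟨hb, hbl.trans hl⟩ l ⟨hb.trans hbl.le, hl⟩ hbl
  exact ⟨fun q => j (g q), j.continuous.comp_continuousOn hg,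
    fun q hq => by rw [hj, hgf q hq]⟩

theorem ContAt.add (hf : X.ContAt l D f p) (hg : X.ContAt l D g p) :
    X.ContAt l D (fun q => f q + g q) p := fun ε hε => by
  filter_upwards [hf (ε / 2) (half_pos hε), hg (ε / 2) (half_pos hε)] with q h1 h2
  have := h1.add h2
  rwa [add_halves, sub_add_sub_comm] at this

theorem ContAt.neg (hf : X.ContAt l D f p) : X.ContAt l D (fun q => -f q) p := fun ε hε => by
  filter_upwards [hf ε hε] with q h1
  simpa only [neg_sub_neg, neg_sub] using h1.neg

theorem ContAt.sub (hf : X.ContAt l D f p) (hg : X.ContAt l D g p) :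
    X.ContAt l D (fun q => f q - g q) p := by
  simpa only [sub_eq_add_neg] using hf.add hg.neg

theorem ContAt.congr (hf : X.ContAt l D f p) (hfg : ∀ q ∈ D, g q = f q) (hp : p ∈ D) :
    X.ContAt l D g p := fun ε hε => by
  filter_upwards [hf ε hε, self_mem_nhdsWithin] with q h1 hq
  rwa [hfg q hq, hfg p hp]

theorem contAt_of_normLE_rpow {K r : ℝ} {a : P → ℝ} (ha : ContinuousWithinAt a D p) (hr : 0 < r)
    (hap : a p = 0) (hfp : f p = 0) (hf : ∀ᶠ q in 𝓝[D] p, X.NormLE l (f q) (K * a q ^ r)) :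
    X.ContAt l D f p := fun ε hε => by
  have h1 : Tendsto (fun q => K * a q ^ r) (𝓝[D] p) (𝓝 (K * a p ^ r)) :=
    (ha.tendsto.rpow_const (Or.inr hr.le)).const_mul K
  rw [hap, Real.zero_rpow hr.ne', mul_zero] at h1
  filter_upwards [h1.eventually_lt_const hε, hf] with q hq hfq
  rw [hfp, sub_zero]
  exact hfq.mono hq.le

namespace IsSmoothingSemigroup

/-- Strong continuity at time `0` is not assumed, but at positive times smoothing makes `t ↦ S(t)w`
Lipschitz in every `X_l`. -/
theorem exists_time_lipschitz (hS : X.IsSmoothingSemigroup S A) (hl0 : 0 ≤ l) (hl : l < 2) :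
    ∃ C : ℝ, 1 ≤ C ∧ ∀ m ∈ Ioc (0 : ℝ) 1, ∀ a ∈ Icc m 1, ∀ b ∈ Icc m 1, ∀ w : E,
      X.NormLE l (S a w - S b w) (C * |a - b| * m ^ (-1 - l) * ‖w‖) := by
  obtain ⟨C, hC1, hC⟩ := hS.exists_approx_smoothing (le_refl (0 : ℝ)) zero_le_one hl0 hl
  have key : ∀ m ∈ Ioc (0 : ℝ) 1, ∀ a ∈ Icc m 1, ∀ b ∈ Icc m 1, b ≤ a → ∀ w : E,
      X.NormLE l (S a w - S b w) (C * |a - b| * m ^ (-1 - l) * ‖w‖) := by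
    intro m hm a ha b hb hba w
    have hb0 : 0 < b := hm.1.trans_le hb.1
    have h := hC (a - b) ⟨by linarith, by linarith [ha.2]⟩ b ⟨hb0, hb.2⟩ w ‖w‖
      (normLE_zero_iff.2 le_rfl)
    rw [hS.apply_apply (by linarith) hb0.le, sub_add_cancel, zero_sub] at h
    rw [abs_of_nonneg (by linarith)]
    refine h.mono ?_
    have := Real.rpow_le_rpow_of_nonpos hm.1 hb.1 (show -1 - l ≤ 0 by linarith)
    have : 0 ≤ a - b := by linarith
    gcongr
  refine ⟨C, hC1, fun m hm a ha b hb w => ?_⟩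
  rcases le_total b a with h | h
  · exact key m hm a ha b hb h w
  · rw [abs_sub_comm]
    exact (key m hm b hb a ha h w).sub_comm

theorem contAt_apply (hS : X.IsSmoothingSemigroup S A) (hl0 : 0 ≤ l) (hl : l < 2) {a : P → ℝ}
    (ha : ContinuousWithinAt a D p) (hap : 0 < a p) (hp : p ∈ D) (ha1 : ∀ q ∈ D, a q ≤ 1)
    (hf : ContinuousWithinAt f D p) : X.ContAt l D (fun q => S (a q) (f q)) p := fun ε hε => by
  obtain ⟨C, hC1, hC⟩ := hS.exists_time_lipschitz hl0 hl
  obtain ⟨L, hL1, hL⟩ := hS.exists_smoothing (le_refl (0 : ℝ)) hl0 hl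
  set m := a p / 2 with hm
  have hm0 : 0 < m := half_pos hap
  have hmp : m < a p := half_lt_self hap
  have h1 : Tendsto (fun q => L * m ^ (0 - l) * ‖f q - f p‖
      + C * |a q - a p| * m ^ (-1 - l) * ‖f p‖) (𝓝[D] p) (𝓝 (L * m ^ (0 - l) * ‖f p - f p‖
      + C * |a p - a p| * m ^ (-1 - l) * ‖f p‖)) :=
    (((hf.tendsto.sub_const _).norm).const_mul _).add
      (((((ha.tendsto.sub_const _).abs).const_mul C).mul_const _).mul_const _)
  simp only [sub_self, norm_zero, abs_zero, mul_zero, zero_mul, add_zero] at h1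
  filter_upwards [h1.eventually_lt_const hε, self_mem_nhdsWithin,
    ha.tendsto.eventually_const_lt hmp] with q hq hqD hqm
  have e : S (a q) (f q) - S (a p) (f p)
      = S (a q) (f q - f p) + (S (a q) (f p) - S (a p) (f p)) := by rw [map_sub]; abel
  rw [e]
  have h2 := hL (a q) ⟨hm0.trans hqm, ha1 q hqD⟩ _ _ (normLE_zero_iff.2 (le_refl ‖f q - f p‖))
  have h3 := hC m ⟨hm0, hmp.le.trans (ha1 p hp)⟩ (a q) ⟨hqm.le, ha1 q hqD⟩ (a p)
    ⟨hmp.le, ha1 p hp⟩ (f p)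
  refine (h2.add h3).mono (le_trans ?_ hq.le)
  have := Real.rpow_le_rpow_of_nonpos hm0 hqm.le (show 0 - l ≤ 0 by linarith)
  gcongr

end IsSmoothingSemigroup

end BanachScale

/-! ### Continuity of solutions at positive times -/

namespace BanachScale.IsSmoothingSemigroup

variable {E : Type u} [NormedAddCommGroup E] [NormedSpace ℝ E] {X : BanachScale.{u, v} E}
  {S : ℝ → E →L[ℝ] E} {A : E →ₗ.[ℝ] E} {σ : E → E} {η α ρ γ ω H U : ℝ} {x : ℝ → ℝ} {y : ℝ → E}

theorem locHolder_nonlinearSolution (hS : X.IsSmoothingSemigroup S A)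
    (hσ : X.IsAdmissibleNonlinearity σ α ω) (he : IsExponentTriple η α ρ) (hγ : 0 ≤ γ)
    (hγα : γ ≤ α) (hγη : γ < η - α) (hH : 0 ≤ H)
    (hx : ∀ r q, 0 ≤ r → r ≤ q → q ≤ 1 → |x q - x r| ≤ H * (q - r) ^ η)
    (hy : X.NonlinearSolution S σ x α ρ γ 1 y) (hyU : X.NormLE (α - γ) (y 0) U) {l : ℝ}
    (hlα : α ≤ l) (hl : l < 2) (hlη : l < η + α) : X.LocHolder l (η + α - l) y := by
  have hα : 0 < α := he.pos.trans_le he.le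
  have hα2 : α < 2 := by linarith [he.lt, he.lt_one]
  have hl0 := hα.le.trans hlα
  have hU := hyU.nonneg
  obtain ⟨C₁, hC₁, h₁⟩ := hS.exists_increment_bounds hσ he hγ hγα hγη hH hx hU hα.le hα2
    (by linarith [he.lt])
  obtain ⟨C₂, hC₂, h₂⟩ := hS.exists_increment_bounds hσ he hγ hγα hγη hH hx hU hl0 hl hlη
  obtain ⟨C₃, hC₃, h₃⟩ := hS.exists_smooth_value_bound hσ he hγ hγα hγη hH hx hU le_rfl hα2
    (by linarith [he.lt])
  obtain ⟨C₄, hC₄, h₄⟩ := hS.exists_smooth_value_bound hσ he hγ hγα hγη hH hx hU hlα hl hlη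
  refine locHolder_of_normLE ⟨hl0, hl⟩ (by linarith) (fun t ht => ⟨_, h₄ y hy hyU t ht⟩)
    fun ε hε => ?_
  -- The increment bound starts at `2δ` because it looks back into the past of the path; the bounds
  -- collected below hold from `δ` on.
  set δ := ε / 2 with hδε
  have hδ : 0 < δ := half_pos hε.1
  have e1 : 0 ≤ C₁ * δ ^ (-γ) := by positivity
  have e2 : 0 ≤ C₂ * δ ^ (-γ) := by positivity
  have e3 : 0 ≤ C₃ * δ ^ (-γ) := by positivity
  have e4 : 0 ≤ C₄ * δ ^ (α - γ - l) := by positivity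
  have hpow : ∀ t, δ ≤ t → ∀ e : ℝ, e ≤ 0 → t ^ e ≤ δ ^ e := fun t ht e he' =>
    Real.rpow_le_rpow_of_nonpos hδ ht he'
  set N := C₁ * δ ^ (-γ) + C₂ * δ ^ (-γ) + C₃ * δ ^ (-γ) + C₄ * δ ^ (α - γ - l) with hN
  have b3 : ∀ t ∈ Icc δ 1, X.NormLE α (y t) N := fun t ht => by
    refine (h₃ y hy hyU t ⟨hδ.trans_le ht.1, ht.2⟩).mono ?_
    rw [sub_right_comm, sub_self, zero_sub]
    have : C₃ * t ^ (-γ) ≤ C₃ * δ ^ (-γ) :=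
      mul_le_mul_of_nonneg_left (hpow t ht.1 _ (by linarith)) (by linarith)
    linarith
  have b4 : ∀ t ∈ Icc δ 1, X.NormLE l (y t) N := fun t ht => by
    refine (h₄ y hy hyU t ⟨hδ.trans_le ht.1, ht.2⟩).mono ?_
    have : C₄ * t ^ (α - γ - l) ≤ C₄ * δ ^ (α - γ - l) :=
      mul_le_mul_of_nonneg_left (hpow t ht.1 _ (by linarith)) (by linarith)
    linarith
  have b1 : ∀ s t, δ ≤ s → s < t → t ≤ 1 →
      X.NormLE α (hatDeltaOne S y s t) (N * (t - s) ^ η) := fun s t hs hst ht => by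
    refine (h₁ y hy hyU s t (hδ.trans_le hs) hst ht).2.mono ?_
    rw [sub_self, max_self, sub_zero]
    have : C₁ * s ^ (-γ) ≤ C₁ * δ ^ (-γ) :=
      mul_le_mul_of_nonneg_left (hpow s hs _ (by linarith)) (by linarith)
    exact mul_le_mul_of_nonneg_right (by linarith) (Real.rpow_nonneg (by linarith) _)
  have b2 : ∀ s t, δ ≤ s → s < t → t ≤ 1 →
      X.NormLE l (hatDeltaOne S y s t) (N * (t - s) ^ (η + α - l)) := fun s t hs hst ht => by
    refine (h₂ y hy hyU s t (hδ.trans_le hs) hst ht).2.mono ?_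
    rw [max_eq_left (by linarith), show η - (l - α) = η + α - l by ring]
    have : C₂ * s ^ (-γ) ≤ C₂ * δ ^ (-γ) :=
      mul_le_mul_of_nonneg_left (hpow s hs _ (by linarith)) (by linarith)
    exact mul_le_mul_of_nonneg_right (by linarith) (Real.rpow_nonneg (by linarith) _)
  obtain ⟨C, hC0, hC⟩ := hS.exists_smooth_increment_bound hα.le (by linarith [he.lt, he.lt_one])
    he.lt_one hlα hl hlη hδ (by positivity) b3 b4 b1 b2
  exact ⟨C, hC0, fun s t hs hst ht => hC s t (by linarith) hst ht⟩

/-- For `l` below `α`, continuity is proved in `X_α` and embedded. -/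
theorem contOn_nonlinearSolution (hS : X.IsSmoothingSemigroup S A)
    (hσ : X.IsAdmissibleNonlinearity σ α ω) (he : IsExponentTriple η α ρ) (hγ : 0 ≤ γ)
    (hγα : γ ≤ α) (hγη : γ < η - α) (hH : 0 ≤ H)
    (hx : ∀ r q, 0 ≤ r → r ≤ q → q ≤ 1 → |x q - x r| ≤ H * (q - r) ^ η)
    (hy : X.NonlinearSolution S σ x α ρ γ 1 y) (hyU : X.NormLE (α - γ) (y 0) U) {l : ℝ}
    (hl0 : 0 ≤ l) (hl : l < 2) (hlη : l < η + α) : X.ContOn l (Ioc (0 : ℝ) 1) y := by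
  have hlη' : max l α < η + α := max_lt hlη (by linarith [he.lt_one, he.lt, he.le, he.pos])
  have hl' : max l α < 2 := max_lt hl (by linarith [he.lt, he.lt_one])
  exact (LocHolder.contOn (r := η + α - max l α) (by linarith) (hS.locHolder_nonlinearSolution hσ he hγ hγα hγη hH hx hy
    hyU (le_max_right _ _) hl' hlη')).embed hl0 (le_max_left _ _) hl'

end BanachScale.IsSmoothingSemigroup

/-! ### From mild solutions to germs -/

namespace BanachScale

variable {E : Type u} [NormedAddCommGroup E] [NormedSpace ℝ E] {X : BanachScale.{u, v} E}
  {S : ℝ → E →L[ℝ] E} {A : E →ₗ.[ℝ] E} {σ : E → E} {η α ρ γ ω H U : ℝ} {x : ℝ → ℝ} {y : ℝ → E}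
  {ψ : E}

namespace IsConvIntegral

variable {φ : ℝ → E} {k : ℝ → ℝ → E}

/-- For positive `r` this is the cocycle identity imposed on the sewing map; the case `r = 0`
follows from the limit that extends `k` to the initial time. -/
theorem split (hS : X.IsSmoothingSemigroup S A) (h : X.IsConvIntegral S 0 1 x φ k) {r s t : ℝ}
    (hr : 0 ≤ r) (hrs : r < s) (hst : s ≤ t) (ht : t ≤ 1) :
    k r t = k s t + S (t - s) (k r s) := by
  obtain ⟨α, β, η, ρ, γ, -, -, -, -, -, -, -, M, -, hM, hk, hlim, -⟩ := h
  have key : ∀ r, 0 < r → r < s → k r t = k s t + S (t - s) (k r s) := by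
    intro r hr hrs
    have h1 := hM r s t hr hrs.le hst ht
    simp only [hatDeltaTwo, deltaSTwo, map_sub] at h1
    rw [hS.apply_apply (by linarith) (by linarith), hS.apply_apply (by linarith) (by linarith),
      sub_add_sub_cancel] at h1
    rw [hk r t hr (by linarith) ht, hk s t (by linarith) hst ht, hk r s hr hrs.le (by linarith),
      map_sub, hS.apply_apply (by linarith) (by linarith), sub_add_sub_cancel]
    rw [← sub_eq_zero] at h1 ⊢
    rw [← neg_eq_zero, ← h1]
    abel
  rcases hr.eq_or_lt with rfl | hr
  swap
  · exact key r hr hrs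
  have h1 := hlim t ⟨by linarith, ht⟩
  have h2 := (((S (t - s)).continuous.tendsto _).comp (hlim s ⟨hrs, by linarith⟩)).const_add (k s t)
  refine tendsto_nhds_unique h1 (h2.congr' ?_)
  filter_upwards [Ioo_mem_nhdsGT hrs] with r hr
  exact (key r hr.1 hr.2).symm

/-- The bound on the sewing map with `ε = 0`, read in `E`, is a germ estimate of order `η + ρ > 1`.
-/
theorem exists_remainder_bound (h : X.IsConvIntegral S 0 1 x φ k) {s : ℝ} (hs : 0 < s) (hs1 : s < 1) :
    ∃ C p : ℝ, 0 ≤ C ∧ 1 < p ∧ ∀ r q, s ≤ r → r ≤ q → q ≤ 1 →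
      ‖k r q - S (q - r) ((x q - x r) • φ r)‖ ≤ C * (q - r) ^ p := by
  obtain ⟨α, β, η, ρ, γ, ⟨hβ0, hβα, hα, -⟩, -, hρ, -, -, -, -, M, hM, -, hk, -, -⟩ := h
  have hβ2 : β < 2 := by linarith
  obtain ⟨-, hd, C, hC⟩ := hM s ⟨hs, by linarith⟩ 0 ⟨le_rfl, one_pos⟩ (by linarith)
  rw [add_zero, zero_add, sub_zero] at *
  obtain ⟨K, hK1, hK⟩ := X.exists_normLE_embed le_rfl hβ0 hβ2
  refine ⟨K * |C|, η + ρ, by positivity, by linarith [hρ.1], fun r q hr hrq hq => ?_⟩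
  have e : k r q - S (q - r) ((x q - x r) • φ r) = -M r q := by
    rw [hk r q (by linarith) hrq hq]; abel
  have hp := Real.rpow_nonneg (show 0 ≤ q - r by linarith) (η + ρ)
  rw [e, norm_neg]
  rcases hrq.eq_or_lt with rfl | hrq
  · rw [hd r ⟨hr, hq⟩, norm_zero]
    positivity
  have h1 := normLE_zero_iff.1 (hK _ _ (hC r q hr hrq hq))
  refine h1.trans ?_
  rw [mul_assoc]
  have := le_abs_self C
  gcongr

end IsConvIntegral

/-- A plain increment is `δ̂₁y(s,t)`, which carries no weight, plus `(S(t-s) - I)y(s)`, which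
carries the weight `γ`; both fit under the weight `γ + ρ`. -/
theorem MemY.exists_forcingBound (hS : X.IsSmoothingSemigroup S A) (he : IsExponentTriple η α ρ)
    (hγ : 0 ≤ γ) (h : X.MemY S α γ y) : ∃ N, 0 ≤ N ∧ X.ForcingBound α ρ γ 0 1 N y := by
  have hρ := he.pos
  have hα : 0 < α := hρ.trans_le he.le
  have hα1 : α ≤ 1 := by linarith [he.lt, he.lt_one]
  obtain ⟨⟨-, C₁, h₁⟩, -, -, -, C₂, h₂⟩ := h
  obtain ⟨D, hD1, hD⟩ := hS.exists_norm_sub_le hα hα1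
  obtain ⟨K, hK1, hK⟩ := X.exists_normLE_embed le_rfl hα.le (by linarith)
  refine ⟨|C₁| + K * |C₂| + D * |C₁|, by positivity, fun s hs => (h₁ s hs).mono ?_,
    fun s t hs hst ht => ?_⟩
  · have := Real.rpow_nonneg (show 0 ≤ s - 0 by linarith [hs.1]) (-γ)
    have h3 : 0 ≤ K * |C₂| + D * |C₁| := by positivity
    exact mul_le_mul_of_nonneg_right (by linarith [le_abs_self C₁]) this
  have hts : 0 < t - s := by linarith
  have hd := normLE_zero_iff.1 (hK _ _ (h₂ s t hs.le hst ht))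
  have ha := hD (t - s) ⟨hts.le, by linarith⟩ _ _ (h₁ s ⟨hs, by linarith⟩)
  rw [sub_zero] at ha ⊢
  have e1 : (t - s) ^ α ≤ (t - s) ^ ρ :=
    Real.rpow_le_rpow_of_exponent_ge hts (by linarith) he.le
  have e2 : s ^ (-γ) ≤ s ^ (-γ - ρ) :=
    Real.rpow_le_rpow_of_exponent_ge hs (by linarith) (by linarith)
  have e3 : 1 ≤ s ^ (-γ - ρ) := (one_le_rpow_neg hs (by linarith) hγ).trans e2
  have e4 := Real.rpow_nonneg hts.le ρ
  have e5 := Real.rpow_nonneg hts.le α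
  have e6 := Real.rpow_nonneg hs.le (-γ)
  rw [sub_eq_hatDeltaOne_add S y s t]
  calc _ ≤ K * (C₂ * (t - s) ^ α) + D * (t - s) ^ α * (C₁ * s ^ (-γ)) :=
        (norm_add_le _ _).trans (add_le_add hd ha)
    _ ≤ K * (|C₂| * (t - s) ^ α) * 1 + D * (t - s) ^ α * (|C₁| * s ^ (-γ)) := by
        rw [mul_one]
        have := le_abs_self C₁
        have := le_abs_self C₂
        gcongr
    _ ≤ K * (|C₂| * (t - s) ^ ρ) * s ^ (-γ - ρ)
        + D * (t - s) ^ ρ * (|C₁| * s ^ (-γ - ρ)) := by gcongr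
    _ ≤ |C₁| * ((t - s) ^ ρ * s ^ (-γ - ρ)) + (K * (|C₂| * (t - s) ^ ρ) * s ^ (-γ - ρ)
        + D * (t - s) ^ ρ * (|C₁| * s ^ (-γ - ρ))) := le_add_of_nonneg_left (by positivity)
    _ = _ := by ring

theorem IsMildSolution.apply_zero (hS : X.IsSmoothingSemigroup S A)
    (h : X.IsMildSolution S σ x ψ y) : y 0 = ψ := by
  obtain ⟨k, ⟨_, _, _, _, _, -, -, -, -, -, -, -, _, -, -, -, -, hk⟩, hy⟩ := h
  rw [hy 0 ⟨le_rfl, zero_le_one⟩, hk, add_zero, hS.apply_zero]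

/-- Additivity of the integral gives `δ̂₁y = k` at positive times. The remainder bound for `k` is
then the germ condition, and the limit extending `k` to `0` becomes the weak initial condition. -/
theorem IsMildSolution.nonlinearSolution (hS : X.IsSmoothingSemigroup S A)
    (he : IsExponentTriple η α ρ) (h : X.IsMildSolution S σ x ψ y) (hY : X.MemY S α γ y)
    (hγ : 0 ≤ γ) : X.NonlinearSolution S σ x α ρ γ 1 y := by
  have hy0 := h.apply_zero hS
  obtain ⟨k, hk, hy⟩ := h
  have hkδ : ∀ s t, 0 < s → s ≤ t → t ≤ 1 → hatDeltaOne S y s t = k s t := by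
    intro s t hs hst ht
    rw [hatDeltaOne, hy t ⟨by linarith, ht⟩, hy s ⟨hs.le, by linarith⟩, map_add,
      hS.apply_apply (by linarith) hs.le, sub_add_cancel, hk.split hS le_rfl hs hst ht]
    abel
  refine ⟨⟨fun s hs => ?_, fun t ht => ?_⟩, hY.exists_forcingBound hS he hγ⟩
  · rcases hs.2.eq_or_lt with rfl | hs1
    · refine ⟨0, 2, le_rfl, one_lt_two, fun r q hr hrq hq => ?_⟩
      obtain rfl : r = 1 := by linarith
      obtain rfl : q = 1 := by linarith
      rw [germRemainder, hS.hatDeltaOne_self, sub_self (x 1), zero_smul, map_zero, sub_zero,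
        norm_zero, zero_mul]
    · obtain ⟨C, p, hC, hp, hb⟩ := hk.exists_remainder_bound hs.1 hs1
      refine ⟨C, p, hC, hp, fun r q hr hrq hq => ?_⟩
      rw [germRemainder, hkδ r q (hs.1.trans_le hr) hrq hq]
      exact hb r q hr hrq hq
  · obtain ⟨_, _, _, _, _, -, -, -, -, -, -, -, _, -, -, -, hlim, -⟩ := hk
    have h1 := (hlim t ht).const_sub (y t)
    have e : y t - k 0 t = S (t - 0) (y 0) := by
      rw [hy t ⟨ht.1.le, ht.2⟩, add_sub_cancel_right, hy0, sub_zero]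
    rw [e] at h1
    refine h1.congr' ?_
    filter_upwards [Ioo_mem_nhdsGT ht.1] with s hs
    rw [← hkδ s t hs.1 hs.2.le ht.2, hatDeltaOne, sub_sub_cancel]

end BanachScale

/-! ### From germs to mild solutions in the space `Y` -/

namespace BanachScale

variable {E : Type u} [NormedAddCommGroup E] [NormedSpace ℝ E] {X : BanachScale.{u, v} E}
  {S : ℝ → E →L[ℝ] E} {A : E →ₗ.[ℝ] E} {σ : E → E} {η α ρ γ ω H U l : ℝ} {x : ℝ → ℝ} {y : ℝ → E}

theorem ContOn.contAt_comp {P Q : Type*} [TopologicalSpace P] [TopologicalSpace Q] {D : Set P}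
    {D' : Set Q} {f : P → E} {a : Q → P} {q : Q} (h : X.ContOn l D f)
    (ha : ContinuousWithinAt a D' q) (hq : a q ∈ D) (hD : ∀ᶠ q' in 𝓝[D'] q, a q' ∈ D) :
    X.ContAt l D' (fun q => f (a q)) q := fun _ hε =>
  (tendsto_nhdsWithin_iff.2 ⟨ha, hD⟩).eventually (h.eventually_normLE hq hε)

theorem MemIncr.neg {r a b : ℝ} {F : ℝ → ℝ → E} (h : X.MemIncr l r a b F) :
    X.MemIncr l r a b (fun s t => -F s t) := by
  obtain ⟨⟨g, hg, hgF⟩, h0, C, hC⟩ := h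
  exact ⟨⟨fun p => -g p, hg.neg, fun p hp => by rw [map_neg, hgF p hp]⟩,
    fun s hs => by simp only [h0 s hs, neg_zero], C, fun s t hs hst ht => (hC s t hs hst ht).neg⟩

theorem IsAdmissibleNonlinearity.contOn_comp {P : Type*} [TopologicalSpace P] {D : Set P}
    {f : P → E} (hσ : X.IsAdmissibleNonlinearity σ α ω) (hα : α ∈ Ico (0 : ℝ) 2)
    (hf : X.ContOn α D f) : X.ContOn α D (fun p => σ (f p)) := by
  obtain ⟨G, hG1, hG⟩ := hσ.exists_growth
  obtain ⟨K, hK1, hK⟩ := hσ.exists_local_lipschitz hα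
  refine contOn_of_normLE hα (fun p hp => ?_) fun p hp ε hε => ?_
  · obtain ⟨c, hc⟩ := hf.exists_normLE hp
    exact ⟨_, hG _ _ hc⟩
  · obtain ⟨c, hc⟩ := hf.exists_normLE hp
    have hc0 := hc.nonneg
    have hM : 0 < K * (1 + (c + 1)) ^ ω := by positivity
    filter_upwards [hf.eventually_normLE hp (lt_min one_pos (div_pos hε hM))] with q hq
    have hqc : X.NormLE α (f q) (c + 1) := by
      have := hc.add (hq.mono (min_le_left _ _))
      rwa [add_sub_cancel] at this
    refine (hK (c + 1) (by linarith) _ _ _ hqc (hc.mono (by linarith)) hq).mono ?_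
    calc _ ≤ K * (1 + (c + 1)) ^ ω * (ε / (K * (1 + (c + 1)) ^ ω)) := by
          gcongr
          exact min_le_right _ _
      _ = ε := mul_div_cancel₀ _ hM.ne'

namespace IsSmoothingSemigroup

theorem contAt_hatDeltaOne (hS : X.IsSmoothingSemigroup S A) (hl0 : 0 ≤ l) (hl : l < 2)
    {D : Set (ℝ × ℝ)} (hD : ∀ p ∈ D, 0 ≤ p.1 ∧ p.1 ≤ p.2 ∧ p.2 ≤ 1) {f : ℝ → E}
    (hf : X.ContOn l (Ioc (0 : ℝ) 1) f) {p : ℝ × ℝ} (hp : p ∈ D) (hp1 : 0 < p.1)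
    (hp2 : p.1 < p.2) : X.ContAt l D (fun q => hatDeltaOne S f q.1 q.2) p := by
  have hp3 := (hD p hp).2.2
  have c1 : ContinuousWithinAt (fun q : ℝ × ℝ => q.1) D p := continuous_fst.continuousWithinAt
  have c2 : ContinuousWithinAt (fun q : ℝ × ℝ => q.2) D p := continuous_snd.continuousWithinAt
  have m1 : ∀ᶠ q in 𝓝[D] p, q.1 ∈ Ioc (0 : ℝ) 1 := by
    filter_upwards [c1.tendsto.eventually_const_lt hp1, self_mem_nhdsWithin] with q hq hqD
    exact ⟨hq, by linarith [(hD q hqD).2.1, (hD q hqD).2.2]⟩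
  have m2 : ∀ᶠ q in 𝓝[D] p, q.2 ∈ Ioc (0 : ℝ) 1 := by
    filter_upwards [m1, self_mem_nhdsWithin] with q hq hqD
    exact ⟨hq.1.trans_le (hD q hqD).2.1, (hD q hqD).2.2⟩
  have h1 : ContinuousWithinAt (fun q : ℝ × ℝ => f q.1) D p :=
    (hf.continuousOn p.1 ⟨hp1, by linarith⟩).tendsto.comp (tendsto_nhdsWithin_iff.2 ⟨c1, m1⟩)
  exact (hf.contAt_comp c2 ⟨by linarith, hp3⟩ m2).sub
    (hS.contAt_apply hl0 hl (c2.sub c1) (by linarith) hp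
      (fun q hq => by linarith [(hD q hq).1, (hD q hq).2.2]) h1)

theorem contAt_germ (hS : X.IsSmoothingSemigroup S A) (hl0 : 0 ≤ l) (hl : l < 2)
    {D : Set (ℝ × ℝ)} (hD : ∀ p ∈ D, 0 < p.1 ∧ p.1 ≤ p.2 ∧ p.2 ≤ 1) {f : ℝ → E}
    (hf : ContinuousOn f (Ioc (0 : ℝ) 1)) (hx : ContinuousOn x (Icc 0 1)) {p : ℝ × ℝ} (hp : p ∈ D)
    (hp2 : p.1 < p.2) : X.ContAt l D (fun q => S (q.2 - q.1) ((x q.2 - x q.1) • f q.1)) p := by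
  have c1 : ContinuousOn (fun q : ℝ × ℝ => q.1) D := continuous_fst.continuousOn
  have c2 : ContinuousOn (fun q : ℝ × ℝ => q.2) D := continuous_snd.continuousOn
  have hD' : ∀ q ∈ D, 0 < q.1 ∧ q.1 ≤ 1 ∧ 0 < q.2 ∧ q.2 ≤ 1 := fun q hq => by
    obtain ⟨h1, h2, h3⟩ := hD q hq
    exact ⟨h1, by linarith, by linarith, h3⟩
  refine hS.contAt_apply hl0 hl ((c2 p hp).sub (c1 p hp)) (sub_pos.2 hp2) hp
    (fun q hq => by linarith [(hD q hq).1, (hD q hq).2.2]) (ContinuousOn.smul (ContinuousOn.sub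
      (hx.comp c2 fun q hq => ?_) (hx.comp c1 fun q hq => ?_)) (hf.comp c1 fun q hq => ?_) p hp)
  · exact ⟨(hD' q hq).2.2.1.le, (hD' q hq).2.2.2⟩
  · exact ⟨(hD' q hq).1.le, (hD' q hq).2.1⟩
  · exact ⟨(hD' q hq).1, (hD' q hq).2.1⟩

/-- Continuity on the closed triangle has three cases: the diagonal, by the power bound; the
interior, by smoothing; and `s = 0 < t`, by `δ̂₁y(s,t) = y(t) - S(t)y(0) - S(t-s)δ̂₁y(0,s)`, whose
last term tends to zero with `s`. -/
theorem memIncr_hatDeltaOne (hS : X.IsSmoothingSemigroup S A) (hl0 : 0 ≤ l) (hl : l < 2)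
    {κ r C : ℝ} (hr : r ≤ κ) (hκ : 0 < κ) (hC0 : 0 ≤ C) (hy : X.ContOn l (Ioc (0 : ℝ) 1) y)
    (hC : ∀ s t, 0 ≤ s → s < t → t ≤ 1 → X.NormLE l (hatDeltaOne S y s t) (C * (t - s) ^ κ)) :
    X.MemIncr l r 0 1 (hatDeltaOne S y) := by
  have hC' : ∀ s t, 0 ≤ s → s ≤ t → t ≤ 1 →
      X.NormLE l (hatDeltaOne S y s t) (C * (t - s) ^ κ) := by
    intro s t hs hst ht
    rcases hst.eq_or_lt with rfl | hst
    · rw [hS.hatDeltaOne_self]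
      exact normLE_zero_vector (mul_nonneg hC0 (Real.rpow_nonneg (by linarith) _))
    · exact hC s t hs hst ht
  refine ⟨contOn_of_normLE ⟨hl0, hl⟩ (fun p hp => ⟨_, hC' p.1 p.2 hp.1 hp.2.1 hp.2.2⟩)
    fun p hp => ?_, fun s _ => hS.hatDeltaOne_self y s, C, fun s t hs hst ht =>
    (hC s t hs hst ht).mono ?_⟩
  swap
  · have := Real.rpow_le_rpow_of_exponent_ge (show 0 < t - s by linarith) (by linarith) hr
    gcongr
  set D : Set (ℝ × ℝ) := {p | 0 ≤ p.1 ∧ p.1 ≤ p.2 ∧ p.2 ≤ 1} with hD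
  have c1 : ContinuousWithinAt (fun q : ℝ × ℝ => q.1) D p := continuous_fst.continuousWithinAt
  have c2 : ContinuousWithinAt (fun q : ℝ × ℝ => q.2) D p := continuous_snd.continuousWithinAt
  change X.ContAt l D (fun q => hatDeltaOne S y q.1 q.2) p
  obtain ⟨hp0, hp1, hp2⟩ := hp
  rcases hp1.eq_or_lt with heq | hlt
  · refine contAt_of_normLE_rpow (K := C) (a := fun q => q.2 - q.1) (c2.sub c1) hκ (by linarith)
      (by rw [heq]; exact hS.hatDeltaOne_self y _) ?_
    filter_upwards [self_mem_nhdsWithin] with q hq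
    exact hC' q.1 q.2 hq.1 hq.2.1 hq.2.2
  rcases hp0.eq_or_lt with heq | hpos
  swap
  · exact hS.contAt_hatDeltaOne hl0 hl (fun q hq => hq) hy ⟨hp0, hp1, hp2⟩ hpos hlt
  obtain ⟨L, hL1, hL⟩ := hS.exists_bound hl0 hl
  have hp2' : 0 < p.2 := by linarith
  have h1 : X.ContAt l D (fun q => y q.2) p := by
    refine hy.contAt_comp c2 ⟨hp2', hp2⟩ ?_
    filter_upwards [c2.tendsto.eventually_const_lt hp2', self_mem_nhdsWithin] with q hq hqD
    exact ⟨hq, hqD.2.2⟩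
  have h2 : X.ContAt l D (fun q => S q.2 (y 0)) p :=
    hS.contAt_apply hl0 hl c2 hp2' ⟨hp0, hp1, hp2⟩ (fun q hq => hq.2.2) continuousWithinAt_const
  have h3 : X.ContAt l D (fun q => S (q.2 - q.1) (hatDeltaOne S y 0 q.1)) p := by
    refine contAt_of_normLE_rpow (K := L * C) (r := κ) c1 hκ heq.symm ?_ ?_
    · rw [← heq, hS.hatDeltaOne_self, map_zero]
    · filter_upwards [self_mem_nhdsWithin] with q hq
      have := hL (q.2 - q.1) ⟨by linarith [hq.2.1], by linarith [hq.1, hq.2.2]⟩ _ _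
        (hC' 0 q.1 le_rfl hq.1 (hq.2.1.trans hq.2.2))
      rwa [sub_zero, ← mul_assoc] at this
  refine ((h1.sub h2).sub h3).congr (fun q hq => ?_) ⟨hp0, hp1, hp2⟩
  have e := hS.hatDeltaOne_split y hq.1 hq.2.1
  rw [eq_sub_iff_add_eq, ← e, hatDeltaOne, sub_zero]

theorem memY_nonlinearSolution (hS : X.IsSmoothingSemigroup S A)
    (hσ : X.IsAdmissibleNonlinearity σ α ω) (he : IsExponentTriple η α ρ) (hγ : 0 ≤ γ)
    (hγα : γ ≤ α) (hγη : γ < η - α) (hH : 0 ≤ H)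
    (hx : ∀ r q, 0 ≤ r → r ≤ q → q ≤ 1 → |x q - x r| ≤ H * (q - r) ^ η)
    (hy : X.NonlinearSolution S σ x α ρ γ 1 y) (hyU : X.NormLE (α - γ) (y 0) U) :
    X.MemY S α γ y := by
  have hα : 0 < α := he.pos.trans_le he.le
  have hα2 : α < 2 := by linarith [he.lt, he.lt_one]
  have hcont : ∀ l, 0 ≤ l → l ≤ α → X.ContOn l (Ioc (0 : ℝ) 1) y := fun l hl0 hl =>
    hS.contOn_nonlinearSolution hσ he hγ hγα hγη hH hx hy hyU hl0 (by linarith)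
      (by linarith [he.lt])
  obtain ⟨C, hC1, hC⟩ := hS.exists_hatDeltaOne_bound hσ he hγ hγα hγη hH hx hyU.nonneg
  have hC := hC y hy hyU
  obtain ⟨R, hR1, hR⟩ := hS.exists_bounds_global hσ he hγ hγα hγη hH hx hyU.nonneg
  obtain ⟨K, hK1, hK⟩ := X.exists_normLE_embed le_rfl hα.le hα2
  obtain ⟨L, hL1, hL⟩ := hS.exists_norm_bound
  refine ⟨⟨hcont α hα.le le_rfl, R, fun t ht => ?_⟩, ⟨hcont 0 le_rfl hα.le,
    K * C + L * ‖y 0‖, fun t ht => ?_⟩, hS.memIncr_hatDeltaOne hα.le hα2 (by linarith)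
      (by linarith) (by linarith) (hcont α hα.le le_rfl) hC⟩
  · rw [sub_zero]
    exact (hR 1 ⟨one_pos, le_rfl⟩ y hy hyU).1 t ht
  · rw [neg_zero, Real.rpow_zero, mul_one, normLE_zero_iff, ← add_hatDeltaOne S y 0 t]
    refine (norm_add_le _ _).trans (add_le_add ?_ (hL _ ⟨by linarith [ht.1], by linarith [ht.2]⟩ _))
    refine (normLE_zero_iff.1 (hK _ _ (hC 0 t le_rfl ht.1 ht.2))).trans ?_
    have : (t - 0) ^ (η - γ) ≤ 1 :=
      Real.rpow_le_one (by linarith [ht.1]) (by linarith [ht.2]) (by linarith)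
    gcongr
    exact mul_le_of_le_one_right (by linarith) this

theorem memIncrSing_hatDeltaOne (hS : X.IsSmoothingSemigroup S A) {f : ℝ → E} {r B : ℝ}
    (hr : 0 < r) (hγ : 0 ≤ γ) (hB : 0 ≤ B) (hf : X.ContOn 0 (Ioc (0 : ℝ) 1) f)
    (h : ∀ s t, 0 < s → s ≤ t → t ≤ 1 →
      ‖hatDeltaOne S f s t‖ ≤ B * s ^ (-γ) * (t - s) ^ r) :
    X.MemIncrSing 0 r γ 0 1 (hatDeltaOne S f) := by
  refine ⟨contOn_of_normLE ⟨le_rfl, two_pos⟩ (fun p _ => ⟨_, normLE_zero_iff.2 le_rfl⟩)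
    fun p hp => ?_, fun s _ => hS.hatDeltaOne_self _ s, B, fun s t hs hst ht => ?_⟩
  swap
  · rw [sub_zero, normLE_zero_iff]
    exact h s t hs hst.le ht
  obtain ⟨hp0, hp1, hp2⟩ := hp
  rcases hp1.eq_or_lt with heq | hlt
  swap
  · exact hS.contAt_hatDeltaOne le_rfl two_pos (fun q hq => ⟨hq.1.le, hq.2⟩) hf ⟨hp0, hp1, hp2⟩
      hp0 hlt
  have hp02 : 0 < p.1 / 2 := half_pos hp0
  refine contAt_of_normLE_rpow (f := fun q : ℝ × ℝ => hatDeltaOne S f q.1 q.2)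
    (K := B * (p.1 / 2) ^ (-γ)) (a := fun q => q.2 - q.1)
    (continuous_snd.sub continuous_fst).continuousWithinAt hr (by linarith)
    (by simp only [heq]; exact hS.hatDeltaOne_self _ _) ?_
  filter_upwards [self_mem_nhdsWithin, nhdsWithin_le_nhds
    (continuous_fst.continuousAt.eventually_const_lt (half_lt_self hp0))] with q hq hq1
  refine normLE_zero_iff.2 ((h q.1 q.2 hq.1 hq.2.1 hq.2.2).trans ?_)
  have := Real.rpow_le_rpow_of_nonpos hp02 hq1.le (show -γ ≤ 0 by linarith)
  have := Real.rpow_nonneg (sub_nonneg.2 hq.2.1) r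
  gcongr

theorem memIncr_germRemainder (hS : X.IsSmoothingSemigroup S A) (hl0 : 0 ≤ l) (hl : l < 2)
    {φ : ℝ → E} {r τ C : ℝ} (hr : 0 < r) (hτ : 0 < τ) (hγ : 0 ≤ γ) (hC0 : 0 ≤ C)
    (hx : ContinuousOn x (Icc 0 1)) (hy : X.ContOn l (Ioc (0 : ℝ) 1) y)
    (hφ : ContinuousOn φ (Ioc (0 : ℝ) 1))
    (h : ∀ s t, 0 < s → s < t → t ≤ 1 →
      X.NormLE l (germRemainder S x y φ s t) (C * s ^ (-γ) * (t - s) ^ r)) :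
    X.MemIncr l r τ 1 (germRemainder S x y φ) := by
  have hself : ∀ s, germRemainder S x y φ s s = 0 := fun s => by
    rw [germRemainder, hS.hatDeltaOne_self, sub_self (x s), zero_smul, map_zero, sub_zero]
  have h' : ∀ s t, τ ≤ s → s ≤ t → t ≤ 1 →
      X.NormLE l (germRemainder S x y φ s t) (C * τ ^ (-γ) * (t - s) ^ r) := by
    intro s t hs hst ht
    have hp := Real.rpow_nonneg (sub_nonneg.2 hst) r
    rcases hst.eq_or_lt with rfl | hst
    · rw [hself]
      exact normLE_zero_vector (by positivity)
    · refine (h s t (hτ.trans_le hs) hst ht).mono ?_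
      have := Real.rpow_le_rpow_of_nonpos hτ hs (show -γ ≤ 0 by linarith)
      gcongr
  refine ⟨contOn_of_normLE ⟨hl0, hl⟩ (fun p hp => ⟨_, h' p.1 p.2 hp.1 hp.2.1 hp.2.2⟩)
    fun p hp => ?_, fun s _ => hself s, C * τ ^ (-γ), fun s t hs hst ht => h' s t hs hst.le ht⟩
  rcases hp.2.1.eq_or_lt with heq | hlt
  · refine contAt_of_normLE_rpow (f := fun q : ℝ × ℝ => germRemainder S x y φ q.1 q.2)
      (K := C * τ ^ (-γ)) (a := fun q => q.2 - q.1)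
      (continuous_snd.sub continuous_fst).continuousWithinAt hr (by linarith)
      (by simp only [heq]; exact hself _) ?_
    filter_upwards [self_mem_nhdsWithin] with q hq
    exact h' q.1 q.2 hq.1 hq.2.1 hq.2.2
  · have hp1 := hτ.trans_le hp.1
    exact (hS.contAt_hatDeltaOne hl0 hl (fun q hq => ⟨hτ.le.trans hq.1, hq.2⟩) hy hp hp1 hlt).sub
      (hS.contAt_germ hl0 hl (fun q hq => ⟨hτ.trans_le hq.1, hq.2⟩) hφ hx hp hlt)

theorem isMildSolution_nonlinearSolution (hS : X.IsSmoothingSemigroup S A)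
    (hσ : X.IsAdmissibleNonlinearity σ α ω) (he : IsExponentTriple η α ρ) (hγ : 0 ≤ γ)
    (hγα : γ ≤ α) (hγη : γ < η - α) (hH : 0 ≤ H)
    (hxη : ∃ C : NNReal, HolderOnWith C η.toNNReal x (Icc 0 1))
    (hx : ∀ r q, 0 ≤ r → r ≤ q → q ≤ 1 → |x q - x r| ≤ H * (q - r) ^ η)
    (hy : X.NonlinearSolution S σ x α ρ γ 1 y) (hyU : X.NormLE (α - γ) (y 0) U) :
    X.IsMildSolution S σ x (y 0) y := by
  have hα : 0 < α := he.pos.trans_le he.le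
  have hαη := he.lt
  have hη1 := he.lt_one
  have hα2 : α < 2 := by linarith
  have hηα : 1 < η + α := by linarith [he.one_lt, he.le]
  have hU := hyU.nonneg
  have hcont : ∀ l, 0 ≤ l → l ≤ 1 → X.ContOn l (Ioc (0 : ℝ) 1) y := fun l hl0 hl =>
    hS.contOn_nonlinearSolution hσ he hγ hγα hγη hH hx hy hyU hl0 (by linarith) (by linarith)
  have hxc : ContinuousOn x (Icc 0 1) := by
    obtain ⟨C, hC⟩ := hxη
    exact hC.continuousOn (Real.toNNReal_pos.2 (by linarith))
  have hσc := hσ.contOn_comp ⟨hα.le, hα2⟩ (hcont α hα.le (by linarith))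
  obtain ⟨R, hR1, hR⟩ := hS.exists_bounds_global hσ he hγ hγα hγη hH hx hU
  obtain ⟨hRα, hRi⟩ := hR 1 ⟨one_pos, le_rfl⟩ y hy hyU
  obtain ⟨G, hG1, hG⟩ := hσ.exists_growth
  obtain ⟨D, hD1, hD⟩ := hS.exists_hatDeltaOne_comp hσ hα (by linarith) hγ
  have hD := hD y R hR1 hRα hRi
  -- The integral is `δ̂₁y` and the sewing map is minus the germ remainder. The parameters are `α' =
  -- α`, `β = 0`, `η' = η`, `ρ' = α`, `γ' = γ`, for which the constraint on `γ'` reduces to `γ < η`.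
  refine ⟨hatDeltaOne S y, ⟨α, 0, η, α, γ, ⟨le_rfl, hα.le, hα2, by linarith⟩,
    ⟨by linarith, hη1⟩, ⟨by linarith, by linarith⟩, ⟨hγ, lt_min (by linarith) (by linarith)⟩, hxη,
    ⟨hσc, G * (2 * R), fun t ht => ?_⟩, hS.memIncrSing_hatDeltaOne hα hγ (by positivity)
      (hσc.embed le_rfl hα.le hα2) hD,
    fun s t => -germRemainder S x y (fun r => σ (y r)) s t, ?_, ?_, ?_, ?_, ?_⟩, ?_⟩
  · refine (hG _ _ (hRα t ht)).mono ?_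
    have h1 := one_le_rpow_neg ht.1 ht.2 hγ
    rw [sub_zero, mul_assoc, mul_assoc]
    gcongr
    nlinarith
  · rintro τ ⟨hτ, -⟩ ε ⟨hε0, hε1⟩ -
    obtain ⟨C, hC1, hC⟩ := hS.exists_increment_bounds hσ he hγ hγα (by linarith) hH hx hU hε0
      (show ε < 2 by linarith) (by linarith)
    rw [zero_add, zero_add]
    exact (hS.memIncr_germRemainder hε0 (by linarith) (by linarith) hτ hγ (by linarith) hxc
      (hcont ε hε0 hε1.le) hσc.continuousOn fun s t hs hst ht => (hC y hy hyU s t hs hst ht).1).neg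
  · intro r s t hr hrs hst ht
    simp only [hatDeltaTwo, deltaSTwo, germRemainder, map_sub, map_neg]
    rw [hS.hatDeltaOne_split y hrs hst, hS.apply_apply (by linarith) (by linarith),
      hS.apply_apply (by linarith) (by linarith), sub_add_sub_cancel]
    abel
  · intro s t _ _ _
    simp only [germRemainder, sub_neg_eq_add, add_sub_cancel]
  · intro t ht
    exact (hy.sol.2 t ht).const_sub (y t)
  · exact hS.hatDeltaOne_self y 0
  · intro t _
    rw [hatDeltaOne, sub_zero, add_sub_cancel]

end IsSmoothingSemigroup

end BanachScale

/-! ### The main theorem -/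

theorem theorem3p16
    {E : Type u} [NormedAddCommGroup E] [NormedSpace ℝ E] [CompleteSpace E]
    (X : BanachScale.{u, v} E) (S : ℝ → E →L[ℝ] E) (A : E →ₗ.[ℝ] E)
    (hS : X.IsSmoothingSemigroup S A)
    (η : ℝ) (hη : η ∈ Ioo (1 / 2 : ℝ) 1)
    (x : ℝ → ℝ) (hx : ∃ C : NNReal, HolderOnWith C η.toNNReal x (Icc 0 1))
    (α : ℝ) (hα : α ∈ Ioo (0 : ℝ) 1) (hηα : 1 < η + α)
    (ω : ℝ) (hω : 1 ≤ ω)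
    (σ : E → E) (hσ : X.IsAdmissibleNonlinearity σ α ω)
    (θ : ℝ) (hθ : θ ∈ Icc 0 α) (hηθ : α + (1 + ω) * (α - θ) < η) :
    (∀ ψ : X.Sp θ, ∃ y : ℝ → E,
      (X.IsMildSolution S σ x (X.incl θ ψ) y ∧ X.MemY S α (α - θ) y) ∧
      ∀ z : ℝ → E, X.IsMildSolution S σ x (X.incl θ ψ) z → X.MemY S α (α - θ) z →
        EqOn z y (Icc 0 1)) ∧
    (∀ (ψ : X.Sp θ) (y : ℝ → E),
      X.IsMildSolution S σ x (X.incl θ ψ) y → X.MemY S α (α - θ) y →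
      ∀ ρ ∈ Ico (η + α - 1) (η + α),
        X.ContOn ρ (Ioc (0 : ℝ) 1) y ∧ X.LocHolder ρ (min η (η + α - ρ)) y) ∧
    (∀ μ ∈ Ico 0 (η + α - 1), ∃ C : ℝ → ℝ, (∀ r, 0 < C r) ∧
      ∀ (ψ : X.Sp θ) (y : ℝ → E),
        X.IsMildSolution S σ x (X.incl θ ψ) y → X.MemY S α (α - θ) y →
        ∀ t ∈ Ioc (0 : ℝ) 1, X.NormLE (1 + μ) (y t) (C ‖ψ‖ * t ^ (θ - 1 - μ))) := by
  have hω1 : 0 < 1 + ω := by linarith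
  have hγ : 0 ≤ α - θ := by linarith [hθ.2]
  have hγα : α - θ ≤ α := by linarith [hθ.1]
  have hγη : (1 + ω) * (α - θ) < η - α := by linarith
  have hγη' : α - θ < η - α := by nlinarith
  have hαη : α < η := by linarith
  -- Such a `ρ` exists because `η + α > 1` and `α < η`, the latter being part of the assumption on
  -- `θ`.
  obtain ⟨ρ, hρ1, hρ2⟩ := exists_between (show 1 - η < min α (1 - α) from
    lt_min (by linarith) (by linarith))
  obtain ⟨hρα, hρα'⟩ := lt_min_iff.1 hρ2
  have he : BanachScale.IsExponentTriple η α ρ :=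
    ⟨by linarith, hη.2, hρα.le, hαη, by linarith⟩
  obtain ⟨H, hH, hxH⟩ : ∃ H : ℝ, 0 ≤ H ∧
      ∀ r q, 0 ≤ r → r ≤ q → q ≤ 1 → |x q - x r| ≤ H * (q - r) ^ η := by
    obtain ⟨C, hC⟩ := hx
    refine ⟨C, C.2, fun r q hr hrq hq => ?_⟩
    have h := hC.dist_le ⟨hr.trans hrq, hq⟩ ⟨hr, hrq.trans hq⟩
    rwa [Real.dist_eq, Real.dist_eq, abs_of_nonneg (sub_nonneg.2 hrq),
      Real.coe_toNNReal η (by linarith [hη.1])] at h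
  have hstart : ∀ ψ : X.Sp θ, X.NormLE (α - (α - θ)) (X.incl θ ψ) ‖ψ‖ := fun ψ => by
    rw [sub_sub_cancel]
    exact BanachScale.normLE_incl ψ
  have hsol : ∀ (ψ : X.Sp θ) (y : ℝ → E), X.IsMildSolution S σ x (X.incl θ ψ) y →
      X.MemY S α (α - θ) y → X.NonlinearSolution S σ x α ρ (α - θ) 1 y ∧
        y 0 = X.incl θ ψ ∧ X.NormLE (α - (α - θ)) (y 0) ‖ψ‖ := fun ψ y h1 h2 => by
    have h0 := h1.apply_zero hS
    exact ⟨h1.nonlinearSolution hS he h2 hγ, h0, h0 ▸ hstart ψ⟩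
  refine ⟨fun ψ => ?_, fun ψ y h1 h2 r hr => ?_, fun μ hμ => ?_⟩
  · obtain ⟨y, hy0, hy⟩ := hS.exists_nonlinearSolution hσ hω he hγ hγα hγη hH hxH (hstart ψ)
    have hyU : X.NormLE (α - (α - θ)) (y 0) ‖ψ‖ := hy0 ▸ hstart ψ
    refine ⟨y, ⟨?_, hS.memY_nonlinearSolution hσ he hγ hγα hγη' hH hxH hy hyU⟩,
      fun z hz1 hz2 => ?_⟩
    · rw [← hy0]
      exact hS.isMildSolution_nonlinearSolution hσ he hγ hγα hγη' hH hx hxH hy hyU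
    · obtain ⟨hz, hz0, hzU⟩ := hsol ψ z hz1 hz2
      exact hS.nonlinearSolution_unique hσ hω he hγ hγα hγη hH hxH ⟨one_pos, le_rfl⟩ hz hy hzU
        (hz0.trans hy0.symm)
  · obtain ⟨hy, -, hyU⟩ := hsol ψ y h1 h2
    have hr0 : 0 ≤ r := by linarith [hr.1]
    have hr2 : r < 2 := by linarith [hr.2, hη.2, hα.2]
    refine ⟨hS.contOn_nonlinearSolution hσ he hγ hγα hγη' hH hxH hy hyU hr0 hr2 hr.2, ?_⟩
    rcases le_total α r with h | h
    · rw [min_eq_right (by linarith)]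
      exact hS.locHolder_nonlinearSolution hσ he hγ hγα hγη' hH hxH hy hyU h hr2 hr.2
    -- Below `α` the exponent no longer improves: it is the exponent `η` found in `X_α`, transported
    -- by the embedding.
    · rw [min_eq_left (by linarith)]
      have := hS.locHolder_nonlinearSolution hσ he hγ hγα hγη' hH hxH hy hyU le_rfl
        (by linarith [hα.2]) (by linarith [hη.1])
      rw [add_sub_cancel_right] at this
      exact this.embed hr0 h (by linarith [hα.2])
  · have hC : ∀ r : ℝ, ∃ C : ℝ, 0 < C ∧ ∀ y : ℝ → E,
        X.NonlinearSolution S σ x α ρ (α - θ) 1 y → X.NormLE (α - (α - θ)) (y 0) r →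
        ∀ t ∈ Ioc (0 : ℝ) 1, X.NormLE (1 + μ) (y t) (C * t ^ (θ - 1 - μ)) := by
      intro r
      -- Only `r = ‖ψ‖` is used later; the absolute value provides a constant for every real `r`,
      -- fixed before `ψ`.
      obtain ⟨C, hC1, hC⟩ := hS.exists_smooth_value_bound hσ he hγ hγα hγη' hH hxH (abs_nonneg r)
        (show α ≤ 1 + μ by linarith [hα.2, hμ.1]) (by linarith [hμ.2, hη.2, hα.2])
        (by linarith [hμ.2])
      refine ⟨C, by linarith, fun y hy hyr t ht => ?_⟩
      have := hC y hy (hyr.mono (le_abs_self r)) t ht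
      rwa [sub_sub_cancel, ← sub_sub] at this
    choose C hC0 hC using hC
    refine ⟨C, hC0, fun ψ y h1 h2 => ?_⟩
    obtain ⟨hy, -, hyU⟩ := hsol ψ y h1 h2
    exact hC _ y hy hyU
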